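/- Let $K$ be a non-archimedean local field with ring of integers $\mathcal{O}$ and residue field $k$, let $L/K$ be a finite Galois extension with Galois group $\Gamma$ and ring of integers $\mathcal{O}_L$, and let $I\subseteq\Gamma$ be the inertia subgroup, i.e. the subgroup of elements acting trivially on $\mathcal{O}_L/\mathfrak{P}$, where $\mathfrak{P}$ is the maximal ideal of $\mathcal{O}_L$. Let $T=\operatorname{Spec} B$ be an algebraic $K$-torus split by $L$, i.e. $T\otimes_K L\cong\mathbb{G}_{m,L}^d$ for some $d\geq 0$, and let $X^\bullet(T)=\operatorname{Hom}_L(T\otimes_K L,\mathbb{G}_{m,L})$ be its character group, a $\Gamma$-module. The standard integral model of $T$ is the affine group scheme over $\mathcal{O}$ whose coordinate ring is the $\mathcal{O}$-subalgebra of $B$ generated by the coordinates, with respect to an $\mathcal{O}$-basis of $\mathcal{O}_L$, of all characters $\chi\in X^\bullet(T)\subset L\otimes_K B$. Its smoothening is the smooth affine group scheme over $\mathcal{O}$, together with a homomorphism to the standard model, through which every morphism from a smooth $\mathcal{O}$-scheme to the standard model factors uniquely. The torus $T$ has good reduction if the identity component of the special fibre of this smoothened standard model is a torus over $k$. The same definition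 is applied to the subtori of $T$, which are all split by $L$. An isogeny is a surjective homomorphism of algebraic groups with finite kernel. Then there is a largest subtorus $T_I$ of $T$ with good reduction (it contains every subtorus of $T$ with good reduction); there is a factor torus $T\to T^I$ for which pull-back identifies the character group of $T^I$ with the submodule $X^\bullet(T)^I$ of $I$-invariants of $X^\bullet(T)$; and $T_I$ and $T^I$ are $K$-isogenous, i.e. there is an isogeny $T_I\to T^I$ defined over $K$. -/

import Mathlib

open scoped TensorProduct ValuativeRel

universe u

/-!
An affine group scheme over a commutative ring `R` is given by its coordinate ring, a commutative
Hopf algebra `B` over `R`; a homomorphism `Spec C → Spec B` of group schemes is given by a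
homomorphism `B →ₐc[R] C` of bialgebras (which automatically respects the antipodes).
-/

noncomputable section

namespace AlgTorus

section Tori

/-- The affine `K`-group `Spec B` is a torus split by `L`: over `L` it becomes isomorphic to
`𝔾ₘ ^ d = Spec L[ℤ ^ d]` for some `d`. -/
def IsTorusSplitBy (K L B : Type u) [Field K] [Field L] [Algebra K L] [CommRing B]
    [HopfAlgebra K B] : Prop :=
  ∃ d : ℕ, Nonempty ((L ⊗[K] B) ≃ₐc[L] MonoidAlgebra L (Multiplicative (Fin d → ℤ)))

/-- The affine `K`-group `Spec B` is a torus: it is split by some finite Galois extension. -/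
def IsTorus (K B : Type u) [Field K] [CommRing B] [HopfAlgebra K B] : Prop :=
  ∃ (L : Type u) (_ : Field L) (_ : Algebra K L),
    FiniteDimensional K L ∧ IsGalois K L ∧ IsTorusSplitBy K L B

/-- The group of characters of `T = Spec B` defined over `L`, i.e. of homomorphisms
`T_L → 𝔾ₘ`, as the group of group-like elements of the coordinate ring `L ⊗ B` of `T_L`. -/
abbrev CharGroup (K L B : Type u) [Field K] [Field L] [Algebra K L] [CommRing B]
    [HopfAlgebra K B] : Type u :=
  GroupLike L (L ⊗[K] B)

variable {K L B D : Type u} [Field K] [Field L] [Algebra K L] [CommRing B] [HopfAlgebra K B]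
  [CommRing D] [HopfAlgebra K D]

/-- The pull-back of characters along a homomorphism of `K`-groups `Spec B → Spec D`. -/
def charPullback (j : D →ₐc[K] B) (ψ : CharGroup K L D) : CharGroup K L B :=
  ⟨Bialgebra.TensorProduct.map (BialgHom.id L L) j ψ.val, ψ.2.map _⟩

/-- The coefficientwise Galois action `σ ⊗ id` on the coordinate ring of `T_L`; it induces the
Galois action on characters. -/
def galAct (B : Type u) [CommRing B] [HopfAlgebra K B] (σ : L ≃ₐ[K] L) :
    L ⊗[K] B →ₐ[K] L ⊗[K] B :=
  Algebra.TensorProduct.map (σ : L →ₐ[K] L) (AlgHom.id K B)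

/-- The subgroup of the characters that are invariant under a group `I` of Galois
automorphisms. -/
def invariantChars (B : Type u) [CommRing B] [HopfAlgebra K B] (I : Subgroup (L ≃ₐ[K] L)) :
    Subgroup (CharGroup K L B) where
  carrier := {χ | ∀ σ ∈ I, galAct B σ χ.val = χ.val}
  mul_mem' {a b} ha hb σ hσ := by
    rw [GroupLike.val_mul, map_mul, ha σ hσ, hb σ hσ]
  one_mem' σ _ := by rw [GroupLike.val_one, map_one]
  inv_mem' {a} ha σ hσ := by
    have h1 : a.val * (a⁻¹).val = 1 := by
      rw [← GroupLike.val_mul, mul_inv_cancel, GroupLike.val_one]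
    have h2 := congrArg (galAct B σ) h1
    rw [map_mul, ha σ hσ, map_one] at h2
    exact (left_inv_eq_right_inv ((mul_comm _ _).trans h1) h2).symm

end Tori

section Isogenies

variable {K B₁ B₂ : Type u} [Field K] [CommRing B₁] [HopfAlgebra K B₁] [CommRing B₂]
  [HopfAlgebra K B₂]

/-- The homomorphism of `K`-groups `Spec B₁ → Spec B₂` given by `φ` is an isogeny: it is
surjective, and its kernel, whose coordinate ring is the quotient of `B₁` by the ideal generated
by the image of the augmentation ideal of `B₂`, is finite over `K`. -/
structure IsIsogeny (φ : B₂ →ₐc[K] B₁) : Prop where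
  surjective : Function.Surjective
    (PrimeSpectrum.comap ((φ : B₂ →ₐ[K] B₁) : B₂ →+* B₁))
  finite_ker : Module.Finite K
    (B₁ ⧸ Ideal.map ((φ : B₂ →ₐ[K] B₁) : B₂ →+* B₁) (RingHom.ker (Bialgebra.counitAlgHom K B₂)))

/-- There is a `K`-isogeny `Spec B₁ → Spec B₂`. -/
def IsIsogenous (K B₁ B₂ : Type u) [Field K] [CommRing B₁] [HopfAlgebra K B₁] [CommRing B₂]
    [HopfAlgebra K B₂] : Prop :=
  ∃ φ : B₂ →ₐc[K] B₁, IsIsogeny φ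

/-- The unit element of the affine `K`-group `Spec B`, as a point of the spectrum. -/
def unitPoint (K B : Type u) [Field K] [CommRing B] [HopfAlgebra K B] : PrimeSpectrum B :=
  PrimeSpectrum.comap ((Bialgebra.counitAlgHom K B : B →ₐ[K] K) : B →+* K) ⊥

/-- `q` presents `Spec B₁` as the identity component of `Spec B₂`: it is an open and closed
subgroup scheme whose underlying space is the connected component of the unit element. -/
structure IsIdentityComponent (q : B₂ →ₐc[K] B₁) : Prop where
  surjective : Function.Surjective q
  isOpen : ∃ e : B₂, IsIdempotentElem e ∧
    RingHom.ker ((q : B₂ →ₐ[K] B₁) : B₂ →+* B₁) = Ideal.span {e}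
  range_eq : Set.range (PrimeSpectrum.comap ((q : B₂ →ₐ[K] B₁) : B₂ →+* B₁)) =
    connectedComponent (unitPoint K B₂)

end Isogenies

section Models

/-- For a `K`-linear form `f` on `L`, the map `f ⊗ id : L ⊗ B → K ⊗ B = B`. If `f` is the
`j`-th coordinate with respect to a basis of `L` over `K`, this is the `j`-th coordinate with
respect to the same basis, viewed as a basis of `L ⊗ B` over `B`. -/
def coordMap {K L : Type u} (B : Type u) [Field K] [Field L] [Algebra K L] [CommRing B]
    [Algebra K B] (f : L →ₗ[K] K) : L ⊗[K] B →ₗ[K] B :=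
  (TensorProduct.lid K B).toLinearMap ∘ₗ LinearMap.rTensor B f

/-- The coordinate ring of the standard integral model: the `O`-subalgebra of `B` generated by
the coordinates of all characters with respect to an integral basis of `L` over `K`.
The forms `f` that are integral on the ring of integers `O_L` are exactly the `O`-combinations of
the coordinate forms of any `O`-basis of `O_L`; and since the structure constants of such a basis
lie in `O`, it makes no difference whether all characters are used or only a `ℤ`-basis of the
character group together with the inverses of its members. -/
def standardOrder (O K L B : Type u) [CommRing O] [Field K] [Algebra O K] [Field L] [Algebra K L]
    [Algebra O L] [CommRing B] [HopfAlgebra K B] [Algebra O B] : Subalgebra O B :=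
  Algebra.adjoin O {b | ∃ (χ : CharGroup K L B) (f : L →ₗ[K] K),
    (∀ x ∈ integralClosure O L, f x ∈ (algebraMap O K).range) ∧ b = coordMap B f χ.val}

/-- The affine `O`-group `Spec M` is the standard integral model of `Spec B`: its generic fibre
is isomorphic to `Spec B`, and this isomorphism identifies the coordinate ring `M` with the
standard order in `B`. -/
def IsStandardModel (O K L B M : Type u) [CommRing O] [Field K] [Algebra O K] [Field L]
    [Algebra K L] [Algebra O L] [CommRing B] [HopfAlgebra K B] [CommRing M]
    [HopfAlgebra O M] : Prop :=
  ∃ e : (K ⊗[O] M) ≃ₐc[K] B,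
    Function.Injective (fun m : M => e (1 ⊗ₜ m)) ∧
    Set.range (fun m : M => e (1 ⊗ₜ m)) =
      letI : Algebra O B := Algebra.compHom B (algebraMap O K)
      (standardOrder O K L B : Set B)

/-- `ι` presents `Spec N` as the group smoothening of the affine `O`-group `Spec M`: `Spec N` is a
smooth `O`-group, and every morphism from a smooth `O`-scheme to `Spec M` factors uniquely through
`Spec N` (it suffices to test this on affine schemes). -/
structure IsGroupSmoothening (O : Type u) {M N : Type u} [CommRing O] [CommRing M]
    [HopfAlgebra O M] [CommRing N] [HopfAlgebra O N] (ι : M →ₐc[O] N) : Prop where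
  smooth : Algebra.Smooth O N
  existsUnique_lift : ∀ (C : Type u) [CommRing C] [Algebra O C] [Algebra.Smooth O C]
    (f : M →ₐ[O] C), ∃! g : N →ₐ[O] C, g.comp (ι : M →ₐ[O] N) = f

/-- The torus `Spec B` (split by `L`) has good reduction: the identity component of the special
fibre of the smooth standard model, i.e. of the smoothening of the standard integral model, is a
torus over the residue field. -/
def HasGoodReduction (O K L B : Type u) [CommRing O] [IsLocalRing O] [Field K] [Algebra O K]
    [Field L] [Algebra K L] [Algebra O L] [CommRing B] [HopfAlgebra K B] : Prop :=
  ∃ (M : Type u) (_ : CommRing M) (_ : HopfAlgebra O M)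
    (N : Type u) (_ : CommRing N) (_ : HopfAlgebra O N) (ι : M →ₐc[O] N)
    (H : Type u) (_ : CommRing H) (_ : HopfAlgebra (IsLocalRing.ResidueField O) H)
    (q : (IsLocalRing.ResidueField O ⊗[O] N) →ₐc[IsLocalRing.ResidueField O] H),
    IsStandardModel O K L B M ∧ IsGroupSmoothening O ι ∧
      IsIdentityComponent q ∧ IsTorus (IsLocalRing.ResidueField O) H

end Models

section Pieces

variable {K B C D : Type u} [Field K] [CommRing B] [HopfAlgebra K B] [CommRing C]
  [HopfAlgebra K C] [CommRing D] [HopfAlgebra K D]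

/-- The closed subgroup `Spec C` of the torus `Spec B` given by the surjection `q` is the maximal
subtorus with good reduction: it is a subtorus with good reduction and contains every subtorus
with good reduction. (A subtorus of a torus split by `L` is split by `L`.) -/
structure IsMaximalGoodSubtorus (O L : Type u) [CommRing O] [IsLocalRing O] [Algebra O K]
    [Field L] [Algebra K L] [Algebra O L] (q : B →ₐc[K] C) : Prop where
  surjective : Function.Surjective q
  isTorus : IsTorusSplitBy K L C
  good : HasGoodReduction O K L C
  le : ∀ (C' : Type u) [CommRing C'] [HopfAlgebra K C'] (q' : B →ₐc[K] C'),
    Function.Surjective q' → IsTorusSplitBy K L C' → HasGoodReduction O K L C' →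
      RingHom.ker ((q : B →ₐ[K] C) : B →+* C) ≤ RingHom.ker ((q' : B →ₐ[K] C') : B →+* C')

/-- The homomorphism `Spec B → Spec D` given by the injection `j` presents `Spec D` as the factor
torus of the torus `Spec B` whose characters are the `I`-invariant characters of `Spec B`. -/
structure IsInvariantFactorTorus {L : Type u} [Field L] [Algebra K L]
    (I : Subgroup (L ≃ₐ[K] L)) (j : D →ₐc[K] B) : Prop where
  injective : Function.Injective j
  isTorus : IsTorusSplitBy K L D
  range_eq : Set.range (charPullback (L := L) j) = (invariantChars B I : Set (CharGroup K L B))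

end Pieces

end AlgTorus

end

/-!
A torus split by `L` has good reduction if and only if the inertia group `I` acts trivially on its
characters. Granting this, the theorem is a matter of lattices with an action of the Galois group.
A torus split by `L` is determined by its character group `X`, and the subtori with good reduction
correspond to the torsion-free stable quotients of `X` on which `I` acts trivially. A map from `X`
to such a quotient kills every character of norm one, because it sends the norm
`N χ = ∏ σ χ` over `σ ∈ I` to the `|I|`-th power of the image of `χ` and the quotient is torsion
free. So the subtorus with character group `N X` is the largest one with good reduction
(`exists_isMaximalGoodSubtorus`); the inertia group is normal, whence `N X` is stable. The factor
torus belongs to the submodule of invariants (`exists_isInvariantFactorTorus`). On invariants the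
norm is the `|I|`-th power, so the composite of the inclusion of the maximal subtorus and the
projection to the factor torus identifies the invariants with a subgroup of finite exponent of the
characters of the subtorus, and is an isogeny (`isIsogeny_comp`).

If inertia acts trivially, let `S` be the ring of integers of the inertia field. It is a Galois
extension of the ring of integers `O` of `K` in the sense of Chase, Harrison and Rosenberg
(`isGaloisExt_fixedField`), so Galois descent gives a form `TorusAlg O S ρ` over `O` of the split
torus over `S`. This form is smooth (`smooth_torusAlg`), its coordinate ring is the standard order
(`range_formToTorus`) and its special fibre is a torus (`exists_equiv_specialFibre`). It is
therefore its own smoothening and has good reduction (`hasGoodReduction_of_galAct_eq`).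

Conversely (`galAct_eq_of_hasGoodReduction`), suppose the torus has good reduction, and let `l` be a
prime that is invertible in `O`. A comparison of tangent spaces shows that the rank of the torus in
the special fibre is at least that of the generic fibre (`rank_le_of_isGroupSmoothening`,
`rank_le_of_isIdentityComponent`). The `l`-torsion points of the special fibre lift to the
smoothening over an unramified extension of `O`, since the kernel of multiplication by `l` on a
smooth group is étale (`exists_torsion_lift`). They give `l`-torsion points of the standard model,
at least as many as the torus has over an algebraically closed field. The value of such a point at
a character `χ` is an integral `l`-th root of unity, because the coordinates of `χ` lie in the
standard order; an element `σ` of inertia changes it by a congruence, hence not at all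
(`extPoint_galAct_eq`). So `σ χ / χ` has value one at all `l`-torsion points, and counting these
shows that it is an `l`-th power (`dvd_of_value_eq_one`). This holds for infinitely many `l`, which
forces `σ χ = χ`.
-/

set_option linter.unusedSectionVars false

noncomputable section

namespace AlgTorus

/-! ### Galois extensions of rings and descent -/

section Descent

/-- `S` is a Galois extension of `R` with group `G`, in the form of Chase, Harrison and Rosenberg:
`R` is the ring of invariants and there are coordinates `x i`, `y i` with
`∑ x i * g (y i) = δ_{g,1}`. An element of trace one is included, which makes `R` a direct summand
of `S`. -/
class IsGaloisExt (R S G : Type*) [CommRing R] [CommRing S] [Algebra R S] [Group G] [Fintype G]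
    [MulSemiringAction G S] : Prop where
  injective : Function.Injective (algebraMap R S)
  smul_algebraMap : ∀ (g : G) (r : R), g • algebraMap R S r = algebraMap R S r
  exists_algebraMap_eq : ∀ s : S, (∀ g : G, g • s = s) → ∃ r, algebraMap R S r = s
  exists_coords : ∃ (n : ℕ) (x y : Fin n → S), ∑ i, x i * y i = 1 ∧
    ∀ g : G, g ≠ 1 → ∑ i, x i * g • y i = 0
  exists_trace : ∃ c : S, ∑ g : G, g • c = 1

variable (R S G : Type*) [CommRing R] [CommRing S] [Algebra R S] [Group G] [Fintype G]
    [MulSemiringAction G S] [IsGaloisExt R S G]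

lemma exists_trace_form :
    ∃ τ : S →ₗ[R] R, ∀ s, algebraMap R S (τ s) = ∑ g : G, g • s := by
  have h (s : S) : ∃ r, algebraMap R S r = ∑ g : G, g • s := by
    refine IsGaloisExt.exists_algebraMap_eq (G := G) _ fun g => ?_
    rw [Finset.smul_sum]
    simp only [smul_smul]
    exact Fintype.sum_equiv (Equiv.mulLeft g) _ _ fun _ => rfl
  choose f hf using h
  have inj := IsGaloisExt.injective (R := R) (S := S) (G := G)
  refine ⟨⟨⟨f, fun a b => inj ?_⟩, fun r a => inj ?_⟩, hf⟩
  · simp [hf, smul_add, Finset.sum_add_distrib]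
  · simp [hf, Algebra.smul_def, smul_mul', IsGaloisExt.smul_algebraMap, Finset.mul_sum]

/-- `R` is a direct summand of the `R`-module `S`. -/
lemma exists_retraction (R S G : Type*) [CommRing R] [CommRing S] [Algebra R S] [Group G]
    [Fintype G] [MulSemiringAction G S] [IsGaloisExt R S G] : ∃ τ : S →ₗ[R] R, τ 1 = 1 := by
  obtain ⟨τ, hτ⟩ := exists_trace_form R S G
  obtain ⟨c, hc⟩ := IsGaloisExt.exists_trace (R := R) (S := S) (G := G)
  refine ⟨τ ∘ₗ LinearMap.mulLeft R c, IsGaloisExt.injective (R := R) (S := S) (G := G) ?_⟩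
  simp [hτ, hc]

lemma one_tmul_injective (R S G : Type*) [CommRing R] [CommRing S] [Algebra R S] [Group G]
    [Fintype G] [MulSemiringAction G S] [IsGaloisExt R S G] (W : Type*) [AddCommGroup W]
    [Module R W] :
    Function.Injective (fun w : W => (1 : S) ⊗ₜ[R] w) := by
  obtain ⟨τ, hτ⟩ := exists_retraction R S G
  refine Function.LeftInverse.injective
    (g := (TensorProduct.lid R W).toLinearMap ∘ₗ LinearMap.rTensor W τ) fun w => ?_
  simp [hτ]

/-- The action of `g` on the first factor of `S ⊗ W`. -/
def actLeft (W : Type*) [AddCommGroup W] [Module R W] (g : G) : S ⊗[R] W →ₗ[R] S ⊗[R] W :=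
  LinearMap.rTensor W
    { toFun := fun s => g • s
      map_add' := smul_add g
      map_smul' := fun r s => by
        simp [Algebra.smul_def, smul_mul', IsGaloisExt.smul_algebraMap] }

@[simp] lemma actLeft_tmul (W : Type*) [AddCommGroup W] [Module R W] (g : G) (s : S) (w : W) :
    actLeft R S G W g (s ⊗ₜ w) = (g • s) ⊗ₜ w := rfl

variable {R S G} in
/-- Invariant elements of `S ⊗ W` come from `W`. -/
lemma exists_one_tmul_of_invariant {W : Type*} [AddCommGroup W] [Module R W] (v : S ⊗[R] W)
    (hv : ∀ g : G, actLeft R S G W g v = v) : ∃ w, (1 : S) ⊗ₜ[R] w = v := by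
  obtain ⟨τ, hτ⟩ := exists_trace_form R S G
  obtain ⟨c, hc⟩ := IsGaloisExt.exists_trace (R := R) (S := S) (G := G)
  have key (v : S ⊗[R] W) : ∑ g : G, (g • c) • actLeft R S G W g v =
      1 ⊗ₜ (TensorProduct.lid R W (LinearMap.rTensor W (τ ∘ₗ LinearMap.mulLeft R c) v)) := by
    induction v with
    | zero => simp
    | add a b ha hb => simp [smul_add, Finset.sum_add_distrib, ha, hb, TensorProduct.tmul_add]
    | tmul s w =>
      simp [TensorProduct.smul_tmul', ← TensorProduct.sum_tmul, TensorProduct.tmul_smul,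
        Algebra.algebraMap_eq_smul_one, ← smul_mul', ← hτ]
  refine ⟨_, (key v).symm.trans ?_⟩
  simp [hv, ← Finset.sum_smul, hc]

end Descent

/-! ### Base change of tensor squares and Hopf orders -/

section TensorSquare

variable {R S : Type*} [CommRing R] [CommRing S] [Algebra R S]

/-- If `V` and `W` are the base changes to `S` of `M` and `N`, then `V ⊗ W` is the base change
of `M ⊗ N`. -/
lemma exists_equiv_tensor {M N V W : Type*} [AddCommGroup M] [Module R M] [AddCommGroup N]
    [Module R N] [AddCommGroup V] [Module S V] [AddCommGroup W] [Module S W]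
    (eV : S ⊗[R] M ≃ₗ[S] V) (eW : S ⊗[R] N ≃ₗ[S] W) :
    ∃ e : S ⊗[R] (M ⊗[R] N) ≃ₗ[S] V ⊗[S] W,
      ∀ m n, e (1 ⊗ₜ (m ⊗ₜ n)) = eV (1 ⊗ₜ m) ⊗ₜ eW (1 ⊗ₜ n) :=
  ⟨(TensorProduct.AlgebraTensorModule.distribBaseChange R S M N).trans
    (TensorProduct.congr eV eW), fun m n => by simp⟩

variable {M A : Type*} [CommRing M] [Algebra R M] [CommRing A] [Algebra R A] [Algebra S A]
  [IsScalarTower R S A]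

variable (S) in
/-- The tensor product `f ⊗ g : M ⊗ N → A ⊗ B` of two homomorphisms, over a change of the base
ring from `R` to `S`. -/
def tmap {N B : Type*} [CommRing N] [Algebra R N] [CommRing B] [Algebra R B] [Algebra S B]
    [IsScalarTower R S B] (f : M →ₐ[R] A) (g : N →ₐ[R] B) : M ⊗[R] N →ₐ[R] A ⊗[S] B :=
  Algebra.TensorProduct.lift
    (((Algebra.TensorProduct.includeLeft : A →ₐ[S] A ⊗[S] B).restrictScalars R).comp f)
    (((Algebra.TensorProduct.includeRight : B →ₐ[S] A ⊗[S] B).restrictScalars R).comp g)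
    fun _ _ => Commute.all _ _

@[simp] lemma tmap_tmul {N B : Type*} [CommRing N] [Algebra R N] [CommRing B] [Algebra R B]
    [Algebra S B] [IsScalarTower R S B] (f : M →ₐ[R] A) (g : N →ₐ[R] B) (m : M) (n : N) :
    tmap S f g (m ⊗ₜ n) = f m ⊗ₜ g n := by
  simp [tmap]

variable (S) in
lemma tmap_injective_of_equiv {N B : Type*} [CommRing N] [Algebra R N] [CommRing B] [Algebra R B]
    [Algebra S B] [IsScalarTower R S B] (f : M →ₐ[R] A) (g : N →ₐ[R] B)
    (eV : S ⊗[R] M ≃ₗ[S] A) (eW : S ⊗[R] N ≃ₗ[S] B)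
    (hV : ∀ m, eV (1 ⊗ₜ m) = f m) (hW : ∀ n, eW (1 ⊗ₜ n) = g n)
    (hinj : Function.Injective (fun w : M ⊗[R] N => (1 : S) ⊗ₜ[R] w)) :
    Function.Injective (tmap S f g) ∧
      ∃ e : S ⊗[R] (M ⊗[R] N) ≃ₗ[S] A ⊗[S] B, ∀ t, e (1 ⊗ₜ t) = tmap S f g t := by
  obtain ⟨e, he⟩ := exists_equiv_tensor eV eW
  have h (t : M ⊗[R] N) : e (1 ⊗ₜ t) = tmap S f g t := by
    induction t with
    | zero => simp
    | add a b ha hb => simp [TensorProduct.tmul_add, ha, hb]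
    | tmul m n => simp [he, hV, hW]
  refine ⟨fun a b hab => hinj (e.injective ?_), e, h⟩
  simpa [h] using hab

end TensorSquare

section HopfOrder

variable {R S M A : Type*} [CommRing R] [CommRing S] [Algebra R S]
  [CommRing M] [Algebra R M] [CommRing A] [Algebra R A] [HopfAlgebra S A] [IsScalarTower R S A]

/-- The subring `j : M → A` of an `S`-Hopf algebra is stable under the Hopf algebra operations
over the smaller base ring `R`. -/
structure IsHopfOrder (j : M →ₐ[R] A) : Prop where
  base_injective : Function.Injective (algebraMap R S)
  injective : Function.Injective j
  injective₂ : Function.Injective (tmap S j j)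
  injective₃ : Function.Injective (tmap S j (tmap S j j))
  comul : ∀ m, ∃ t, tmap S j j t = Coalgebra.comul (R := S) (j m)
  counit : ∀ m, ∃ r, algebraMap R S r = Coalgebra.counit (R := S) (j m)
  antipode : ∀ m, ∃ m', j m' = HopfAlgebra.antipode S (j m)

variable {j : M →ₐ[R] A}

namespace IsHopfOrder

/-- The comultiplication of a Hopf order. -/
def comulHom (h : IsHopfOrder (S := S) j) : M →ₐ[R] M ⊗[R] M where
  toFun m := (h.comul m).choose
  map_one' := h.injective₂ (by rw [(h.comul _).choose_spec]; simp)
  map_mul' a b := h.injective₂ (by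
    rw [(h.comul (a * b)).choose_spec, map_mul j, Bialgebra.comul_mul, map_mul (tmap S j j),
      (h.comul a).choose_spec, (h.comul b).choose_spec])
  map_zero' := h.injective₂ (by rw [(h.comul _).choose_spec]; simp)
  map_add' a b := h.injective₂ (by
    rw [(h.comul (a + b)).choose_spec, map_add j, map_add, map_add (tmap S j j),
      (h.comul a).choose_spec, (h.comul b).choose_spec])
  commutes' r := h.injective₂ (by
    rw [(h.comul _).choose_spec, AlgHom.commutes, AlgHom.commutes,
      IsScalarTower.algebraMap_apply R S A, Bialgebra.comul_algebraMap,
      ← IsScalarTower.algebraMap_apply])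

lemma tmap_comulHom (h : IsHopfOrder (S := S) j) (m : M) :
    tmap S j j (h.comulHom m) = Coalgebra.comul (R := S) (j m) :=
  (h.comul m).choose_spec

/-- The counit of a Hopf order. -/
def counitHom (h : IsHopfOrder (S := S) j) : M →ₐ[R] R where
  toFun m := (h.counit m).choose
  map_one' := h.base_injective (by rw [(h.counit _).choose_spec]; simp)
  map_mul' a b := h.base_injective (by
    rw [(h.counit (a * b)).choose_spec, map_mul j, Bialgebra.counit_mul, map_mul (algebraMap R S),
      (h.counit a).choose_spec, (h.counit b).choose_spec])
  map_zero' := h.base_injective (by rw [(h.counit _).choose_spec]; simp)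
  map_add' a b := h.base_injective (by
    rw [(h.counit (a + b)).choose_spec, map_add j, map_add, map_add (algebraMap R S),
      (h.counit a).choose_spec, (h.counit b).choose_spec])
  commutes' r := h.base_injective (by
    rw [(h.counit _).choose_spec, AlgHom.commutes,
      IsScalarTower.algebraMap_apply R S A, Bialgebra.counit_algebraMap]; rfl)

lemma algebraMap_counitHom (h : IsHopfOrder (S := S) j) (m : M) :
    algebraMap R S (h.counitHom m) = Coalgebra.counit (R := S) (j m) :=
  (h.counit m).choose_spec

/-- The antipode of a Hopf order. -/
def antipodeHom (h : IsHopfOrder (S := S) j) : M →ₐ[R] M where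
  toFun m := (h.antipode m).choose
  map_one' := h.injective (by rw [(h.antipode _).choose_spec]; simp)
  map_mul' a b := h.injective (by
    rw [(h.antipode (a * b)).choose_spec, map_mul j, HopfAlgebra.antipode_mul_distrib, map_mul (j),
      (h.antipode a).choose_spec, (h.antipode b).choose_spec])
  map_zero' := h.injective (by rw [(h.antipode _).choose_spec]; simp)
  map_add' a b := h.injective (by
    rw [(h.antipode (a + b)).choose_spec, map_add j, map_add, map_add (j),
      (h.antipode a).choose_spec, (h.antipode b).choose_spec])
  commutes' r := h.injective (by
    rw [(h.antipode _).choose_spec, AlgHom.commutes, IsScalarTower.algebraMap_apply R S A]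
    exact (HopfAlgebra.antipodeAlgHom S A).commutes _)

lemma apply_antipodeHom (h : IsHopfOrder (S := S) j) (m : M) :
    j (h.antipodeHom m) = HopfAlgebra.antipode S (j m) :=
  (h.antipode m).choose_spec

/-- The bialgebra structure on a Hopf order. -/
abbrev bialgebra (h : IsHopfOrder (S := S) j) : Bialgebra R M := by
  refine Bialgebra.ofAlgHom h.comulHom h.counitHom ?_ ?_ ?_
  · ext m
    apply h.injective₃
    have h1 (t : M ⊗[R] M) (b : M) :
        tmap S j (tmap S j j) (Algebra.TensorProduct.assoc R R R M M M (t ⊗ₜ b)) =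
          TensorProduct.assoc S A A A (tmap S j j t ⊗ₜ j b) := by
      induction t with
      | zero => simp
      | add a b ha hb => simp only [TensorProduct.add_tmul, map_add, ha, hb]
      | tmul m n => simp
    have h2 (t : M ⊗[R] M) : tmap S j (tmap S j j) (Algebra.TensorProduct.assoc R R R M M M
        (Algebra.TensorProduct.map h.comulHom (AlgHom.id R M) t)) =
        TensorProduct.assoc S A A A (Coalgebra.comul.rTensor A (tmap S j j t)) := by
      induction t with
      | zero => simp
      | add a b ha hb => simp only [map_add, ha, hb]
      | tmul m n => simp [h1, h.tmap_comulHom]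
    have h3 (t : M ⊗[R] M) : tmap S j (tmap S j j)
        (Algebra.TensorProduct.map (AlgHom.id R M) h.comulHom t) =
        Coalgebra.comul.lTensor A (tmap S j j t) := by
      induction t with
      | zero => simp
      | add a b ha hb => simp only [map_add, ha, hb]
      | tmul m n => simp [h.tmap_comulHom]
    have := Coalgebra.coassoc_apply (R := S) (j m)
    rw [← h.tmap_comulHom, ← h2, ← h3] at this
    simpa using this
  · ext m
    have h2 (t : M ⊗[R] M) : j (TensorProduct.lid R M
        (Algebra.TensorProduct.map h.counitHom (AlgHom.id R M) t)) =
        TensorProduct.lid S A (Coalgebra.counit.rTensor A (tmap S j j t)) := by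
      induction t with
      | zero => simp
      | add a b ha hb => simp only [map_add, ha, hb]
      | tmul m n => simp [← h.algebraMap_counitHom]
    have := Coalgebra.rTensor_counit_comul (R := S) (j m)
    rw [← h.tmap_comulHom] at this
    have h3 := h2 (h.comulHom m)
    rw [this, TensorProduct.lid_tmul, one_smul] at h3
    apply (TensorProduct.lid R M).injective
    simpa using h.injective h3
  · ext m
    have h2 (t : M ⊗[R] M) : j (TensorProduct.rid R M
        (Algebra.TensorProduct.map (AlgHom.id R M) h.counitHom t)) =
        TensorProduct.rid S A (Coalgebra.counit.lTensor A (tmap S j j t)) := by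
      induction t with
      | zero => simp
      | add a b ha hb => simp only [map_add, ha, hb]
      | tmul m n => simp [← h.algebraMap_counitHom]
    have := Coalgebra.lTensor_counit_comul (R := S) (j m)
    rw [← h.tmap_comulHom] at this
    have h3 := h2 (h.comulHom m)
    rw [this, TensorProduct.rid_tmul, one_smul] at h3
    apply (TensorProduct.rid R M).injective
    simpa using h.injective h3

/-- The Hopf algebra structure on a Hopf order. -/
abbrev hopfAlgebra (h : IsHopfOrder (S := S) j) : HopfAlgebra R M := by
  letI := h.bialgebra
  have hc (m : M) : Coalgebra.comul (R := R) m = h.comulHom m := rfl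
  have hu (m : M) : Coalgebra.counit (R := R) m = h.counitHom m := rfl
  refine HopfAlgebra.ofAlgHom h.antipodeHom ?_ ?_
  · ext m
    apply h.injective
    have h2 (t : M ⊗[R] M) : j (Algebra.TensorProduct.lift h.antipodeHom (AlgHom.id R M)
        (fun _ _ => Commute.all _ _) t) =
        LinearMap.mul' S A ((HopfAlgebra.antipode S).rTensor A (tmap S j j t)) := by
      induction t with
      | zero => simp
      | add a b ha hb => simp only [map_add, ha, hb]
      | tmul m n => simp [h.apply_antipodeHom]
    have := HopfAlgebra.mul_antipode_rTensor_comul_apply (R := S) (j m)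
    rw [← h.tmap_comulHom, ← h2, ← h.algebraMap_counitHom,
      ← IsScalarTower.algebraMap_apply, ← AlgHom.commutes j] at this
    simpa [hc, hu, Algebra.ofId_apply] using this
  · ext m
    apply h.injective
    have h2 (t : M ⊗[R] M) : j (Algebra.TensorProduct.lift (AlgHom.id R M) h.antipodeHom
        (fun _ _ => Commute.all _ _) t) =
        LinearMap.mul' S A ((HopfAlgebra.antipode S).lTensor A (tmap S j j t)) := by
      induction t with
      | zero => simp
      | add a b ha hb => simp only [map_add, ha, hb]
      | tmul m n => simp [h.apply_antipodeHom]
    have := HopfAlgebra.mul_antipode_lTensor_comul_apply (R := S) (j m)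
    rw [← h.tmap_comulHom, ← h2, ← h.algebraMap_counitHom,
      ← IsScalarTower.algebraMap_apply, ← AlgHom.commutes j] at this
    simpa [hc, hu, Algebra.ofId_apply] using this

end IsHopfOrder

end HopfOrder

/-! ### Homomorphisms of bialgebras over a change of base rings -/

section SemiHom

variable {R S M A : Type*} [CommRing R] [CommRing S] [Algebra R S]
  [CommRing M] [Bialgebra R M] [CommRing A] [Algebra R A] [Bialgebra S A] [IsScalarTower R S A]

variable (S) in
/-- The `R`-algebra homomorphism `j` from an `R`-bialgebra to an `S`-bialgebra is compatible with
the comultiplications and the counits. -/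
structure IsBialgHomOver (j : M →ₐ[R] A) : Prop where
  comul : ∀ m, tmap S j j (Coalgebra.comul (R := R) m) = Coalgebra.comul (R := S) (j m)
  counit : ∀ m, algebraMap R S (Coalgebra.counit (R := R) m) = Coalgebra.counit (R := S) (j m)

/-- The homomorphism of `S`-bialgebras `S ⊗ M → A` induced by `j : M → A`. -/
def IsBialgHomOver.lift {j : M →ₐ[R] A} (h : IsBialgHomOver S j) : S ⊗[R] M →ₐc[S] A :=
  BialgHom.ofAlgHom (Algebra.TensorProduct.lift (Algebra.ofId S A) j fun _ _ => Commute.all _ _)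
    (by
      ext m
      simp [← h.counit, Algebra.algebraMap_eq_smul_one])
    (by
      ext m
      have h2 (t : M ⊗[R] M) : Algebra.TensorProduct.map
          (Algebra.TensorProduct.lift (Algebra.ofId S A) j fun _ _ => Commute.all _ _)
          (Algebra.TensorProduct.lift (Algebra.ofId S A) j fun _ _ => Commute.all _ _)
          (TensorProduct.AlgebraTensorModule.tensorTensorTensorComm R S R S S S M M
            ((1 ⊗ₜ 1) ⊗ₜ t)) = tmap S j j t := by
        induction t with
        | zero => simp
        | add a b ha hb => simp only [TensorProduct.tmul_add, map_add, ha, hb]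
        | tmul m n => simp
      simpa [TensorProduct.comul_tmul, h.comul] using h2 (Coalgebra.comul m))

@[simp] lemma IsBialgHomOver.lift_tmul {j : M →ₐ[R] A} (h : IsBialgHomOver S j) (s : S) (m : M) :
    h.lift (s ⊗ₜ m) = s • j m := by
  simp [IsBialgHomOver.lift, Algebra.ofId_apply, Algebra.smul_def]

variable (S M) in
/-- The inclusion `M → S ⊗ M`, as a homomorphism over a change of base rings. -/
lemma isBialgHomOver_includeRight :
    IsBialgHomOver S (Algebra.TensorProduct.includeRight : M →ₐ[R] S ⊗[R] M) where
  comul m := by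
    have h2 (t : M ⊗[R] M) :
        tmap S (Algebra.TensorProduct.includeRight : M →ₐ[R] S ⊗[R] M)
          (Algebra.TensorProduct.includeRight : M →ₐ[R] S ⊗[R] M) t =
          TensorProduct.AlgebraTensorModule.tensorTensorTensorComm R S R S S S M M
            ((1 ⊗ₜ 1) ⊗ₜ t) := by
      induction t with
      | zero => simp
      | add a b ha hb => simp only [TensorProduct.tmul_add, map_add, ha, hb]
      | tmul m n => simp
    simp [h2, TensorProduct.comul_tmul]
  counit m := by simp [Algebra.algebraMap_eq_smul_one]

/-- The `R`-algebra homomorphism `f` between `R`-bialgebras is a homomorphism of bialgebras if its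
composite with a homomorphism `j` over a change of base rings is one, and if `j` and `j ⊗ j` are
injective. -/
def bialgHomOfComp {M' : Type*} [CommRing M'] [Bialgebra R M'] (f : M' →ₐ[R] M)
    {j : M →ₐ[R] A} (h : IsBialgHomOver S j) (hS : Function.Injective (algebraMap R S))
    (h2 : Function.Injective (tmap S j j)) (hf : IsBialgHomOver S (j.comp f)) : M' →ₐc[R] M :=
  BialgHom.ofAlgHom f
    (by
      ext m
      apply hS
      simp [h.counit, hf.counit])
    (by
      ext m
      apply h2
      have h3 (t : M' ⊗[R] M') : tmap S j j (Algebra.TensorProduct.map f f t) =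
          tmap S (j.comp f) (j.comp f) t := by
        induction t with
        | zero => simp
        | add a b ha hb => simp only [map_add, ha, hb]
        | tmul m n => simp
      simp [h3, h.comul, hf.comul])

/-- Composing a homomorphism over a change of base rings with a homomorphism of bialgebras. -/
lemma IsBialgHomOver.comp_left {A' : Type*} [CommRing A'] [Algebra R A'] [Bialgebra S A']
    [IsScalarTower R S A'] {j : M →ₐ[R] A} (h : IsBialgHomOver S j) (φ : A →ₐc[S] A') :
    IsBialgHomOver S (((φ : A →ₐ[S] A').restrictScalars R).comp j) where
  comul m := by
    have h3 (t : M ⊗[R] M) : tmap S (((φ : A →ₐ[S] A').restrictScalars R).comp j)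
        (((φ : A →ₐ[S] A').restrictScalars R).comp j) t =
        TensorProduct.map (φ : A →ₗ[S] A') (φ : A →ₗ[S] A') (tmap S j j t) := by
      induction t with
      | zero => simp
      | add a b ha hb => simp only [map_add, ha, hb]
      | tmul m n => simp
    rw [h3, h.comul]
    simp
  counit m := by
    rw [h.counit]
    simp

end SemiHom

/-! ### The Hopf algebra of invariants of a group algebra -/

section Invariants

variable {R S G Y : Type*} [CommRing R] [CommRing S] [Algebra R S] [Group G]
    [MulSemiringAction G S] [CommGroup Y]

/-- The semilinear action of `g` on the group algebra `S[Y]` of a group `Y` on which `G` acts. -/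
def twist (S : Type*) [CommRing S] [MulSemiringAction G S] (ρ : G →* MulAut Y) (g : G) :
    MonoidAlgebra S Y →+* MonoidAlgebra S Y :=
  (MonoidAlgebra.mapDomainRingHom S (ρ g : Y →* Y)).comp
    (MonoidAlgebra.mapRingHom Y (MulSemiringAction.toRingHom G S g))

variable (ρ : G →* MulAut Y)

@[simp] lemma twist_single (g : G) (y : Y) (s : S) :
    twist S ρ g (MonoidAlgebra.single y s) = MonoidAlgebra.single (ρ g y) (g • s) := by
  simp [twist]

lemma twist_smul (g : G) (s : S) (a : MonoidAlgebra S Y) :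
    twist S ρ g (s • a) = (g • s) • twist S ρ g a := by
  induction a using MonoidAlgebra.induction_linear with
  | zero => simp
  | add a b ha hb => simp [smul_add, ha, hb]
  | single y t => simp

lemma twist_twist (g h : G) (a : MonoidAlgebra S Y) :
    twist S ρ g (twist S ρ h a) = twist S ρ (g * h) a := by
  induction a using MonoidAlgebra.induction_linear with
  | zero => simp
  | add a b ha hb => simp [ha, hb]
  | single y t => simp [mul_smul]

lemma twist_one (a : MonoidAlgebra S Y) : twist S ρ 1 a = a := by
  induction a using MonoidAlgebra.induction_linear with
  | zero => simp
  | add a b ha hb => simp [ha, hb]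
  | single y t => simp

variable [Fintype G] [IsGaloisExt R S G]

variable (R S) in
/-- The `R`-algebra of the elements of `S[Y]` that are invariant under the semilinear action
of `G`. -/
def invAlg : Subalgebra R (MonoidAlgebra S Y) where
  carrier := {a | ∀ g, twist S ρ g a = a}
  mul_mem' ha hb g := by rw [map_mul, ha, hb]
  add_mem' ha hb g := by rw [map_add, ha, hb]
  algebraMap_mem' r g := by
    simp [MonoidAlgebra.coe_algebraMap, IsGaloisExt.smul_algebraMap]

/-- The average `∑ g • a`, an invariant element of `S[Y]`. -/
def avg (ρ : G →* MulAut Y) (a : MonoidAlgebra S Y) : invAlg R S ρ :=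
  ⟨∑ g, twist S ρ g a, fun h => by
    simp only [map_sum, twist_twist]
    exact Fintype.sum_equiv (Equiv.mulLeft h) _ _ fun _ => rfl⟩

lemma coe_avg (a : MonoidAlgebra S Y) :
    ((avg ρ a : invAlg R S ρ) : MonoidAlgebra S Y) = ∑ g, twist S ρ g a := rfl

/-- The reconstruction formula of Galois coordinates. -/
lemma sum_coords {n : ℕ} {x y : Fin n → S} (h1 : ∑ i, x i * y i = 1)
    (h2 : ∀ g : G, g ≠ 1 → ∑ i, x i * g • y i = 0) {V : Type*} [AddCommGroup V] [Module S V]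
    (T : G → V) : ∑ i, x i • ∑ g : G, (g • y i) • T g = T 1 := by
  simp only [Finset.smul_sum, smul_smul]
  rw [Finset.sum_comm]
  simp only [← Finset.sum_smul]
  rw [Finset.sum_eq_single 1 (fun g _ hg => by rw [h2 g hg, zero_smul]) (by simp)]
  simp [h1]

lemma sum_smul_avg {n : ℕ} {x y : Fin n → S} (h1 : ∑ i, x i * y i = 1)
    (h2 : ∀ g : G, g ≠ 1 → ∑ i, x i * g • y i = 0) (a : MonoidAlgebra S Y) :
    ∑ i, x i • ((avg ρ (y i • a) : invAlg R S ρ) : MonoidAlgebra S Y) = a := by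
  simp only [coe_avg, twist_smul]
  rw [sum_coords h1 h2 (fun g => twist S ρ g a), twist_one]

variable (R S) in
/-- Galois descent: `S[Y]` is the base change of its algebra of invariants. -/
lemma invAlg_lift_bijective : Function.Bijective
    (Algebra.TensorProduct.lift (Algebra.ofId S (MonoidAlgebra S Y)) (invAlg R S ρ).val
      fun _ _ => Commute.all _ _) := by
  obtain ⟨n, x, y, h1, h2⟩ := IsGaloisExt.exists_coords (R := R) (S := S) (G := G)
  obtain ⟨τ, hτ⟩ := exists_trace_form R S G
  set ψ := Algebra.TensorProduct.lift (Algebra.ofId S (MonoidAlgebra S Y)) (invAlg R S ρ).val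
      fun _ _ => Commute.all _ _ with hψ
  have hψt (s : S) (m : invAlg R S ρ) : ψ (s ⊗ₜ m) = s • (m : MonoidAlgebra S Y) := by
    simp [ψ, Algebra.ofId_apply, Algebra.smul_def]
  have havg (a b : MonoidAlgebra S Y) : (avg ρ (a + b) : invAlg R S ρ) = avg ρ a + avg ρ b := by
    apply Subtype.ext
    simp [coe_avg, Finset.sum_add_distrib]
  have hav0 : (avg ρ (0 : MonoidAlgebra S Y) : invAlg R S ρ) = 0 := by
    apply Subtype.ext
    simp [coe_avg]
  constructor
  · -- The coordinates give a left inverse `a ↦ ∑ x i ⊗ avg (y i a)`.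
    have key (t : S ⊗[R] invAlg R S ρ) : ∑ i, x i ⊗ₜ[R] (avg ρ (y i • ψ t) : invAlg R S ρ) = t := by
      induction t with
      | zero => simp [hav0]
      | add a b ha hb =>
        simp only [map_add, smul_add, havg, TensorProduct.tmul_add, Finset.sum_add_distrib, ha, hb]
      | tmul s m =>
        have h3 (i) : (avg ρ (y i • ψ (s ⊗ₜ m)) : invAlg R S ρ) = τ (y i * s) • m := by
          apply Subtype.ext
          rw [coe_avg, SetLike.val_smul, ← algebraMap_smul S (τ (y i * s)) (m : MonoidAlgebra S Y), hτ,
            Finset.sum_smul]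
          refine Finset.sum_congr rfl fun g _ => ?_
          rw [hψt, smul_smul, twist_smul, m.2 g]
        simp only [h3, TensorProduct.tmul_smul, TensorProduct.smul_tmul', ← TensorProduct.sum_tmul]
        congr 1
        have := sum_coords h1 h2 (fun g => g • s)
        rw [one_smul] at this
        refine Eq.trans (Finset.sum_congr rfl fun i _ => ?_) this
        rw [Algebra.smul_def, hτ, mul_comm]
        simp
    intro a b hab
    rw [← key a, ← key b, hab]
  · intro a
    refine ⟨∑ i, x i ⊗ₜ avg ρ (y i • a), ?_⟩
    simp only [map_sum, hψt]
    exact sum_smul_avg ρ h1 h2 a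

/-- Galois descent: `S[Y]` is the base change of its algebra of invariants, as an isomorphism of
algebras. -/
def invAlgEquiv : S ⊗[R] invAlg R S ρ ≃ₐ[S] MonoidAlgebra S Y :=
  AlgEquiv.ofBijective _ (invAlg_lift_bijective R S ρ)

lemma invAlgEquiv_tmul (s : S) (m : invAlg R S ρ) :
    invAlgEquiv ρ (s ⊗ₜ m) = s • (m : MonoidAlgebra S Y) := by
  simp [invAlgEquiv, Algebra.ofId_apply, Algebra.smul_def]

lemma avg_smul_eq_self (c : S) (hc : ∑ g : G, g • c = 1) (m : invAlg R S ρ) :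
    avg ρ (c • (m : MonoidAlgebra S Y)) = m := by
  apply Subtype.ext
  rw [coe_avg]
  simp only [twist_smul, m.2 _, ← Finset.sum_smul, hc, one_smul]

/-- The algebra of invariants is stable under the comultiplication: it is spanned by averages
`avg (s y)`, and Galois coordinates express the comultiplication of those through averages. -/
lemma isHopfOrder_invAlg : IsHopfOrder (S := S) (invAlg R S ρ).val := by
  obtain ⟨n, x, y, h1, h2⟩ := IsGaloisExt.exists_coords (R := R) (S := S) (G := G)
  obtain ⟨τ, hτ⟩ := exists_trace_form R S G
  obtain ⟨c, hc⟩ := IsGaloisExt.exists_trace (R := R) (S := S) (G := G)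
  have e1 (m : invAlg R S ρ) : (invAlgEquiv ρ).toLinearEquiv (1 ⊗ₜ m) = (invAlg R S ρ).val m := by
    simp [invAlgEquiv_tmul]
  obtain ⟨i2, e, he⟩ := tmap_injective_of_equiv S (invAlg R S ρ).val (invAlg R S ρ).val
      (invAlgEquiv ρ).toLinearEquiv (invAlgEquiv ρ).toLinearEquiv e1 e1 (one_tmul_injective R S G _)
  refine ⟨IsGaloisExt.injective (G := G), Subtype.val_injective, i2,
    (tmap_injective_of_equiv S (invAlg R S ρ).val _ (invAlgEquiv ρ).toLinearEquiv e e1 he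
      (one_tmul_injective R S G _)).1, fun m => ?_, fun m => ?_, fun m => ?_⟩
  · rw [← avg_smul_eq_self ρ c hc m]
    generalize c • (m : MonoidAlgebra S Y) = a
    change ∃ t, _ = Coalgebra.comul (R := S) (∑ g, twist S ρ g a)
    induction a using MonoidAlgebra.induction_linear with
    | zero => exact ⟨0, by simp⟩
    | add a b ha hb =>
      obtain ⟨t, ht⟩ := ha
      obtain ⟨t', ht'⟩ := hb
      exact ⟨t + t', by simp [ht, ht', Finset.sum_add_distrib]⟩
    | single z s =>
      -- All conjugates `ρ g z` of a group element are combinations of the invariants `m i`, with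
      -- coefficients conjugate to the `x i`; the sum over `g` turns coefficients into traces.
      let m (i : Fin n) : invAlg R S ρ := avg ρ (y i • MonoidAlgebra.single z 1)
      have hz (g : G) : MonoidAlgebra.single (ρ g z) (1 : S) = ∑ i, (g • x i) • (m i).1 := by
        have := congrArg (twist S ρ g)
          (sum_smul_avg (R := R) ρ h1 h2 (MonoidAlgebra.single z (1 : S)))
        rw [map_sum] at this
        simp only [twist_smul, twist_single, smul_one] at this
        rw [← this]
        exact Finset.sum_congr rfl fun i _ => congrArg _ ((m i).2 g)
      refine ⟨∑ i, ∑ k, τ (s * (x i * x k)) • (m i ⊗ₜ m k), ?_⟩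
      have h3 (g : G) : Coalgebra.comul (R := S) (twist S ρ g (MonoidAlgebra.single z s)) =
          ∑ i, ∑ k, (g • (s * (x i * x k))) • ((m i).1 ⊗ₜ[S] (m k).1) := by
        have : Coalgebra.comul (R := S) (twist S ρ g (MonoidAlgebra.single z s)) =
          (g • s) • (MonoidAlgebra.single (ρ g z) (1 : S) ⊗ₜ[S]
            MonoidAlgebra.single (ρ g z) (1 : S)) := by
          rw [twist_single, ← mul_one (g • s), ← smul_eq_mul, ← MonoidAlgebra.smul_single, map_smul]
          simp
        rw [this, hz g, TensorProduct.sum_tmul, Finset.smul_sum]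
        refine Finset.sum_congr rfl fun i _ => ?_
        rw [TensorProduct.tmul_sum, Finset.smul_sum]
        refine Finset.sum_congr rfl fun k _ => ?_
        rw [TensorProduct.tmul_smul, ← TensorProduct.smul_tmul', smul_smul, smul_smul]
        congr 1
        simp only [smul_mul']
        ring
      simp only [map_sum, h3]
      symm
      rw [Finset.sum_comm]
      refine Finset.sum_congr rfl fun i _ => ?_
      rw [Finset.sum_comm]
      refine Finset.sum_congr rfl fun k _ => ?_
      rw [← Finset.sum_smul, ← hτ, map_smul, tmap_tmul, algebraMap_smul]
      rfl
  · rw [← avg_smul_eq_self ρ c hc m]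
    generalize c • (m : MonoidAlgebra S Y) = a
    change ∃ r, _ = Coalgebra.counit (R := S) (∑ g, twist S ρ g a)
    induction a using MonoidAlgebra.induction_linear with
    | zero => exact ⟨0, by simp⟩
    | add a b ha hb =>
      obtain ⟨t, ht⟩ := ha
      obtain ⟨t', ht'⟩ := hb
      exact ⟨t + t', by simp only [map_add, ht, ht', Finset.sum_add_distrib]⟩
    | single z s => exact ⟨τ s, by simp [hτ]⟩
  · have h3 (g : G) (a : MonoidAlgebra S Y) : twist S ρ g (HopfAlgebra.antipode S a) =
        HopfAlgebra.antipode S (twist S ρ g a) := by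
      induction a using MonoidAlgebra.induction_linear with
      | zero => simp
      | add a b ha hb => simp [ha, hb]
      | single z s => simp
    exact ⟨⟨HopfAlgebra.antipode S m.1, fun g => by rw [h3, m.2 g]⟩, rfl⟩

variable (R S) in
/-- The coordinate ring of the `R`-form of the diagonalizable group with character group `Y` over
`S` that is given by the action `ρ` of the Galois group on `Y`. -/
def TorusAlg (ρ : G →* MulAut Y) : Type _ := invAlg R S ρ

instance : CommRing (TorusAlg R S ρ) := inferInstanceAs (CommRing (invAlg R S ρ))

instance : HopfAlgebra R (TorusAlg R S ρ) :=
  (isHopfOrder_invAlg ρ).hopfAlgebra (M := invAlg R S ρ)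

namespace TorusAlg

variable (R S) in
/-- The inclusion into the group algebra over `S`. -/
def val : TorusAlg R S ρ →ₐ[R] MonoidAlgebra S Y := (invAlg R S ρ).val

lemma val_injective : Function.Injective (val R S ρ) := Subtype.val_injective

lemma twist_val (g : G) (m : TorusAlg R S ρ) : twist S ρ g (val R S ρ m) = val R S ρ m := m.2 g

lemma exists_val_eq {a : MonoidAlgebra S Y} (h : ∀ g, twist S ρ g a = a) :
    ∃ m, val R S ρ m = a := ⟨⟨a, h⟩, rfl⟩

lemma isBialgHomOver_val : IsBialgHomOver S (val R S ρ) where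
  comul m := (isHopfOrder_invAlg (R := R) (S := S) ρ).tmap_comulHom m
  counit m := (isHopfOrder_invAlg (R := R) (S := S) ρ).algebraMap_counitHom m

lemma tmap_val_injective : Function.Injective (tmap S (val R S ρ) (val R S ρ)) :=
  (isHopfOrder_invAlg (R := R) (S := S) ρ).injective₂

variable (R S) in
lemma lift_val_bijective : Function.Bijective (isBialgHomOver_val (R := R) (S := S) ρ).lift :=
  invAlg_lift_bijective R S ρ

variable (R S) in
/-- Over `S` the form becomes isomorphic to the diagonalizable group with character group `Y`. -/
def baseChangeEquiv : S ⊗[R] TorusAlg R S ρ ≃ₐc[S] MonoidAlgebra S Y :=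
  BialgEquiv.ofBijective _ (lift_val_bijective R S ρ)

@[simp] lemma baseChangeEquiv_tmul (s : S) (m : TorusAlg R S ρ) :
    baseChangeEquiv R S ρ (s ⊗ₜ m) = s • val R S ρ m :=
  IsBialgHomOver.lift_tmul (isBialgHomOver_val ρ) s m

end TorusAlg

end Invariants

/-! ### Galois coordinates over local rings -/

section Coordinates

variable {R S G : Type*} [CommRing R] [CommRing S] [Algebra R S] [Group G]
    [MulSemiringAction G S]

/-- If every `g ≠ 1` moves some element of `S` by a unit, then Galois coordinates exist: the
coordinates separating `1` from one `g` have two terms, and these are multiplied. -/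
lemma exists_coords_of_isUnit [Fintype G] (sep : ∀ g : G, g ≠ 1 → ∃ s : S, IsUnit (s - g • s)) :
    ∃ (n : ℕ) (x y : Fin n → S), ∑ i, x i * y i = 1 ∧
      ∀ g : G, g ≠ 1 → ∑ i, x i * g • y i = 0 := by
  classical
  have key (F : Finset G) (hF : (1 : G) ∉ F) : ∃ (n : ℕ) (x y : Fin n → S), ∑ i, x i * y i = 1 ∧
      ∀ g ∈ F, ∑ i, x i * g • y i = 0 := by
    induction F using Finset.induction_on with
    | empty => exact ⟨1, 1, 1, by simp, by simp⟩
    | insert h F hh ih =>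
      obtain ⟨n, x, y, h1, h2⟩ := ih (fun h1 => hF (Finset.mem_insert_of_mem h1))
      obtain ⟨s, u, hu⟩ := sep h (fun h1 => hF (by simp [h1]))
      -- The two-term coordinates `(s - h s)⁻¹ (s - h s)`, which vanish after applying `h`.
      let x' : Fin 2 → S := ![-(↑u⁻¹ * h • s), ↑u⁻¹]
      let y' : Fin 2 → S := ![1, s]
      have h3 (g : G) : ∑ i, x' i * g • y' i = ↑u⁻¹ * (g • s - h • s) := by
        simp only [Fin.sum_univ_two, x', y', Matrix.cons_val_zero, Matrix.cons_val_one, smul_one]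
        ring
      have h4 : ∑ i, x' i * y' i = 1 := by
        simp only [Fin.sum_univ_two, x', y', Matrix.cons_val_zero, Matrix.cons_val_one]
        rw [show -(↑u⁻¹ * h • s) * 1 + ↑u⁻¹ * s = ↑u⁻¹ * (s - h • s) by ring, ← hu]
        simp
      let e : Fin (Fintype.card (Fin n × Fin 2)) ≃ Fin n × Fin 2 := (Fintype.equivFin _).symm
      refine ⟨_, fun i => x (e i).1 * x' (e i).2, fun i => y (e i).1 * y' (e i).2, ?_, ?_⟩
      · rw [e.sum_comp (fun p => x p.1 * x' p.2 * (y p.1 * y' p.2)), Fintype.sum_prod_type]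
        simp only [mul_mul_mul_comm, ← Finset.mul_sum, h1, h4, mul_one]
      · intro g hg
        rw [e.sum_comp (fun p => x p.1 * x' p.2 * g • (y p.1 * y' p.2)), Fintype.sum_prod_type]
        simp only [smul_mul', mul_mul_mul_comm, ← Finset.mul_sum, ← Finset.sum_mul]
        rcases Finset.mem_insert.mp hg with rfl | hg
        · rw [h3, sub_self, mul_zero, mul_zero]
        · rw [h2 g hg, zero_mul]
  obtain ⟨n, x, y, h1, h2⟩ := key (Finset.univ.erase 1) (by simp)
  exact ⟨n, x, y, h1, fun g hg => h2 g (by simp [hg])⟩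

/-- Over a local ring `R`, an element of trace one exists automatically: the coordinates express
`1` through traces, so that some trace is a unit. -/
lemma isGaloisExt_of_isUnit [Fintype G] [IsLocalRing R]
    (inj : Function.Injective (algebraMap R S))
    (comm : ∀ (g : G) (r : R), g • algebraMap R S r = algebraMap R S r)
    (inv : ∀ s : S, (∀ g : G, g • s = s) → ∃ r, algebraMap R S r = s)
    (sep : ∀ g : G, g ≠ 1 → ∃ s : S, IsUnit (s - g • s))
    (top : (IsLocalRing.maximalIdeal R).map (algebraMap R S) ≠ ⊤) : IsGaloisExt R S G := by
  refine ⟨inj, comm, inv, exists_coords_of_isUnit sep, ?_⟩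
  obtain ⟨n, x, y, h1, h2⟩ := exists_coords_of_isUnit (S := S) sep
  have h3 (s : S) : ∃ r, algebraMap R S r = ∑ g : G, g • s := by
    refine inv _ fun g => ?_
    rw [Finset.smul_sum]
    simp only [smul_smul]
    exact Fintype.sum_equiv (Equiv.mulLeft g) _ _ fun _ => rfl
  choose τ hτ using h3
  -- If all traces of the `y i` were in the maximal ideal, then `1` would be as well.
  have h4 : ∑ i, x i * algebraMap R S (τ (y i)) = 1 := by
    simp only [hτ, Finset.mul_sum]
    rw [Finset.sum_comm, Finset.sum_eq_single 1 (fun g _ hg => h2 g hg) (by simp)]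
    simpa using h1
  obtain ⟨i, hi⟩ : ∃ i, IsUnit (τ (y i)) := by
    by_contra! hcon
    refine top ((Ideal.eq_top_iff_one _).mpr (h4 ▸ Ideal.sum_mem _ fun i _ => ?_))
    exact Ideal.mul_mem_left _ _ (Ideal.mem_map_of_mem _
      ((IsLocalRing.mem_maximalIdeal _).mpr (hcon i)))
  obtain ⟨u, hu⟩ := hi
  refine ⟨algebraMap R S ↑u⁻¹ * y i, ?_⟩
  simp only [smul_mul', comm, ← Finset.mul_sum, ← hτ, ← map_mul, ← hu]
  simp

end Coordinates

/-- A finite Galois extension of fields has Galois coordinates. -/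
instance isGaloisExt_field (K L : Type*) [Field K] [Field L] [Algebra K L] [FiniteDimensional K L]
    [IsGalois K L] : IsGaloisExt K L (L ≃ₐ[K] L) := by
  refine isGaloisExt_of_isUnit (algebraMap K L).injective (fun g r => g.commutes r)
    (fun s hs => ?_) (fun g hg => ?_) ?_
  · exact (IsGalois.mem_range_algebraMap_iff_fixed s).mpr hs
  · obtain ⟨s, hs⟩ : ∃ s, g s ≠ s := by
      by_contra! h
      exact hg (AlgEquiv.ext h)
    exact ⟨s, (sub_ne_zero.mpr hs.symm).isUnit⟩
  · rw [IsLocalRing.maximalIdeal_eq_bot, Ideal.map_bot]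
    exact bot_ne_top

/-! ### Finite extensions of complete local rings -/

section Complete

variable {O T : Type u} [CommRing O] [IsNoetherianRing O] [CommRing T] [Algebra O T]
  [Module.Finite O T]

lemma isAdicComplete_of_finite (I : Ideal O) [IsAdicComplete I O] :
    IsAdicComplete (I.map (algebraMap O T)) T := by
  rw [IsAdicComplete.map_algebraMap_iff, ← AdicCompletion.of_bijective_iff]
  have h1 := AdicCompletion.ofTensorProduct_bijective_of_finite_of_isNoetherian I T
  let e : T ≃ₗ[O] AdicCompletion I O ⊗[O] T :=
    (TensorProduct.lid O T).symm.trans (LinearEquiv.rTensor T (AdicCompletion.ofLinearEquiv I O))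
  have h2 : (AdicCompletion.of I T : T → _) = AdicCompletion.ofTensorProduct I T ∘ e := by
    funext x
    have h3 : AdicCompletion.of I O 1 = 1 := rfl
    simp [e, h3]
  rw [h2]
  exact h1.comp e.bijective

/-- A domain that is finite over a complete local ring is local: idempotents of the special fibre
lift. -/
lemma isLocalRing_of_finite [IsLocalRing O] [IsAdicComplete (IsLocalRing.maximalIdeal O) O]
    [IsDomain T] : IsLocalRing T := by
  set J := (IsLocalRing.maximalIdeal O).map (algebraMap O T)
  have hJ : IsAdicComplete J T := isAdicComplete_of_finite _
  have hjac : J ≤ Ideal.jacobson ⊥ := IsAdicComplete.le_jacobson_bot J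
  have hmax (P : Ideal T) (hP : P.IsMaximal) : J ≤ P :=
    hjac.trans (sInf_le ⟨bot_le, hP⟩)
  let _ : Field (O ⧸ IsLocalRing.maximalIdeal O) := Ideal.Quotient.field _
  have : IsArtinianRing (T ⧸ J) := by
    have : Module.Finite (O ⧸ IsLocalRing.maximalIdeal O) (T ⧸ J) :=
      Module.Finite.of_restrictScalars_finite O _ _
    exact IsArtinianRing.of_finite (O ⧸ IsLocalRing.maximalIdeal O) (T ⧸ J)
  obtain ⟨M, hM⟩ := Ideal.exists_maximal T
  refine IsLocalRing.of_unique_max_ideal ⟨M, hM, fun P hP => ?_⟩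
  have hcomap (Q : Ideal T) (hQ : Q.IsMaximal) :
      (Q.map (Ideal.Quotient.mk J)).comap (Ideal.Quotient.mk J) = Q := by
    rw [Ideal.comap_map_of_surjective' _ Ideal.Quotient.mk_surjective, Ideal.mk_ker,
      sup_eq_left]
    exact hmax Q hQ
  have hmap (Q : Ideal T) (hQ : Q.IsMaximal) : (Q.map (Ideal.Quotient.mk J)).IsMaximal :=
    (Ideal.map_eq_top_or_isMaximal_of_surjective _ Ideal.Quotient.mk_surjective hQ).resolve_left
      fun h => hQ.ne_top (by rw [← hcomap Q hQ, h, Ideal.comap_top])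
  let p (Q : Ideal T) (hQ : Q.IsMaximal) : PrimeSpectrum (T ⧸ J) :=
    ⟨Q.map (Ideal.Quotient.mk J), (hmap Q hQ).isPrime⟩
  -- An idempotent of the artinian ring `T ⧸ J` cuts out the point of `M` in its discrete spectrum;
  -- it lifts to `T`, where only `0` and `1` are idempotent.
  obtain ⟨e, he, hes⟩ := PrimeSpectrum.exists_idempotent_basicOpen_eq_of_isClopen
    (isClopen_discrete ({p M hM} : Set (PrimeSpectrum (T ⧸ J))))
  obtain ⟨a, rfl⟩ := Ideal.Quotient.mk_surjective e
  have he' : a * a - a ∈ J := by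
    rw [← Ideal.Quotient.eq_zero_iff_mem, map_sub, map_mul, he.eq, sub_self]
  obtain ⟨b, hb, hba⟩ := HenselianRing.is_henselian (I := J)
    (Polynomial.X ^ 2 - Polynomial.X : Polynomial T)
    (by monicity!) a (by simpa [sq] using he') (by
      refine IsUnit.of_mul_eq_one (Ideal.Quotient.mk J (2 * a - 1)) ?_
      rw [← map_mul, ← map_one (Ideal.Quotient.mk J), Ideal.Quotient.eq]
      simp only [Polynomial.derivative_sub, Polynomial.derivative_X_pow, Polynomial.derivative_X,
        Polynomial.eval_sub, Polynomial.eval_mul, Polynomial.eval_pow, Polynomial.eval_X,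
        Polynomial.eval_one, Polynomial.eval_C]
      have := J.mul_mem_left 4 he'
      convert this using 1
      push_cast
      ring)
  have hb' : b = 0 ∨ b = 1 := by
    have : b * (b - 1) = 0 := by
      have := hb
      simp only [Polynomial.IsRoot, Polynomial.eval_sub, Polynomial.eval_pow,
        Polynomial.eval_X] at this
      linear_combination this
    rcases mul_eq_zero.mp this with h | h
    · exact Or.inl h
    · exact Or.inr (sub_eq_zero.mp h)
  have hab : Ideal.Quotient.mk J a = Ideal.Quotient.mk J b :=
    ((Ideal.Quotient.eq).mpr hba).symm
  have hMe : p M hM ∈ (PrimeSpectrum.basicOpen (Ideal.Quotient.mk J a) : Set _) := by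
    rw [← hes]; rfl
  rw [hab] at hes hMe
  rcases hb' with rfl | rfl
  · simp at hMe
  · have hPe : p P hP ∈ ({p M hM} : Set (PrimeSpectrum (T ⧸ J))) := by
      rw [hes]; simp
    have h1 : P.map (Ideal.Quotient.mk J) = M.map (Ideal.Quotient.mk J) :=
      congrArg PrimeSpectrum.asIdeal (Set.mem_singleton_iff.mp hPe)
    rw [← hcomap P hP, h1, hcomap M hM]

end Complete

/-! ### Rings of integers and inertia -/

section Fixed

variable {A : Type u} [CommRing A] {G : Type*} [Group G] [MulSemiringAction G A]

/-- If a finite group acts trivially on a finite residue field of `A`, then every residue class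
contains an invariant element: the residue field has no automorphisms over that of the ring of
invariants. -/
lemma exists_fixed_sub_mem [Finite G] (P : Ideal A) [P.IsMaximal] [Finite (A ⧸ P)]
    (hP : ∀ (g : G) (a : A), g • a - a ∈ P) (a : A) :
    ∃ b : A, (∀ g : G, g • b = b) ∧ a - b ∈ P := by
  let A₀ := FixedPoints.subring A G
  have h1 : Algebra.IsInvariant A₀ A G := ⟨fun b hb => ⟨⟨b, hb⟩, rfl⟩⟩
  let P₀ : Ideal A₀ := P.under A₀
  have : P.LiesOver P₀ := ⟨rfl⟩
  have hmax : P₀.IsMaximal := by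
    have : Algebra.IsIntegral A₀ A := Algebra.IsInvariant.isIntegral A₀ A G
    exact Ideal.isMaximal_comap_of_isIntegral_of_isMaximal P
  let _ : Field (A ⧸ P) := Ideal.Quotient.field P
  let _ : Field (A₀ ⧸ P₀) := Ideal.Quotient.field P₀
  have h2 : Finite (A₀ ⧸ P₀) := Finite.of_injective (algebraMap (A₀ ⧸ P₀) (A ⧸ P))
    (algebraMap (A₀ ⧸ P₀) (A ⧸ P)).injective
  obtain ⟨b, hb⟩ := (IsGalois.mem_range_algebraMap_iff_fixed (F := A₀ ⧸ P₀)
    (Ideal.Quotient.mk P a)).mpr fun f => by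
      -- Every automorphism of the residue field is induced by some `g`, which acts trivially.
      obtain ⟨g, rfl⟩ := Ideal.Quotient.stabilizerHom_surjective G P₀ P f
      exact (Ideal.Quotient.eq).mpr (hP g a)
  obtain ⟨b, rfl⟩ := Ideal.Quotient.mk_surjective b
  exact ⟨b, b.2, (Ideal.Quotient.eq).mp hb.symm⟩

end Fixed

section Integers

lemma isTorsionFree_of_isFractionRing (O K L : Type u) [CommRing O] [IsDomain O]
    [Field K] [Algebra O K] [IsFractionRing O K]
    [Field L] [Algebra K L] [Algebra O L] [IsScalarTower O K L] : Module.IsTorsionFree O L := by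
  have : FaithfulSMul O L := (faithfulSMul_iff_algebraMap_injective O L).mpr (by
    rw [IsScalarTower.algebraMap_eq O K L]
    exact (algebraMap K L).injective.comp (IsFractionRing.injective O K))
  infer_instance

lemma finite_integralClosure (O K L : Type u) [CommRing O] [IsDomain O]
    [IsDiscreteValuationRing O] [Field K] [Algebra O K] [IsFractionRing O K]
    [Field L] [Algebra K L] [Algebra O L] [IsScalarTower O K L] [FiniteDimensional K L]
    [IsGalois K L] : Module.Finite O (integralClosure O L) :=
  IsIntegralClosure.finite O K L _

lemma free_integralClosure (O K L : Type u) [CommRing O] [IsDomain O]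
    [IsDiscreteValuationRing O] [Field K] [Algebra O K] [IsFractionRing O K]
    [Field L] [Algebra K L] [Algebra O L] [IsScalarTower O K L] [FiniteDimensional K L]
    [IsGalois K L] : Module.Free O (integralClosure O L) := by
  have := isTorsionFree_of_isFractionRing O K L
  exact IsIntegralClosure.module_free O K L _

lemma isLocalRing_integralClosure (O K L : Type u) [CommRing O] [IsDomain O]
    [IsDiscreteValuationRing O] [IsAdicComplete (IsLocalRing.maximalIdeal O) O]
    [Field K] [Algebra O K] [IsFractionRing O K]
    [Field L] [Algebra K L] [Algebra O L] [IsScalarTower O K L] [FiniteDimensional K L]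
    [IsGalois K L] : IsLocalRing (integralClosure O L) := by
  have := finite_integralClosure O K L
  exact isLocalRing_of_finite (O := O)

variable {O K L : Type u} [CommRing O] [Field K] [Algebra O K]
  [Field L] [Algebra K L] [Algebra O L] [IsScalarTower O K L]

lemma exists_algebraMap_of_fixed [IsDomain O] [IsDiscreteValuationRing O] [IsFractionRing O K]
    [FiniteDimensional K L] [IsGalois K L] (x : L)
    (hx : x ∈ integralClosure O L) (h : ∀ g : L ≃ₐ[K] L, g x = x) :
    ∃ r : O, algebraMap O L r = x := by
  obtain ⟨y, rfl⟩ := (IsGalois.mem_range_algebraMap_iff_fixed (F := K) x).mpr h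
  have h1 : IsIntegral O y := (isIntegral_algebraMap_iff (algebraMap K L).injective).mp hx
  obtain ⟨r, rfl⟩ := IsIntegrallyClosed.isIntegral_iff.mp h1
  exact ⟨r, IsScalarTower.algebraMap_apply O K L r⟩

/-- The maximal ideal of a local ring of integers is Galois stable, so its inertia group is
normal. -/
lemma normal_inertia [IsLocalRing (integralClosure O L)]
    (P : Ideal (integralClosure O L)) [hP : P.IsMaximal] : (P.inertia (L ≃ₐ[K] L)).Normal := by
  refine ⟨fun σ hσ τ x => ?_⟩
  have h1 := hσ (τ⁻¹ • x)
  have h2 : (τ * σ * τ⁻¹) • x - x = τ • (σ • (τ⁻¹ • x) - τ⁻¹ • x) := by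
    rw [smul_sub, smul_smul, smul_smul, smul_smul, mul_inv_cancel, one_smul]
  rw [h2]
  rw [IsLocalRing.eq_maximalIdeal hP] at h1 ⊢
  change _ ∈ IsLocalRing.maximalIdeal _ at h1
  change _ ∈ IsLocalRing.maximalIdeal _
  rw [IsLocalRing.mem_maximalIdeal, mem_nonunits_iff] at h1 ⊢
  intro h3
  refine h1 ?_
  have := h3.map (MulSemiringAction.toRingHom (L ≃ₐ[K] L) (integralClosure O L) τ⁻¹)
  simpa [smul_smul] using this

end Integers

section RootsOfUnity

/-- Two roots of unity of order invertible in the ring that are congruent modulo the Jacobson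
radical are equal. -/
lemma eq_of_pow_eq_one {T : Type*} [CommRing T] {n : ℕ} (hn0 : n ≠ 0) (hn : IsUnit (n : T))
    {a b : T} (ha : a ^ n = 1) (hb : b ^ n = 1) (hab : a - b ∈ Ideal.jacobson (⊥ : Ideal T)) :
    a = b := by
  have hbu : IsUnit b := IsUnit.of_pow_eq_one hb hn0
  -- The cofactor of `a - b` in `a ^ n - b ^ n = 0` is congruent to `n b ^ (n - 1)`, a unit.
  have h1 : (a - b) * ∑ i ∈ Finset.range n, a ^ i * b ^ (n - 1 - i) = 0 := by
    rw [mul_comm, (Commute.all a b).geom_sum₂_mul, ha, hb, sub_self]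
  have h4 : (n : T) * b ^ (n - 1) = ∑ i ∈ Finset.range n, b ^ i * b ^ (n - 1 - i) := by
    rw [Finset.sum_congr rfl (g := fun _ => b ^ (n - 1)) (fun i hi => by
      rw [← pow_add]; congr 1; have := Finset.mem_range.mp hi; omega)]
    simp
  have h3 : (∑ i ∈ Finset.range n, a ^ i * b ^ (n - 1 - i)) - n * b ^ (n - 1)
      ∈ Ideal.jacobson (⊥ : Ideal T) := by
    rw [h4, ← Finset.sum_sub_distrib]
    refine Ideal.sum_mem _ fun i _ => ?_
    rw [← sub_mul]
    exact Ideal.mul_mem_right _ _ (Ideal.mem_of_dvd _ (sub_dvd_pow_sub_pow a b i) hab)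
  obtain ⟨v, hv⟩ := hn.mul (hbu.pow (n - 1))
  have h2 : IsUnit (∑ i ∈ Finset.range n, a ^ i * b ^ (n - 1 - i)) := by
    rw [← hv] at h3
    have h5 := v.isUnit.mul (Ideal.mem_jacobson_bot.mp h3 ↑v⁻¹)
    convert h5 using 1
    linear_combination (-(∑ i ∈ Finset.range n, a ^ i * b ^ (n - 1 - i)) + v) * v.mul_inv
  exact sub_eq_zero.mp ((h2.mul_left_eq_zero).mp h1)

end RootsOfUnity

section FixedField

variable (O : Type u) {K L : Type u} [CommRing O] [IsDomain O] [IsDiscreteValuationRing O]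
  [Field K] [Algebra O K] [IsFractionRing O K]
  [Field L] [Algebra K L] [Algebra O L] [IsScalarTower O K L] [FiniteDimensional K L]
  [IsGalois K L]

instance isScalarTower_intermediateField (F : IntermediateField K L) : IsScalarTower O F L :=
  IsScalarTower.of_algebraMap_eq fun _ => rfl

/-- The inclusion of the ring of integers of an intermediate field. -/
def integralClosureMap (O : Type u) {K L : Type u} [CommRing O] [Field K] [Algebra O K] [Field L]
    [Algebra K L] [Algebra O L] [IsScalarTower O K L] (F : IntermediateField K L) :
    integralClosure O F →ₐ[O] integralClosure O L :=
  (IsScalarTower.toAlgHom O F L).mapIntegralClosure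

lemma finite_quotient_integralClosure [Finite (IsLocalRing.ResidueField O)]
    (hfin : Module.Finite O (integralClosure O L))
    (P : Ideal (integralClosure O L)) [hP : P.IsMaximal] :
    Finite (integralClosure O L ⧸ P) := by
  have h1 : P.under O = IsLocalRing.maximalIdeal O :=
    IsLocalRing.eq_maximalIdeal (Ideal.isMaximal_comap_of_isIntegral_of_isMaximal P)
  have h2 : Finite (O ⧸ P.under O) := by rw [h1]; assumption
  have h3 : Module.Finite (O ⧸ P.under O) (integralClosure O L ⧸ P) :=
    Module.Finite.of_restrictScalars_finite O _ _
  exact Module.finite_of_finite (O ⧸ P.under O)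

/-- Over the fixed field of the inertia group, the ring of integers has Galois coordinates: an
automorphism that is nontrivial there moves some inertia-invariant element by a unit. -/
lemma isGaloisExt_fixedField [IsAdicComplete (IsLocalRing.maximalIdeal O) O]
    [Finite (IsLocalRing.ResidueField O)] (P : Ideal (integralClosure O L)) [hP : P.IsMaximal]
    (F : IntermediateField K L) (hF : F = IntermediateField.fixedField (P.inertia (L ≃ₐ[K] L)))
    [IsGalois K F] :
    IsGaloisExt O (integralClosure O F) (F ≃ₐ[K] F) := by
  have := isLocalRing_integralClosure O K L
  have := isLocalRing_integralClosure O K F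
  have := finite_integralClosure O K F
  have := finite_quotient_integralClosure O (finite_integralClosure O K L) P
  have hinj : Function.Injective (algebraMap O (integralClosure O F)) := by
    have := isTorsionFree_of_isFractionRing O K F
    exact FaithfulSMul.algebraMap_injective _ _
  refine isGaloisExt_of_isUnit hinj (fun g r => ?_) ?_ (fun g hg => ?_) ?_
  · rw [smul_algebraMap]
  · intro s hs
    obtain ⟨r, hr⟩ := exists_algebraMap_of_fixed (O := O) (K := K) (s : F) s.2
      (fun g => congrArg Subtype.val (hs g))
    exact ⟨r, Subtype.ext hr⟩
  · obtain ⟨σ, rfl⟩ := AlgEquiv.restrictNormalHom_surjective (F := K) (K₁ := F) L g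
    have hσ : σ ∉ P.inertia (L ≃ₐ[K] L) := by
      intro h
      refine hg ?_
      rw [← MonoidHom.mem_ker, IntermediateField.restrictNormalHom_ker, hF,
        IntermediateField.fixingSubgroup_fixedField]
      exact h
    -- An element moved by `σ` modulo `P` is congruent to an inertia-invariant one.
    obtain ⟨x, hx⟩ : ∃ x, σ • x - x ∉ P := by
      by_contra! h
      exact hσ h
    obtain ⟨b, hb, hxb⟩ := exists_fixed_sub_mem (G := P.inertia (L ≃ₐ[K] L)) P
      (fun g a => g.2 a) x
    have hbF : (b : L) ∈ F := by
      rw [hF, IntermediateField.mem_fixedField_iff]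
      exact fun τ hτ => congrArg Subtype.val (hb ⟨τ, hτ⟩)
    have hbint : IsIntegral O (⟨(b : L), hbF⟩ : F) :=
      (isIntegral_algebraMap_iff (algebraMap F L).injective).mp b.2
    let b' : integralClosure O F := ⟨⟨b, hbF⟩, hbint⟩
    refine ⟨b', ?_⟩
    let ι := integralClosureMap O F
    have hι (y : integralClosure O F) : ((ι y : integralClosure O L) : L) = ((y : F) : L) := rfl
    have hιb : ι b' = b := Subtype.ext rfl
    have hισ : ι ((AlgEquiv.restrictNormalHom F) σ • b') = σ • b :=
      Subtype.ext (AlgEquiv.restrictNormal_commutes σ F (b' : F))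
    have hnot : σ • b - b ∉ P := fun h => hx (by
      have hs : σ • (x - b) ∈ P := by
        have h1 := hxb
        rw [IsLocalRing.eq_maximalIdeal hP] at h1 ⊢
        rw [IsLocalRing.mem_maximalIdeal, mem_nonunits_iff] at h1 ⊢
        intro h3
        refine h1 ?_
        have := h3.map (MulSemiringAction.toRingHom (L ≃ₐ[K] L) (integralClosure O L) σ⁻¹)
        simpa [smul_smul] using this
      have h4 := P.add_mem (P.add_mem hs h) (P.neg_mem hxb)
      rw [smul_sub] at h4
      convert h4 using 1
      ring)
    by_contra hu
    refine hnot ?_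
    have h5 : ι (b' - AlgEquiv.restrictNormalHom F σ • b') ∈ P := by
      have h6 : (P.comap ι).IsMaximal := by
        have : (ι : integralClosure O F →+* integralClosure O L).IsIntegral := by
          refine RingHom.IsIntegral.tower_top (algebraMap O _) _ ?_
          rw [AlgHom.comp_algebraMap]
          exact algebraMap_isIntegral_iff.mpr inferInstance
        exact Ideal.isMaximal_comap_of_isIntegral_of_isMaximal' _ this P
      have h7 : b' - AlgEquiv.restrictNormalHom F σ • b' ∈ P.comap ι := by
        rw [IsLocalRing.eq_maximalIdeal h6]
        exact hu
      exact h7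
    rw [map_sub, hιb, hισ] at h5
    simpa using P.neg_mem h5
  · rw [Ne, Ideal.map_eq_top_iff _ hinj (algebraMap_isIntegral_iff.mpr inferInstance)]
    exact (IsLocalRing.maximalIdeal.isMaximal O).ne_top

/-- A linear form on the ring of integers of an intermediate field extends to a linear form on `L`
that is integral on the ring of integers, since the quotient of the rings of integers is torsion
free. -/
lemma exists_extension_form (F : IntermediateField K L) [IsGalois K F]
    (f : integralClosure O F →ₗ[O] O) :
    ∃ f' : L →ₗ[K] K, (∀ x ∈ integralClosure O L, f' x ∈ (algebraMap O K).range) ∧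
      ∀ s : integralClosure O F, f' (s : F) = algebraMap O K (f s) := by
  have := finite_integralClosure O K L
  have := isTorsionFree_of_isFractionRing O K L
  have := isTorsionFree_of_isFractionRing O K F
  let ι := integralClosureMap O F
  have hι (y : integralClosure O F) : ((ι y : integralClosure O L) : L) = ((y : F) : L) := rfl
  let N := LinearMap.range ι.toLinearMap
  have htf : Module.IsTorsionFree O (integralClosure O L ⧸ N) := by
    refine Module.isTorsionFree_iff_smul_eq_zero.mpr fun r y => ?_
    obtain ⟨y, rfl⟩ := N.mkQ_surjective y
    rw [← map_smul, N.mkQ_apply, N.mkQ_apply, Submodule.Quotient.mk_eq_zero,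
      Submodule.Quotient.mk_eq_zero]
    rintro ⟨z, hz⟩
    refine or_iff_not_imp_left.mpr fun hr => ?_
    have hrK : algebraMap O K r ≠ 0 := by
      rwa [Ne, map_eq_zero_iff _ (IsFractionRing.injective O K)]
    have hzy : ((z : F) : L) = algebraMap O L r * (y : L) := by
      rw [← hι, show ι z = r • y from hz, Algebra.smul_def]
      rfl
    have hyF : (y : L) ∈ F := by
      have h1 : (y : L) = (algebraMap O K r)⁻¹ • ((z : F) : L) := by
        rw [hzy, IsScalarTower.algebraMap_apply O K L, ← Algebra.smul_def, smul_smul,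
          inv_mul_cancel₀ hrK, one_smul]
      rw [h1]
      exact F.smul_mem (z : F).2
    have hyint : IsIntegral O (⟨(y : L), hyF⟩ : F) :=
      (isIntegral_algebraMap_iff (algebraMap F L).injective).mp y.2
    exact ⟨⟨_, hyint⟩, Subtype.ext rfl⟩
  -- The torsion-free quotient is projective, so there is a projection `p` onto the ring of
  -- integers of `F`.
  obtain ⟨s, hs⟩ := Module.projective_lifting_property N.mkQ LinearMap.id N.mkQ_surjective
  have hinj : Function.Injective ι.toLinearMap := fun x y hxy =>
    Subtype.ext (Subtype.ext (congrArg (fun z : integralClosure O L => (z : L)) hxy))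
  let e := LinearEquiv.ofInjective ι.toLinearMap hinj
  let p : integralClosure O L →ₗ[O] integralClosure O F :=
    e.symm.toLinearMap ∘ₗ (LinearMap.id - s ∘ₗ N.mkQ).codRestrict N (fun a => by
      have := LinearMap.congr_fun hs (N.mkQ a)
      simp only [LinearMap.comp_apply, LinearMap.id_apply] at this
      rw [← Submodule.Quotient.mk_eq_zero N]
      change N.mkQ (a - s (N.mkQ a)) = 0
      rw [map_sub, this, sub_self])
  have hp (y : integralClosure O F) : p (ι y) = y := by
    refine e.injective (Subtype.ext ?_)
    have : N.mkQ (ι y) = 0 := by simp [N]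
    simp [p, this, e]
  let i : integralClosure O L →ₗ[O] L :=
    (IsScalarTower.toAlgHom O (integralClosure O L) L).toLinearMap
  have : IsLocalizedModule (nonZeroDivisors O) i :=
    isLocalizedModule_iff_isLocalization.mpr (IsIntegralClosure.isLocalization O K L _)
  have hloc (x : nonZeroDivisors O) : IsUnit ((algebraMap O (Module.End O K)) ↑x) :=
    IsLocalizedModule.map_units (Algebra.linearMap O K) x
  let h : L →ₗ[O] K := IsLocalizedModule.lift (nonZeroDivisors O) i
    (Algebra.linearMap O K ∘ₗ f ∘ₗ p) hloc
  have hh (x : integralClosure O L) : h x = algebraMap O K (f (p x)) :=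
    IsLocalizedModule.lift_apply _ i _ hloc x
  refine ⟨h.extendScalarsOfIsLocalization (nonZeroDivisors O) K, fun x hx => ?_, fun x => ?_⟩
  · exact ⟨_, (hh ⟨x, hx⟩).symm⟩
  · have h1 := hh (ι x)
    rwa [hp] at h1

end FixedField

/-! ### Unramified extensions -/

section Unramified

open Polynomial

/-- A complete local ring has a finite étale extension with prescribed finite separable residue
field extension. -/
lemma exists_unramified (O k' : Type u) [CommRing O] [IsLocalRing O] [IsNoetherianRing O]
    [IsAdicComplete (IsLocalRing.maximalIdeal O) O] [Field k']
    [Algebra (IsLocalRing.ResidueField O) k'] [FiniteDimensional (IsLocalRing.ResidueField O) k']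
    [Algebra.IsSeparable (IsLocalRing.ResidueField O) k']
    [Algebra O k'] [IsScalarTower O (IsLocalRing.ResidueField O) k'] :
    ∃ (T : Type u) (_ : CommRing T) (_ : Algebra O T) (π : T →ₐ[O] k'),
      Module.Finite O T ∧ Module.Free O T ∧ Algebra.Smooth O T ∧
      IsAdicComplete ((IsLocalRing.maximalIdeal O).map (algebraMap O T)) T ∧
      Function.Surjective π ∧
      RingHom.ker π = (IsLocalRing.maximalIdeal O).map (algebraMap O T) := by
  obtain ⟨α, hα⟩ := Field.exists_primitive_element (IsLocalRing.ResidueField O) k'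
  have hαi : IsIntegral (IsLocalRing.ResidueField O) α := Algebra.IsIntegral.isIntegral α
  -- Adjoin a root of a monic lift `f` of the minimal polynomial of a primitive element.
  obtain ⟨f, hf, hdeg, hmon⟩ := lifts_and_natDegree_eq_and_monic
    (f := algebraMap O (IsLocalRing.ResidueField O)) (p := minpoly (IsLocalRing.ResidueField O) α)
    ((mem_lifts _).mpr (map_surjective _ IsLocalRing.residue_surjective _))
    (minpoly.monic hαi)
  have hev (g : O[X]) : aeval α g =
      aeval α (g.map (algebraMap O (IsLocalRing.ResidueField O))) := by
    rw [aeval_map_algebraMap]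
  have hfα : aeval α f = 0 := by rw [hev, hf, minpoly.aeval]
  let π : AdjoinRoot f →ₐ[O] k' := AdjoinRoot.liftAlgHom f (Algebra.ofId O k') α hfα
  have hπ (g : O[X]) : π (AdjoinRoot.mk f g) = aeval α g := by
    exact AdjoinRoot.lift_mk (i := algebraMap O k') hfα g
  have hfin : Module.Finite O (AdjoinRoot f) := hmon.finite_adjoinRoot
  have hfree : Module.Free O (AdjoinRoot f) := hmon.free_adjoinRoot
  have hcompl : IsAdicComplete
    ((IsLocalRing.maximalIdeal O).map (algebraMap O (AdjoinRoot f))) (AdjoinRoot f) :=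
    isAdicComplete_of_finite _
  have hsurj : Function.Surjective π := by
    intro x
    have hx : x ∈ IntermediateField.adjoin (IsLocalRing.ResidueField O) {α} := by
      rw [hα]; trivial
    rw [← IntermediateField.mem_toSubalgebra,
      IntermediateField.adjoin_simple_toSubalgebra_of_isAlgebraic hαi.isAlgebraic,
      Algebra.adjoin_singleton_eq_range_aeval] at hx
    obtain ⟨g, rfl⟩ := hx
    obtain ⟨g, rfl⟩ := map_surjective (algebraMap O (IsLocalRing.ResidueField O))
      IsLocalRing.residue_surjective g
    exact ⟨AdjoinRoot.mk f g, by rw [hπ, hev]; rfl⟩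
  have hker : RingHom.ker π =
      (IsLocalRing.maximalIdeal O).map (algebraMap O (AdjoinRoot f)) := by
    refine le_antisymm (fun x hx => ?_) ?_
    · obtain ⟨g, rfl⟩ := AdjoinRoot.mk_surjective x
      rw [RingHom.mem_ker] at hx
      have hx : π (AdjoinRoot.mk f g) = 0 := hx
      rw [hπ, hev] at hx
      obtain ⟨h, hh⟩ := minpoly.dvd _ _ hx
      obtain ⟨h, rfl⟩ := map_surjective (algebraMap O (IsLocalRing.ResidueField O))
        IsLocalRing.residue_surjective h
      rw [← hf, ← Polynomial.map_mul] at hh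
      have h1 : g - f * h ∈ (IsLocalRing.maximalIdeal O).map (C : O →+* O[X]) := by
        rw [Ideal.mem_map_C_iff]
        intro n
        rw [← IsLocalRing.residue_eq_zero_iff]
        have := congrArg (fun q => q.coeff n) hh
        simp only [coeff_map] at this
        rw [coeff_sub, map_sub, sub_eq_zero]
        exact this
      have h2 := Ideal.mem_map_of_mem (AdjoinRoot.mk f) h1
      rw [Ideal.map_map, map_sub, map_mul, AdjoinRoot.mk_self, zero_mul, sub_zero] at h2
      exact h2
    · rw [Ideal.map_le_iff_le_comap]
      intro x hx
      rw [Ideal.mem_comap, RingHom.mem_ker]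
      rw [AlgHom.commutes, IsScalarTower.algebraMap_apply O (IsLocalRing.ResidueField O) k',
        IsLocalRing.ResidueField.algebraMap_eq, (IsLocalRing.residue_eq_zero_iff x).mpr hx,
        map_zero]
  refine ⟨AdjoinRoot f, inferInstance, inferInstance, π, hfin, hfree, ?_, hcompl, hsurj, hker⟩
  -- By separability, the derivative of `f` is a unit at the root, which makes the extension étale.
  have hunit : IsUnit (AdjoinRoot.mk f (derivative f)) := by
    have h1 : π (AdjoinRoot.mk f (derivative f)) ≠ 0 := by
      rw [hπ, hev, ← derivative_map, hf]
      have hsep := Algebra.IsSeparable.isSeparable (IsLocalRing.ResidueField O) α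
      exact hsep.aeval_derivative_ne_zero (minpoly.aeval _ _)
    obtain ⟨y, hy⟩ := hsurj (π (AdjoinRoot.mk f (derivative f)))⁻¹
    have h2 : AdjoinRoot.mk f (derivative f) * y - 1 ∈ RingHom.ker π := by
      rw [RingHom.mem_ker]
      rw [map_sub, map_mul, hy, mul_inv_cancel₀ h1, map_one, sub_self]
    rw [hker] at h2
    have h3 := Ideal.mem_jacobson_bot.mp (IsAdicComplete.le_jacobson_bot _ h2) 1
    rw [mul_one, sub_add_cancel] at h3
    exact isUnit_of_mul_isUnit_left h3
  obtain ⟨v, hv⟩ := isUnit_iff_exists_inv.mp hunit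
  obtain ⟨p₁, rfl⟩ := AdjoinRoot.mk_surjective v
  obtain ⟨p₂, hp₂⟩ : f ∣ 1 - derivative f * p₁ := by
    rw [← AdjoinRoot.mk_eq_zero, map_sub, map_mul, hv, map_one, sub_self]
  let S : StandardEtalePair O := ⟨f, hmon, 1, p₁, p₂, 0, by rw [← hp₂]; ring⟩
  have : IsLocalization.Away (1 : AdjoinRoot f) (AdjoinRoot f) :=
    IsLocalization.away_of_isUnit_of_bijective _ isUnit_one Function.bijective_id
  let e : S.Ring ≃ₐ[O] AdjoinRoot f := S.equivAwayAdjoinRoot.trans <| by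
    have h : IsLocalization.Away (AdjoinRoot.mk S.f S.g) (AdjoinRoot f) := by
      rw [show AdjoinRoot.mk S.f S.g = 1 from map_one _]; exact this
    exact (IsLocalization.algEquiv (Submonoid.powers (AdjoinRoot.mk S.f S.g))
      (Localization.Away (AdjoinRoot.mk S.f S.g)) (AdjoinRoot f)).restrictScalars O
  exact Algebra.Smooth.of_equiv e

/-- A prime of a finite unramified extension of a discrete valuation ring that does not contain
the uniformizer is zero, by Nakayama's lemma. -/
lemma injective_of_unramified {O T F k' : Type*} [CommRing O] [IsDomain O]
    [IsDiscreteValuationRing O] [CommRing T] [Algebra O T] [Module.Finite O T] [Field k']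
    (hJ : (IsLocalRing.maximalIdeal O).map (algebraMap O T) ≤ Ideal.jacobson ⊥)
    (π : T →+* k') (hπ : Function.Surjective π)
    (hker : RingHom.ker π = (IsLocalRing.maximalIdeal O).map (algebraMap O T))
    [Field F] (φ : T →+* F) (h : Function.Injective (φ.comp (algebraMap O T))) :
    Function.Injective φ := by
  obtain ⟨ϖ, hϖ⟩ := IsDiscreteValuationRing.exists_irreducible O
  have hm : (IsLocalRing.maximalIdeal O).map (algebraMap O T) = Ideal.span {algebraMap O T ϖ} := by
    rw [hϖ.maximalIdeal_eq, Ideal.map_span, Set.image_singleton]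
  have hϖF : φ (algebraMap O T ϖ) ≠ 0 := fun h0 => hϖ.ne_zero (h (by simpa using h0))
  have hlocal : RingHom.ker φ ≤ Ideal.span {algebraMap O T ϖ} := by
    intro x hx
    rw [← hm, ← hker]
    by_contra hcon
    obtain ⟨y, hy⟩ := hπ (π x)⁻¹
    have h2 : x * y - 1 ∈ RingHom.ker π := by
      rw [RingHom.mem_ker, map_sub, map_mul, hy, mul_inv_cancel₀ hcon, map_one, sub_self]
    rw [hker] at h2
    have h3 := Ideal.mem_jacobson_bot.mp (hJ h2) 1
    rw [mul_one, sub_add_cancel] at h3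
    have h4 := (isUnit_of_mul_isUnit_left h3).map φ
    rw [(RingHom.mem_ker).mp hx] at h4
    exact not_isUnit_zero h4
  have hnoeth : IsNoetherian O T := inferInstance
  have hT : IsNoetherianRing T := isNoetherian_of_tower O hnoeth
  rw [RingHom.injective_iff_ker_eq_bot]
  refine Submodule.eq_bot_of_le_smul_of_le_jacobson_bot (Ideal.span {algebraMap O T ϖ}) _
    (IsNoetherian.noetherian _) (fun x hx => ?_) (hm ▸ hJ)
  obtain ⟨y, rfl⟩ := Ideal.mem_span_singleton.mp (hlocal hx)
  rw [smul_eq_mul]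
  refine Ideal.mul_mem_mul (Ideal.mem_span_singleton_self _) ?_
  rw [RingHom.mem_ker, map_mul] at hx
  exact (mul_eq_zero.mp hx).resolve_left hϖF

end Unramified

/-! ### Characters of split tori -/

section Functoriality

lemma twist_mapDomain {S G Y Y' : Type*} [CommRing S] [Group G] [MulSemiringAction G S]
    [CommGroup Y] [CommGroup Y'] {ρ : G →* MulAut Y} {ρ' : G →* MulAut Y'}
    (θ : Y →* Y') (hθ : ∀ g y, θ (ρ g y) = ρ' g (θ y)) (g : G)
    (a : MonoidAlgebra S Y) : twist S ρ' g (MonoidAlgebra.mapDomainBialgHom S θ a) =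
      MonoidAlgebra.mapDomainBialgHom S θ (twist S ρ g a) := by
  induction a using MonoidAlgebra.induction_linear with
  | zero => simp
  | add a b ha hb => simp only [map_add, ha, hb]
  | single y t => simp [hθ]

variable {R S G Y Y' : Type*} [CommRing R] [CommRing S] [Algebra R S] [Group G] [Fintype G]
    [MulSemiringAction G S] [IsGaloisExt R S G] [CommGroup Y] [CommGroup Y']
    {ρ : G →* MulAut Y} {ρ' : G →* MulAut Y'}

/-- The homomorphism of tori given by an equivariant homomorphism of character groups. -/
def TorusAlg.map (R S : Type*) [CommRing R] [CommRing S] [Algebra R S] [MulSemiringAction G S]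
    [IsGaloisExt R S G] (θ : Y →* Y') (hθ : ∀ g y, θ (ρ g y) = ρ' g (θ y)) :
    TorusAlg R S ρ →ₐc[R] TorusAlg R S ρ' :=
  let f : TorusAlg R S ρ →ₐ[R] TorusAlg R S ρ' :=
    (((MonoidAlgebra.mapDomainBialgHom S θ : MonoidAlgebra S Y →ₐ[S]
      MonoidAlgebra S Y').restrictScalars R).comp (TorusAlg.val R S ρ)).codRestrict (invAlg R S ρ')
      (fun m g => by
        have h := twist_mapDomain θ hθ g (TorusAlg.val R S ρ m)
        rwa [TorusAlg.twist_val] at h)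
  bialgHomOfComp f (TorusAlg.isBialgHomOver_val ρ') (IsGaloisExt.injective (G := G))
    (TorusAlg.tmap_val_injective ρ')
    ((TorusAlg.isBialgHomOver_val ρ).comp_left (MonoidAlgebra.mapDomainBialgHom S θ))

variable (θ : Y →* Y') (hθ : ∀ g y, θ (ρ g y) = ρ' g (θ y))

lemma TorusAlg.val_map (m : TorusAlg R S ρ) : TorusAlg.val R S ρ' (TorusAlg.map R S θ hθ m) =
    MonoidAlgebra.mapDomainBialgHom S θ (TorusAlg.val R S ρ m) := rfl

lemma TorusAlg.map_injective (h : Function.Injective θ) :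
    Function.Injective (TorusAlg.map R S θ hθ) := by
  intro a b hab
  have := congrArg (TorusAlg.val R S ρ') hab
  rw [TorusAlg.val_map, TorusAlg.val_map] at this
  exact TorusAlg.val_injective ρ (MonoidAlgebra.mapDomain_injective h this)

lemma TorusAlg.map_surjective (h : Function.Surjective θ) :
    Function.Surjective (TorusAlg.map R S θ hθ) := by
  obtain ⟨c, hc⟩ := IsGaloisExt.exists_trace (R := R) (S := S) (G := G)
  intro m
  have hs (a : MonoidAlgebra S Y') : ∃ b, MonoidAlgebra.mapDomainBialgHom S θ b = a := by
    induction a using MonoidAlgebra.induction_linear with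
    | zero => exact ⟨0, map_zero _⟩
    | add a b ha hb =>
      obtain ⟨a', rfl⟩ := ha
      obtain ⟨b', rfl⟩ := hb
      exact ⟨a' + b', map_add _ _ _⟩
    | single y t =>
      obtain ⟨z, rfl⟩ := h y
      exact ⟨.single z t, by simp⟩
  obtain ⟨b, hb⟩ := hs (c • TorusAlg.val R S ρ' m)
  obtain ⟨n, hn⟩ := TorusAlg.exists_val_eq (R := R) ρ (avg (R := R) ρ b).2
  refine ⟨n, TorusAlg.val_injective ρ' ?_⟩
  rw [TorusAlg.val_map, hn, coe_avg, map_sum]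
  simp only [← twist_mapDomain θ hθ, hb]
  exact congrArg Subtype.val (avg_smul_eq_self (R := R) ρ' c hc (m : invAlg R S ρ'))

end Functoriality

section Free

/-- A finitely generated free abelian group, written multiplicatively, is some `ℤ ^ d`. -/
lemma exists_mulEquiv_of_free (Y : Type*) [CommGroup Y] [Module.Free ℤ (Additive Y)]
    [Module.Finite ℤ (Additive Y)] : ∃ d : ℕ, Nonempty (Y ≃* Multiplicative (Fin d → ℤ)) := by
  let b := Module.finBasis ℤ (Additive Y)
  exact ⟨_, ⟨(AddEquiv.toMultiplicative b.equivFun.toAddEquiv :)⟩⟩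

end Free

section Characters

variable {K L B C : Type u} [Field K] [Field L] [Algebra K L] [CommRing B] [HopfAlgebra K B]
  [CommRing C] [HopfAlgebra K C]

lemma isTorusSplitBy_of_equiv {Y : Type*} [CommGroup Y] [Module.Free ℤ (Additive Y)]
    [Module.Finite ℤ (Additive Y)] (e : L ⊗[K] B ≃ₐc[L] MonoidAlgebra L Y) :
    IsTorusSplitBy K L B := by
  obtain ⟨d, ⟨f⟩⟩ := exists_mulEquiv_of_free Y
  exact ⟨d, ⟨e.trans (MonoidAlgebra.domCongrBialgEquiv L L f)⟩⟩

/-- An isomorphism of the coordinate ring over `L` with a group algebra identifies the character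
group with the group. -/
def charGroupEquiv {Y : Type*} [CommGroup Y] (e : L ⊗[K] B ≃ₐc[L] MonoidAlgebra L Y) :
    CharGroup K L B ≃* Y :=
  MulEquiv.symm <| MulEquiv.ofBijective
    { toFun := fun y => ⟨e.symm (.single y 1), (MonoidAlgebra.isGroupLikeElem_single_one y).map _⟩
      map_one' := GroupLike.val_injective (by
        change e.symm (1 : MonoidAlgebra L Y) = 1
        exact map_one _)
      map_mul' := fun a b => GroupLike.val_injective (by
        change e.symm (.single (a * b) 1) = e.symm (.single a 1) * e.symm (.single b 1)
        rw [← map_mul, MonoidAlgebra.single_mul_single, mul_one]) :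
      Y →* CharGroup K L B }
    ⟨fun a b hab => by
      have h := e.symm.injective (congrArg GroupLike.val hab)
      exact MonoidAlgebra.single_left_injective one_ne_zero h,
    fun χ => by
      obtain ⟨y, hy⟩ := MonoidAlgebra.isGroupLikeElem_iff_mem_range_single_one.mp (χ.2.map e)
      refine ⟨y, GroupLike.val_injective ?_⟩
      change e.symm (.single y 1) = _
      rw [show MonoidAlgebra.single y (1 : L) = e χ.val from hy]
      exact e.symm_apply_apply _⟩

lemma single_charGroupEquiv {Y : Type*} [CommGroup Y] (e : L ⊗[K] B ≃ₐc[L] MonoidAlgebra L Y)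
    (χ : CharGroup K L B) : MonoidAlgebra.single (charGroupEquiv e χ) 1 = e χ.val := by
  obtain ⟨y, rfl⟩ := (charGroupEquiv e).symm.surjective χ
  rw [MulEquiv.apply_symm_apply]
  exact (e.apply_symm_apply _).symm

lemma charGroup_free (hB : IsTorusSplitBy K L B) : Module.Free ℤ (Additive (CharGroup K L B)) := by
  obtain ⟨d, ⟨e⟩⟩ := hB
  let f : Additive (CharGroup K L B) ≃+ (Fin d → ℤ) := MulEquiv.toAdditiveLeft (charGroupEquiv e)
  exact Module.Free.of_equiv f.toIntLinearEquiv.symm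

lemma charGroup_finite (hB : IsTorusSplitBy K L B) :
    Module.Finite ℤ (Additive (CharGroup K L B)) := by
  obtain ⟨d, ⟨e⟩⟩ := hB
  let f : Additive (CharGroup K L B) ≃+ (Fin d → ℤ) := MulEquiv.toAdditiveLeft (charGroupEquiv e)
  exact Module.Finite.equiv f.toIntLinearEquiv.symm

lemma charGroup_eq_one_of_pow (hB : IsTorusSplitBy K L B) {χ : CharGroup K L B} {n : ℕ}
    (hn : n ≠ 0) (h : χ ^ n = 1) : χ = 1 := by
  have := charGroup_free hB
  have h1 : (n : ℤ) • Additive.ofMul χ = 0 := by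
    rw [natCast_zsmul, ← ofMul_pow, h, ofMul_one]
  exact ((smul_eq_zero (R := ℤ) (M := Additive (CharGroup K L B))).mp h1).resolve_left
    (by exact_mod_cast hn)

variable (K L B) in
/-- The group algebra of the character group maps to the coordinate ring over `L`. -/
def charHom : MonoidAlgebra L (CharGroup K L B) →ₐc[L] L ⊗[K] B :=
  MonoidAlgebra.liftGroupLikeBialgHom

@[simp] lemma charHom_single (χ : CharGroup K L B) (t : L) :
    charHom K L B (.single χ t) = t • χ.val :=
  MonoidAlgebra.lift_single _ _ _

lemma charHom_injective : Function.Injective (charHom K L B) := by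
  intro a b hab
  have h := linearIndep_groupLikeVal (R := L) (A := L ⊗[K] B)
  refine MonoidAlgebra.coeff_injective (h ?_)
  exact (MonoidAlgebra.lift_apply _ a).symm.trans (hab.trans (MonoidAlgebra.lift_apply _ b))

lemma charHom_surjective (hB : IsTorusSplitBy K L B) : Function.Surjective (charHom K L B) := by
  obtain ⟨d, ⟨e⟩⟩ := hB
  have h (a : MonoidAlgebra L (Multiplicative (Fin d → ℤ))) : ∃ b, e (charHom K L B b) = a := by
    induction a using MonoidAlgebra.induction_linear with
    | zero => exact ⟨0, by rw [map_zero, map_zero]⟩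
    | add a b ha hb =>
      obtain ⟨a', rfl⟩ := ha
      obtain ⟨b', rfl⟩ := hb
      exact ⟨a' + b', by rw [map_add, map_add]⟩
    | single y t =>
      obtain ⟨χ, rfl⟩ := (charGroupEquiv e).surjective y
      refine ⟨.single χ t, ?_⟩
      rw [charHom_single, map_smul, ← single_charGroupEquiv, MonoidAlgebra.smul_single,
        smul_eq_mul, mul_one]
  intro v
  obtain ⟨b, hb⟩ := h (e v)
  exact ⟨b, e.injective hb⟩

/-- The coordinate ring over `L` of a torus split by `L` is the group algebra of its character
group. -/
def charEquiv (hB : IsTorusSplitBy K L B) : MonoidAlgebra L (CharGroup K L B) ≃ₐc[L] L ⊗[K] B :=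
  BialgEquiv.ofBijective (charHom K L B) ⟨charHom_injective, charHom_surjective hB⟩

lemma charEquiv_apply (hB : IsTorusSplitBy K L B) (a : MonoidAlgebra L (CharGroup K L B)) :
    charEquiv hB a = charHom K L B a := rfl

variable (L) in
/-- The homomorphism of character groups given by a homomorphism of tori. -/
def mapChar (φ : B →ₐc[K] C) : CharGroup K L B →* CharGroup K L C where
  toFun := charPullback φ
  map_one' := GroupLike.val_injective (map_one _)
  map_mul' _ _ := GroupLike.val_injective (map_mul _ _ _)

lemma val_mapChar (φ : B →ₐc[K] C) (χ : CharGroup K L B) :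
    (mapChar L φ χ).val = Bialgebra.TensorProduct.map (BialgHom.id L L) φ χ.val := rfl

lemma mapChar_comp {D : Type u} [CommRing D] [HopfAlgebra K D] (ψ : C →ₐc[K] D) (φ : B →ₐc[K] C)
    (χ : CharGroup K L B) : mapChar L (ψ.comp φ) χ = mapChar L ψ (mapChar L φ χ) := by
  refine GroupLike.val_injective ?_
  rw [val_mapChar, val_mapChar, val_mapChar]
  generalize χ.val = v
  induction v with
  | zero => simp only [map_zero]
  | add a b ha hb => simp only [map_add, ha, hb]
  | tmul l b => rfl

lemma charHom_mapDomain (φ : B →ₐc[K] C) (a : MonoidAlgebra L (CharGroup K L B)) :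
    charHom K L C (MonoidAlgebra.mapDomainBialgHom L (mapChar L φ) a) =
      Bialgebra.TensorProduct.map (BialgHom.id L L) φ (charHom K L B a) := by
  induction a using MonoidAlgebra.induction_linear with
  | zero => simp only [map_zero]
  | add a b ha hb => simp only [map_add, ha, hb]
  | single χ t => simp [val_mapChar]

end Characters

/-! ### The Galois action on characters -/

section GaloisAction

variable {K L B C : Type u} [Field K] [Field L] [Algebra K L] [CommRing B] [HopfAlgebra K B]
  [CommRing C] [HopfAlgebra K C]

@[simp] lemma galAct_tmul (σ : L ≃ₐ[K] L) (l : L) (b : B) : galAct B σ (l ⊗ₜ b) = σ l ⊗ₜ b := rfl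

lemma galAct_smul (σ : L ≃ₐ[K] L) (l : L) (v : L ⊗[K] B) :
    galAct B σ (l • v) = σ l • galAct B σ v := by
  induction v with
  | zero => simp
  | add a b ha hb => simp only [smul_add, map_add, ha, hb]
  | tmul m b => simp [TensorProduct.smul_tmul']

lemma galAct_mul (σ τ : L ≃ₐ[K] L) (v : L ⊗[K] B) :
    galAct B (σ * τ) v = galAct B σ (galAct B τ v) := by
  induction v with
  | zero => simp
  | add a b ha hb => simp only [map_add, ha, hb]
  | tmul m b => rfl

lemma galAct_one (v : L ⊗[K] B) : galAct B (1 : L ≃ₐ[K] L) v = v := by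
  induction v with
  | zero => simp
  | add a b ha hb => simp only [map_add, ha, hb]
  | tmul m b => rfl

lemma galAct_map (φ : B →ₐc[K] C) (σ : L ≃ₐ[K] L) (v : L ⊗[K] B) :
    galAct C σ (Bialgebra.TensorProduct.map (BialgHom.id L L) φ v) =
      Bialgebra.TensorProduct.map (BialgHom.id L L) φ (galAct B σ v) := by
  induction v with
  | zero => simp only [map_zero]
  | add a b ha hb => simp only [map_add, ha, hb]
  | tmul m b => rfl

/-- The Galois action is semilinear and compatible with the comultiplication, so it preserves
group-like elements. -/
lemma isGroupLikeElem_galAct (σ : L ≃ₐ[K] L) {v : L ⊗[K] B} (hv : IsGroupLikeElem L v) :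
    IsGroupLikeElem L (galAct B σ v) := by
  let s : L ⊗[K] B →ₛₗ[(σ : L →+* L)] L ⊗[K] B :=
    { toFun := galAct B σ
      map_add' := map_add _
      map_smul' := galAct_smul σ }
  have hs (v : L ⊗[K] B) : s v = galAct B σ v := rfl
  constructor
  · have h1 (v : L ⊗[K] B) : Coalgebra.counit (R := L) (galAct B σ v) =
        σ (Coalgebra.counit (R := L) v) := by
      induction v with
      | zero => simp
      | add a b ha hb => simp only [map_add, ha, hb]
      | tmul m b => simp
    rw [h1, hv.counit_eq_one, map_one]
  · have h1 (v : L ⊗[K] B) : Coalgebra.comul (R := L) (galAct B σ v) =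
        TensorProduct.map s s (Coalgebra.comul (R := L) v) := by
      induction v with
      | zero => simp
      | add a b ha hb => simp only [map_add, ha, hb]
      | tmul m b =>
        rw [galAct_tmul]
        have h2 (l : L) : (l ⊗ₜ[K] b : L ⊗[K] B) = l • (1 ⊗ₜ b) := by
          rw [TensorProduct.smul_tmul', smul_eq_mul, mul_one]
        rw [h2 (σ m), h2 m, map_smul, map_smul, LinearMap.map_smulₛₗ]
        congr 1
        have h3 := (isBialgHomOver_includeRight (R := K) L B).comul b
        have h4 (t : B ⊗[K] B) : TensorProduct.map s s (tmap L
            (Algebra.TensorProduct.includeRight : B →ₐ[K] L ⊗[K] B)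
            (Algebra.TensorProduct.includeRight : B →ₐ[K] L ⊗[K] B) t) = tmap L
            (Algebra.TensorProduct.includeRight : B →ₐ[K] L ⊗[K] B)
            (Algebra.TensorProduct.includeRight : B →ₐ[K] L ⊗[K] B) t := by
          induction t with
          | zero => simp only [map_zero]
          | add a b ha hb => simp only [map_add, ha, hb]
          | tmul m n => simp [hs]
        rw [Algebra.TensorProduct.includeRight_apply] at h3
        rw [← h3, h4]
    rw [h1, hv.comul_eq_tmul_self, TensorProduct.map_tmul, hs]

variable (K L B) in
/-- The Galois action on the character group. -/
def galChar : (L ≃ₐ[K] L) →* MulAut (CharGroup K L B) :=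
  { toFun := fun σ =>
      { toFun := fun χ => ⟨galAct B σ χ.val, isGroupLikeElem_galAct σ χ.2⟩
        invFun := fun χ => ⟨galAct B σ⁻¹ χ.val, isGroupLikeElem_galAct σ⁻¹ χ.2⟩
        left_inv := fun χ => GroupLike.val_injective (by
          change galAct B σ⁻¹ (galAct B σ χ.val) = χ.val
          rw [← galAct_mul, inv_mul_cancel, galAct_one])
        right_inv := fun χ => GroupLike.val_injective (by
          change galAct B σ (galAct B σ⁻¹ χ.val) = χ.val
          rw [← galAct_mul, mul_inv_cancel, galAct_one])
        map_mul' := fun χ ψ => GroupLike.val_injective (map_mul (galAct B σ) χ.val ψ.val) }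
    map_one' := MulEquiv.ext fun χ => GroupLike.val_injective (galAct_one χ.val)
    map_mul' := fun σ τ => MulEquiv.ext fun χ => GroupLike.val_injective (galAct_mul σ τ χ.val) }

lemma val_galChar (σ : L ≃ₐ[K] L) (χ : CharGroup K L B) :
    (galChar K L B σ χ).val = galAct B σ χ.val := rfl

lemma mem_invariantChars {I : Subgroup (L ≃ₐ[K] L)} {χ : CharGroup K L B} :
    χ ∈ invariantChars B I ↔ ∀ σ ∈ I, galChar K L B σ χ = χ :=
  forall₂_congr fun _ _ => ⟨fun h => GroupLike.val_injective h, congrArg GroupLike.val⟩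

lemma mapChar_galChar (φ : B →ₐc[K] C) (σ : L ≃ₐ[K] L) (χ : CharGroup K L B) :
    mapChar L φ (galChar K L B σ χ) = galChar K L C σ (mapChar L φ χ) :=
  GroupLike.val_injective (galAct_map φ σ χ.val).symm

lemma charHom_twist (σ : L ≃ₐ[K] L) (a : MonoidAlgebra L (CharGroup K L B)) :
    charHom K L B (twist L (galChar K L B) σ a) = galAct B σ (charHom K L B a) := by
  induction a using MonoidAlgebra.induction_linear with
  | zero => simp only [map_zero]
  | add a b ha hb => simp only [map_add, ha, hb]
  | single χ t => simp [galAct_smul, val_galChar]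

variable [FiniteDimensional K L] [IsGalois K L]

lemma exists_one_tmul_of_galAct (v : L ⊗[K] B) (hv : ∀ σ : L ≃ₐ[K] L, galAct B σ v = v) :
    ∃ b : B, (1 : L) ⊗ₜ[K] b = v := by
  refine exists_one_tmul_of_invariant (G := L ≃ₐ[K] L) v fun σ => ?_
  refine Eq.trans ?_ (hv σ)
  clear hv
  induction v with
  | zero => simp only [map_zero]
  | add a b ha hb => simp only [map_add, ha, hb]
  | tmul m b => rfl

/-- The homomorphism from `B` to the invariants of the group algebra of its characters, which Galois
descent shows to be an isomorphism. -/
def torusHom (hB : IsTorusSplitBy K L B) : B →ₐc[K] TorusAlg K L (galChar K L B) :=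
  let j : B →ₐ[K] MonoidAlgebra L (CharGroup K L B) :=
    (((charEquiv hB).symm.toBialgHom : L ⊗[K] B →ₐ[L] _).restrictScalars K).comp
      Algebra.TensorProduct.includeRight
  let f : B →ₐ[K] TorusAlg K L (galChar K L B) := j.codRestrict (invAlg K L (galChar K L B))
      (fun b σ => charHom_injective (by
        have h : charHom K L B (j b) = 1 ⊗ₜ b := (charEquiv hB).apply_symm_apply _
        rw [charHom_twist, h, galAct_tmul, map_one]))
  bialgHomOfComp f (TorusAlg.isBialgHomOver_val _) (algebraMap K L).injective
    (TorusAlg.tmap_val_injective _)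
    (by
      have h : (TorusAlg.val K L (galChar K L B)).comp f = j := AlgHom.ext fun _ => rfl
      rw [h]
      exact (isBialgHomOver_includeRight L B).comp_left (charEquiv hB).symm.toBialgHom)

lemma charHom_val_torusHom (hB : IsTorusSplitBy K L B) (b : B) :
    charHom K L B (TorusAlg.val K L _ (torusHom hB b)) = 1 ⊗ₜ b :=
  (charEquiv hB).apply_symm_apply _

lemma torusHom_bijective (hB : IsTorusSplitBy K L B) : Function.Bijective (torusHom hB) := by
  constructor
  · intro a b hab
    refine one_tmul_injective K L (L ≃ₐ[K] L) B ?_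
    change (1 : L) ⊗ₜ a = 1 ⊗ₜ b
    rw [← charHom_val_torusHom hB, ← charHom_val_torusHom hB, hab]
  · intro m
    obtain ⟨b, hb⟩ := exists_one_tmul_of_galAct (charHom K L B (TorusAlg.val K L _ m)) fun σ => by
      rw [← charHom_twist, TorusAlg.twist_val]
    refine ⟨b, TorusAlg.val_injective _ (charHom_injective ?_)⟩
    rw [charHom_val_torusHom, hb]

/-- Galois descent: a torus split by `L` is determined by its character group with the Galois
action. -/
def torusEquiv (hB : IsTorusSplitBy K L B) : B ≃ₐc[K] TorusAlg K L (galChar K L B) :=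
  BialgEquiv.ofBijective (torusHom hB) (torusHom_bijective hB)

lemma charHom_val_torusEquiv (hB : IsTorusSplitBy K L B) (b : B) :
    charHom K L B (TorusAlg.val K L _ (torusEquiv hB b)) = 1 ⊗ₜ b :=
  charHom_val_torusHom hB b

end GaloisAction

/-! ### Subtori and factor tori with given character groups -/

section Constructions

variable {K L B : Type u} [Field K] [Field L] [Algebra K L] [CommRing B] [HopfAlgebra K B]
  [FiniteDimensional K L] [IsGalois K L]

section TorusChar

variable {Y : Type u} [CommGroup Y] (ρ : (L ≃ₐ[K] L) →* MulAut Y)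

/-- The character group of the torus constructed from a group with Galois action. -/
def torusChar : CharGroup K L (TorusAlg K L ρ) ≃* Y :=
  charGroupEquiv (TorusAlg.baseChangeEquiv K L ρ)

lemma single_torusChar (χ : CharGroup K L (TorusAlg K L ρ)) :
    MonoidAlgebra.single (torusChar ρ χ) 1 = TorusAlg.baseChangeEquiv K L ρ χ.val :=
  single_charGroupEquiv _ χ

lemma torusChar_galChar (σ : L ≃ₐ[K] L) (χ : CharGroup K L (TorusAlg K L ρ)) :
    torusChar ρ (galChar K L _ σ χ) = ρ σ (torusChar ρ χ) := by
  have h (v : L ⊗[K] TorusAlg K L ρ) : TorusAlg.baseChangeEquiv K L ρ (galAct _ σ v) =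
      twist L ρ σ (TorusAlg.baseChangeEquiv K L ρ v) := by
    induction v with
    | zero => simp only [map_zero]
    | add a b ha hb => simp only [map_add, ha, hb]
    | tmul l b =>
      rw [galAct_tmul, TorusAlg.baseChangeEquiv_tmul, TorusAlg.baseChangeEquiv_tmul, twist_smul,
        TorusAlg.twist_val]
      rfl
  refine MonoidAlgebra.single_left_injective (one_ne_zero (α := L)) ?_
  change MonoidAlgebra.single _ _ = MonoidAlgebra.single _ _
  rw [single_torusChar, val_galChar, h, ← single_torusChar, twist_single, smul_one]

lemma isTorusSplitBy_torusAlg [Module.Free ℤ (Additive Y)] [Module.Finite ℤ (Additive Y)] :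
    IsTorusSplitBy K L (TorusAlg K L ρ) :=
  isTorusSplitBy_of_equiv (TorusAlg.baseChangeEquiv K L ρ)

end TorusChar

variable {Y : Type u} [CommGroup Y] {ρ : (L ≃ₐ[K] L) →* MulAut Y} (hB : IsTorusSplitBy K L B)

/-- The homomorphism to the torus `Spec B` given by an equivariant homomorphism from its character
group. -/
def homOfChar (θ : CharGroup K L B →* Y) (hθ : ∀ σ χ, θ (galChar K L B σ χ) = ρ σ (θ χ)) :
    B →ₐc[K] TorusAlg K L ρ :=
  (TorusAlg.map K L θ hθ).comp (torusEquiv hB).toBialgHom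

lemma torusChar_homOfChar (θ : CharGroup K L B →* Y)
    (hθ : ∀ σ χ, θ (galChar K L B σ χ) = ρ σ (θ χ)) (χ : CharGroup K L B) :
    torusChar ρ (mapChar L (homOfChar hB θ hθ) χ) = θ χ := by
  have h (v : L ⊗[K] B) : TorusAlg.baseChangeEquiv K L ρ
      (Bialgebra.TensorProduct.map (BialgHom.id L L) (homOfChar hB θ hθ) v) =
      MonoidAlgebra.mapDomainBialgHom L θ ((charEquiv hB).symm v) := by
    induction v with
    | zero => simp only [map_zero]
    | add a b ha hb => simp only [map_add, ha, hb]
    | tmul l b =>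
      have h1 : (l ⊗ₜ[K] b : L ⊗[K] B) = l • (1 ⊗ₜ b) := by
        rw [TensorProduct.smul_tmul', smul_eq_mul, mul_one]
      have h2 : (charEquiv hB).symm (1 ⊗ₜ b) = TorusAlg.val K L _ (torusEquiv hB b) := by
        rw [← charHom_val_torusEquiv hB]
        exact (charEquiv hB).symm_apply_apply _
      rw [h1, map_smul, map_smul, map_smul, map_smul, h2]
      congr 1
      exact (TorusAlg.baseChangeEquiv_tmul ρ _ _).trans (one_smul _ _)
  refine MonoidAlgebra.single_left_injective (one_ne_zero (α := L)) ?_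
  change MonoidAlgebra.single _ _ = MonoidAlgebra.single _ _
  rw [single_torusChar, val_mapChar, h]
  have h3 : (charEquiv hB).symm χ.val = .single χ 1 := by
    have h4 := (charEquiv hB).symm_apply_apply (.single χ 1)
    rwa [charEquiv_apply, charHom_single, one_smul] at h4
  rw [h3, MonoidAlgebra.mapDomainBialgHom_single]

lemma homOfChar_surjective (θ : CharGroup K L B →* Y)
    (hθ : ∀ σ χ, θ (galChar K L B σ χ) = ρ σ (θ χ)) (h : Function.Surjective θ) :
    Function.Surjective (homOfChar hB θ hθ) :=
  (TorusAlg.map_surjective θ hθ h).comp (torusEquiv hB).surjective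

/-- The homomorphism from the torus `Spec B` given by an equivariant homomorphism to its character
group. -/
def homToChar (θ : Y →* CharGroup K L B) (hθ : ∀ σ y, θ (ρ σ y) = galChar K L B σ (θ y)) :
    TorusAlg K L ρ →ₐc[K] B :=
  (torusEquiv hB).symm.toBialgHom.comp (TorusAlg.map K L θ hθ)

lemma homToChar_injective (θ : Y →* CharGroup K L B)
    (hθ : ∀ σ y, θ (ρ σ y) = galChar K L B σ (θ y)) (h : Function.Injective θ) :
    Function.Injective (homToChar hB θ hθ) :=
  (torusEquiv hB).symm.injective.comp (TorusAlg.map_injective θ hθ h)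

lemma mapChar_homToChar (θ : Y →* CharGroup K L B)
    (hθ : ∀ σ y, θ (ρ σ y) = galChar K L B σ (θ y)) (ψ : CharGroup K L (TorusAlg K L ρ)) :
    mapChar L (homToChar hB θ hθ) ψ = θ (torusChar ρ ψ) := by
  have h (v : L ⊗[K] TorusAlg K L ρ) :
      Bialgebra.TensorProduct.map (BialgHom.id L L) (homToChar hB θ hθ) v =
      charHom K L B (MonoidAlgebra.mapDomainBialgHom L θ (TorusAlg.baseChangeEquiv K L ρ v)) := by
    induction v with
    | zero => simp only [map_zero]
    | add a b ha hb => simp only [map_add, ha, hb]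
    | tmul l b =>
      rw [TorusAlg.baseChangeEquiv_tmul, map_smul, map_smul, ← TorusAlg.val_map θ hθ]
      have h1 := charHom_val_torusEquiv hB (homToChar hB θ hθ b)
      rw [show torusEquiv hB (homToChar hB θ hθ b) = TorusAlg.map K L θ hθ b from
        (torusEquiv hB).apply_symm_apply _] at h1
      rw [h1, TensorProduct.smul_tmul', smul_eq_mul, mul_one]
      rfl
  refine GroupLike.val_injective ?_
  rw [val_mapChar, h, ← single_torusChar, MonoidAlgebra.mapDomainBialgHom_single, charHom_single,
    one_smul]

end Constructions

/-! ### Smoothness of tori -/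

section Smooth

lemma eq_prod_zpow {d : ℕ} (y : Multiplicative (Fin d → ℤ)) :
    y = ∏ i, (Multiplicative.ofAdd (Pi.single i (1 : ℤ) : Fin d → ℤ)) ^ (y.toAdd i) := by
  apply Multiplicative.toAdd.injective
  rw [toAdd_prod]
  funext j
  simp [Finset.sum_apply, Pi.single_apply]

/-- The group `ℤ ^ d` is generated by its standard basis. -/
lemma eq_top_of_single_mem {d : ℕ} (H : Subgroup (Multiplicative (Fin d → ℤ)))
    (h : ∀ i, Multiplicative.ofAdd (Pi.single i 1) ∈ H) : H = ⊤ := by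
  rw [eq_top_iff]
  rintro y -
  rw [eq_prod_zpow y]
  exact H.prod_mem fun i _ => H.zpow_mem (h i) _

/-- Homomorphisms from the group algebra of `ℤ ^ d` are tuples of units, and units lift along
nilpotent extensions. -/
lemma formallySmooth_monoidAlgebra (S : Type u) [CommRing S] (d : ℕ) :
    Algebra.FormallySmooth S (MonoidAlgebra S (Multiplicative (Fin d → ℤ))) := by
  refine Algebra.FormallySmooth.of_comp_surjective fun C _ _ I hI f => ?_
  have hu (i : Fin d) : IsUnit (f (.single (.ofAdd (Pi.single i 1)) 1)) := by
    refine IsUnit.map f (IsUnit.of_mul_eq_one (.single (.ofAdd (-Pi.single i 1)) 1) ?_)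
    rw [MonoidAlgebra.single_mul_single, ← ofAdd_add, add_neg_cancel, mul_one]
    rfl
  have hnil : ∀ x ∈ I, IsNilpotent x := fun x hx => ⟨2, by
    have := Ideal.pow_mem_pow hx 2
    rwa [hI] at this⟩
  have hl (i : Fin d) : ∃ v : Cˣ,
      Ideal.Quotient.mk I v = f (.single (.ofAdd (Pi.single i 1)) 1) := by
    obtain ⟨c, hc⟩ := Ideal.Quotient.mk_surjective (f (.single (.ofAdd (Pi.single i 1)) 1))
    have h1 : IsUnit c := by
      have h2 := hu i
      rw [← hc] at h2
      obtain ⟨w, hw⟩ := h2.exists_right_inv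
      obtain ⟨w, rfl⟩ := Ideal.Quotient.mk_surjective w
      rw [← map_mul, ← map_one (Ideal.Quotient.mk I), Ideal.Quotient.eq] at hw
      have h3 := (hnil _ hw).isUnit_add_one
      rw [sub_add_cancel] at h3
      exact isUnit_of_mul_isUnit_left h3
    exact ⟨h1.unit, hc⟩
  choose v hv using hl
  let g : Multiplicative (Fin d → ℤ) →* C := (Units.coeHom C).comp
    { toFun := fun y => ∏ i, v i ^ (y.toAdd i)
      map_one' := by simp
      map_mul' := fun a b => by simp [zpow_add, Finset.prod_mul_distrib] }
  refine ⟨MonoidAlgebra.lift S C _ g, ?_⟩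
  have hgv (i : Fin d) : g (.ofAdd (Pi.single i 1)) = v i := by
    have h1 : ∏ j, v j ^ ((Pi.single i (1 : ℤ) : Fin d → ℤ) j) = v i := by
      rw [Finset.prod_eq_single i (fun j _ hj => by rw [Pi.single_eq_of_ne hj, zpow_zero])
        (by simp), Pi.single_eq_same, zpow_one]
    exact congrArg Units.val h1
  let F : MonoidAlgebra S (Multiplicative (Fin d → ℤ)) →ₐ[S] C ⧸ I :=
    (Ideal.Quotient.mkₐ S I).comp (MonoidAlgebra.lift S C _ g)
  let H := MonoidHom.eqLocus ((F : MonoidAlgebra S (Multiplicative (Fin d → ℤ)) →* C ⧸ I).comp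
      (MonoidAlgebra.of S _))
    ((f : MonoidAlgebra S (Multiplicative (Fin d → ℤ)) →* C ⧸ I).comp (MonoidAlgebra.of S _))
  have h1 : H = ⊤ := eq_top_of_single_mem H fun i => by
    change Ideal.Quotient.mk I (MonoidAlgebra.lift S C _ g (.single _ 1)) = f (.single _ 1)
    rw [MonoidAlgebra.lift_single, one_smul, hgv, hv]
  apply MonoidAlgebra.algHom_ext
  · intro y
    have h2 : y ∈ H := by rw [h1]; trivial
    exact h2
  · exact Subsingleton.elim _ _

/-- The coordinate ring of a split torus is smooth. -/
lemma smooth_monoidAlgebra (S Y : Type u) [CommRing S] [IsNoetherianRing S] [CommGroup Y]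
    [Module.Free ℤ (Additive Y)] [Module.Finite ℤ (Additive Y)] :
    Algebra.Smooth S (MonoidAlgebra S Y) := by
  obtain ⟨d, ⟨f⟩⟩ := exists_mulEquiv_of_free Y
  have h1 := formallySmooth_monoidAlgebra S d
  have h2 : Algebra.FiniteType S (MonoidAlgebra S (Multiplicative (Fin d → ℤ))) := inferInstance
  have h3 : Algebra.Smooth S (MonoidAlgebra S (Multiplicative (Fin d → ℤ))) :=
    ⟨h1, Algebra.FinitePresentation.of_finiteType.mp h2⟩
  exact Algebra.Smooth.of_equiv (MonoidAlgebra.domCongr S S f).symm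

lemma smooth_of_isTorusSplitBy {K L B : Type u} [Field K] [Field L] [Algebra K L] [CommRing B]
    [HopfAlgebra K B] (hB : IsTorusSplitBy K L B) : Algebra.Smooth K B := by
  have := charGroup_free hB
  have := charGroup_finite hB
  have := smooth_monoidAlgebra L (CharGroup K L B)
  have : Algebra.Smooth L (L ⊗[K] B) := Algebra.Smooth.of_equiv ((charEquiv hB).toAlgEquiv)
  exact Algebra.Smooth.of_smooth_tensorProduct_of_faithfullyFlat L

/-- The fraction field of a discrete valuation ring is the localization away from a uniformizer,
hence smooth. -/
lemma smooth_fractionField (O K : Type u) [CommRing O] [IsDomain O] [IsDiscreteValuationRing O]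
    [Field K] [Algebra O K] [IsFractionRing O K] : Algebra.Smooth O K := by
  obtain ⟨ϖ, hϖ⟩ := IsDiscreteValuationRing.exists_irreducible O
  have : IsLocalization.Away ϖ K := by
    refine (IsLocalization.iff_of_le_of_exists_dvd (Submonoid.powers ϖ) (nonZeroDivisors O) ?_
      fun n hn => ?_).mpr inferInstance
    · exact powers_le_nonZeroDivisors_of_noZeroDivisors hϖ.ne_zero
    · obtain ⟨m, u, rfl⟩ := IsDiscreteValuationRing.eq_unit_mul_pow_irreducible
        (nonZeroDivisors.ne_zero hn) hϖ
      exact ⟨ϖ ^ m, ⟨m, rfl⟩, ↑u⁻¹, by rw [mul_right_comm, Units.mul_inv, one_mul]⟩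
  exact Algebra.Smooth.of_isLocalization_Away ϖ

end Smooth

/-! ### Tangent spaces -/

section Tangent

/-- The derivations of `N` at the counit with values in `E`: the tangent space of the group
`Spec N` at the unit element. -/
def Tangent (R N E : Type*) [CommRing R] [CommRing N] [Bialgebra R N] [CommRing E] [Algebra R E] :
    Submodule E (N →ₗ[R] E) where
  carrier := {δ | ∀ a b, δ (a * b) = Coalgebra.counit (R := R) a • δ b +
    Coalgebra.counit (R := R) b • δ a}
  add_mem' {δ ε} h1 h2 a b := by
    simp only [LinearMap.add_apply, h1 a b, h2 a b, smul_add]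
    abel
  zero_mem' a b := by simp
  smul_mem' c δ h a b := by
    simp only [LinearMap.smul_apply, h a b, smul_add]
    rw [smul_comm c, smul_comm c]

/-- The universal derivation at the counit, with values in the cotangent space. -/
lemma exists_universal_tangent (R N : Type u) [CommRing R] [CommRing N] [Bialgebra R N]
    [Algebra.Smooth R N] : ∃ (W : Type u) (_ : AddCommGroup W) (_ : Module R W)
      (_ : Module.Finite R W) (_ : Module.Projective R W) (D : N →ₗ[R] W),
      (∀ a b, D (a * b) = Coalgebra.counit (R := R) a • D b + Coalgebra.counit (R := R) b • D a) ∧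
      (∀ (E : Type u) [AddCommGroup E] [Module R E] (δ : N →ₗ[R] E),
        (∀ a b, δ (a * b) = Coalgebra.counit (R := R) a • δ b + Coalgebra.counit (R := R) b • δ a) →
        ∃ l : W →ₗ[R] E, l ∘ₗ D = δ) ∧ Submodule.span R (Set.range D) = ⊤ := by
  let ε := Bialgebra.counitAlgHom R N
  -- The cotangent space is `R ⊗[N] Ω[N⁄R]`, where `N` acts on `R` through the counit.
  let _ : Algebra N R := ε.toRingHom.toAlgebra
  have hε (n : N) (r : R) : n • r = ε n * r := rfl
  have : IsScalarTower R N R := ⟨fun r n s => by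
    rw [hε, map_smul, smul_eq_mul, smul_eq_mul, hε, mul_assoc]⟩
  let D : N →ₗ[R] R ⊗[N] Ω[N⁄R] :=
    { toFun := fun n => 1 ⊗ₜ KaehlerDifferential.D R N n
      map_add' := fun a b => by rw [map_add, TensorProduct.tmul_add]
      map_smul' := fun r n => by
        rw [Derivation.map_smul, RingHom.id_apply, TensorProduct.tmul_smul] }
  have hD (n : N) (v : R ⊗[N] Ω[N⁄R]) : n • v = ε n • v := by
    induction v with
    | zero => rw [smul_zero, smul_zero]
    | add a b ha hb => rw [smul_add, smul_add, ha, hb]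
    | tmul r w => rfl
  refine ⟨R ⊗[N] Ω[N⁄R], inferInstance, inferInstance, inferInstance, inferInstance, D,
    fun a b => ?_, fun E _ _ δ hδ => ?_, ?_⟩
  · change (1 : R) ⊗ₜ _ = _
    rw [Derivation.leibniz, TensorProduct.tmul_add, TensorProduct.tmul_smul,
      TensorProduct.tmul_smul, hD, hD]
    rfl
  · let _ : Module N E := Module.compHom E ε.toRingHom
    have : IsScalarTower R N E := ⟨fun r n e => by
      change ε (r • n) • e = r • ε n • e
      rw [map_smul, smul_assoc]⟩
    have : IsScalarTower N R E := ⟨fun r n e => by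
      change (ε r * n) • e = ε r • n • e
      rw [mul_smul]⟩
    let d : Derivation R N E := Derivation.mk' δ hδ
    refine ⟨LinearMap.liftBaseChange R d.liftKaehlerDifferential, ?_⟩
    ext n
    simp only [LinearMap.comp_apply, D, LinearMap.coe_mk, AddHom.coe_mk,
      LinearMap.liftBaseChange_tmul, one_smul, Derivation.liftKaehlerDifferential_comp_D]
    rfl
  · rw [eq_top_iff]
    rintro v -
    induction v with
    | zero => exact Submodule.zero_mem _
    | add a b ha hb => exact Submodule.add_mem _ ha hb
    | tmul r w =>
      have hw : w ∈ Submodule.span N (Set.range (KaehlerDifferential.D R N)) := by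
        rw [KaehlerDifferential.span_range_derivation]
        trivial
      induction hw using Submodule.span_induction generalizing r with
      | zero => rw [TensorProduct.tmul_zero]; exact Submodule.zero_mem _
      | add a b _ _ ha hb =>
        rw [TensorProduct.tmul_add]; exact Submodule.add_mem _ (ha r) (hb r)
      | smul n w _ h =>
        rw [TensorProduct.tmul_smul, hD]
        exact Submodule.smul_mem _ _ (h r)
      | mem w hw =>
        obtain ⟨n, rfl⟩ := hw
        have h1 : r ⊗ₜ[N] KaehlerDifferential.D R N n = r • D n := by
          change _ = r • ((1 : R) ⊗ₜ _)
          rw [TensorProduct.smul_tmul', smul_eq_mul, mul_one]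
        rw [h1]
        exact Submodule.smul_mem _ _ (Submodule.subset_span ⟨n, rfl⟩)

/-- The dimension of the tangent space of a smooth group over a local ring does not depend on the
field in which it is computed. -/
lemma exists_finrank_tangent (R N : Type u) [CommRing R] [IsLocalRing R] [CommRing N]
    [Bialgebra R N] [Algebra.Smooth R N] : ∃ r : ℕ, ∀ (E : Type u) [Field E] [Algebra R E],
      Nonempty ((Fin r → E) ≃ₗ[E] Tangent R N E) := by
  obtain ⟨W, _, _, _, _, D, hD, huniv, hspan⟩ := exists_universal_tangent R N
  have : Module.Free R W := Module.free_of_flat_of_isLocalRing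
  let b := Module.finBasis R W
  refine ⟨Module.finrank R W, fun E _ _ => ?_⟩
  let φ : (W →ₗ[R] E) →ₗ[E] Tangent R N E :=
    { toFun := fun l => ⟨l ∘ₗ D, fun a c => by simp [hD]⟩
      map_add' := fun l m => rfl
      map_smul' := fun c l => rfl }
  refine ⟨(b.constr E).trans (LinearEquiv.ofBijective φ ⟨fun l m hlm => ?_, fun δ => ?_⟩)⟩
  · have h1 : l ∘ₗ D = m ∘ₗ D := congrArg Subtype.val hlm
    refine LinearMap.ext_on_range (v := D) hspan fun n => LinearMap.congr_fun h1 n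
  · obtain ⟨l, hl⟩ := huniv E δ.1 δ.2
    exact ⟨l, Subtype.ext hl⟩

variable {K L B : Type u} [Field K] [Field L] [Algebra K L] [CommRing B] [HopfAlgebra K B]

/-- A tangent vector of a torus split by `L` is a homomorphism from the character group to the
additive group, so that the tangent space has dimension `d`. -/
lemma nonempty_tangent_equiv {d : ℕ}
    (e : L ⊗[K] B ≃ₐc[L] MonoidAlgebra L (Multiplicative (Fin d → ℤ))) :
    Nonempty (Tangent K B L ≃ₗ[L] (Fin d → L)) := by
  -- The extension of a tangent vector to the coordinate ring over `L`.
  let E : (B →ₗ[K] L) →ₗ[L] L ⊗[K] B →ₗ[L] L := (LinearMap.liftBaseChangeEquiv L).toLinearMap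
  have hE1 (δ : B →ₗ[K] L) (l : L) (b : B) : E δ (l ⊗ₜ b) = l * δ b := rfl
  have hE (δ : Tangent K B L) (v w : L ⊗[K] B) : E δ (v * w) =
      Coalgebra.counit (R := L) v * E δ w + Coalgebra.counit (R := L) w * E δ v := by
    induction v with
    | zero => simp
    | add a b ha hb => simp only [add_mul, map_add, ha, hb]; ring
    | tmul l b =>
      induction w with
      | zero => simp
      | add a b ha hb => simp only [mul_add, map_add, ha, hb]; ring
      | tmul m c =>
        rw [Algebra.TensorProduct.tmul_mul_tmul, hE1, hE1, hE1, δ.2 b c]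
        simp only [TensorProduct.counit_tmul, CommSemiring.counit_apply, Algebra.smul_def]
        ring
  let s (y : Multiplicative (Fin d → ℤ)) : L ⊗[K] B := e.symm (.single y 1)
  have hs1 (y) : Coalgebra.counit (R := L) (s y) = 1 :=
    ((MonoidAlgebra.isGroupLikeElem_single_one y).map e.symm).counit_eq_one
  have hs2 (y z) : s (y * z) = s y * s z := by
    change e.symm _ = e.symm _ * e.symm _
    rw [← map_mul, MonoidAlgebra.single_mul_single, one_mul]
  have hE2 (δ : Tangent K B L) (y z) : E δ (s (y * z)) = E δ (s y) + E δ (s z) := by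
    rw [hs2, hE, hs1, hs1, one_mul, one_mul, add_comm]
  have hE3 (δ : Tangent K B L) : E δ (s 1) = 0 := by
    have := hE2 δ 1 1
    rwa [one_mul, left_eq_add] at this
  let φ : Tangent K B L →ₗ[L] (Fin d → L) :=
    { toFun := fun δ i => E δ (s (.ofAdd (Pi.single i 1)))
      map_add' := fun δ δ' => by
        funext i
        exact LinearMap.congr_fun (map_add E δ.1 δ'.1) _
      map_smul' := fun c δ => by
        funext i
        exact LinearMap.congr_fun (map_smul E c δ.1) _ }
  refine ⟨LinearEquiv.ofBijective φ ⟨?_, fun c => ?_⟩⟩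
  · intro δ δ' hδ
    let H : Subgroup (Multiplicative (Fin d → ℤ)) :=
      { carrier := {y | E δ (s y) = E δ' (s y)}
        mul_mem' := fun {a b} ha hb => by
          change E δ (s (a * b)) = E δ' (s (a * b))
          rw [hE2, hE2, show E δ (s a) = E δ' (s a) from ha, show E δ (s b) = E δ' (s b) from hb]
        one_mem' := (hE3 δ).trans (hE3 δ').symm
        inv_mem' := fun {a} ha => by
          have h1 := hE2 δ a⁻¹ a
          have h2 := hE2 δ' a⁻¹ a
          rw [inv_mul_cancel, hE3] at h1 h2
          rw [← show E δ (s a) = E δ' (s a) from ha, h1] at h2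
          exact add_right_cancel h2 }
    have hH := eq_top_of_single_mem H fun i => congrFun hδ i
    have h0 (a : MonoidAlgebra L (Multiplicative (Fin d → ℤ))) :
        E δ (e.symm a) = E δ' (e.symm a) := by
      induction a using MonoidAlgebra.induction_linear with
      | zero => rw [map_zero, map_zero, map_zero]
      | add a b ha hb => rw [map_add, map_add, map_add, ha, hb]
      | single y t =>
        have h1 : y ∈ H := by rw [hH]; trivial
        have h2 : e.symm (.single y t) = t • s y := by
          change _ = t • e.symm _
          rw [← map_smul, MonoidAlgebra.smul_single, smul_eq_mul, mul_one]
        rw [h2, map_smul, map_smul, show E δ (s y) = E δ' (s y) from h1]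
    refine Subtype.ext (LinearMap.ext fun b => ?_)
    have := h0 (e (1 ⊗ₜ b))
    rwa [show e.symm (e (1 ⊗ₜ b)) = 1 ⊗ₜ b from e.symm_apply_apply _, hE1, hE1, one_mul,
      one_mul] at this
  · -- The additive function `h` on characters with prescribed values on the basis, extended to a
    -- derivation `D` of the group algebra.
    let h (y : Multiplicative (Fin d → ℤ)) : L := ∑ i, c i * (y.toAdd i : L)
    have hadd (y z) : h (y * z) = h y + h z := by
      simp [h, mul_add, Finset.sum_add_distrib]
    let D : MonoidAlgebra L (Multiplicative (Fin d → ℤ)) →ₗ[L] L :=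
      Finsupp.linearCombination L h ∘ₗ (MonoidAlgebra.coeffLinearEquiv L).toLinearMap
    have hD (y t) : D (.single y t) = t * h y := by simp [D]
    have hD2 (a b) : D (a * b) =
        Coalgebra.counit (R := L) a * D b + Coalgebra.counit (R := L) b * D a := by
      induction a using MonoidAlgebra.induction_linear with
      | zero => simp
      | add a b ha hb => simp only [add_mul, map_add, ha, hb]; ring
      | single y t =>
        induction b using MonoidAlgebra.induction_linear with
        | zero => simp
        | add a b ha hb => simp only [mul_add, map_add, ha, hb]; ring
        | single z r =>
          rw [MonoidAlgebra.single_mul_single, hD, hD, hD, hadd]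
          simp only [MonoidAlgebra.counit_single, CommSemiring.counit_apply]
          ring
    let δ : B →ₗ[K] L := D.restrictScalars K ∘ₗ
      (((e : L ⊗[K] B →ₗ[L] _).restrictScalars K) ∘ₗ
        (Algebra.TensorProduct.includeRight : B →ₐ[K] L ⊗[K] B).toLinearMap)
    have hδ (b : B) : δ b = D (e (1 ⊗ₜ b)) := rfl
    have hcounit (b : B) : Coalgebra.counit (R := L) (e (1 ⊗ₜ b)) =
        algebraMap K L (Coalgebra.counit (R := K) b) := by
      rw [CoalgHomClass.counit_comp_apply]
      simp [Algebra.algebraMap_eq_smul_one]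
    refine ⟨⟨δ, fun a b => ?_⟩, ?_⟩
    · rw [hδ, hδ, hδ, ← one_mul (1 : L), ← Algebra.TensorProduct.tmul_mul_tmul, map_mul, hD2,
        one_mul, hcounit, hcounit, Algebra.smul_def, Algebra.smul_def]
    · have hEδ (v : L ⊗[K] B) : E δ v = D (e v) := by
        induction v with
        | zero => simp only [map_zero]
        | add a b ha hb => simp only [map_add, ha, hb]
        | tmul l b =>
          rw [hE1, hδ, ← smul_eq_mul, ← map_smul, ← map_smul, TensorProduct.smul_tmul',
            smul_eq_mul, mul_one]
      funext i
      change E δ (e.symm _) = c i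
      rw [hEδ, show e (e.symm _) = _ from e.apply_symm_apply _, hD, one_mul]
      simp [h, Pi.single_apply]

end Tangent

/-! ### Points of group schemes and the convolution product -/

section Points

open WithConv

variable {R S B T : Type*} [CommRing R] [CommRing S] [Algebra R S] [CommRing B] [Bialgebra R B]
  [CommRing T] [Algebra R T] [Algebra S T] [IsScalarTower R S T]

variable (S) in
/-- The extension of a point of `Spec B` with values in the `S`-algebra `T` to the coordinate ring
over `S`. -/
def extPoint (f : B →ₐ[R] T) : S ⊗[R] B →ₐ[S] T :=
  Algebra.TensorProduct.lift (Algebra.ofId S T) f fun _ _ => Commute.all _ _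

@[simp] lemma extPoint_tmul (f : B →ₐ[R] T) (s : S) (b : B) :
    extPoint S f (s ⊗ₜ b) = algebraMap S T s * f b := rfl

/-- The value of a group-like element at a product of points is the product of its values. -/
lemma extPoint_mul (f g : WithConv (B →ₐ[R] T)) {v : S ⊗[R] B} (hv : IsGroupLikeElem S v) :
    extPoint S (f * g).ofConv v = extPoint S f.ofConv v * extPoint S g.ofConv v := by
  have h (w : S ⊗[R] B) : extPoint S (f * g).ofConv w =
      Algebra.TensorProduct.lift (extPoint S f.ofConv) (extPoint S g.ofConv)
        (fun _ _ => Commute.all _ _) (Coalgebra.comul (R := S) w) := by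
    induction w with
    | zero => simp
    | add a b ha hb => simp only [map_add, ha, hb]
    | tmul s b =>
      have h1 : (s ⊗ₜ[R] b : S ⊗[R] B) = s • (1 ⊗ₜ b) := by
        rw [TensorProduct.smul_tmul', smul_eq_mul, mul_one]
      have h2 := (isBialgHomOver_includeRight (R := R) S B).comul b
      rw [Algebra.TensorProduct.includeRight_apply] at h2
      rw [h1, map_smul, map_smul, map_smul, ← h2]
      congr 1
      rw [extPoint_tmul, map_one, one_mul, AlgHom.convMul_apply]
      generalize (Coalgebra.comul b : B ⊗[R] B) = t
      induction t with
      | zero => simp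
      | add a b ha hb => simp only [map_add, ha, hb]
      | tmul m n => simp
  rw [h, hv.comul_eq_tmul_self, Algebra.TensorProduct.lift_tmul]

lemma extPoint_one {v : S ⊗[R] B} (hv : IsGroupLikeElem S v) :
    extPoint S (1 : WithConv (B →ₐ[R] T)).ofConv v = 1 := by
  have h (w : S ⊗[R] B) : extPoint S (1 : WithConv (B →ₐ[R] T)).ofConv w =
      algebraMap S T (Coalgebra.counit (R := S) w) := by
    induction w with
    | zero => simp
    | add a b ha hb => simp only [map_add, ha, hb]
    | tmul s b =>
      rw [extPoint_tmul, AlgHom.convOne_apply]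
      simp [Algebra.smul_def, ← IsScalarTower.algebraMap_apply, mul_comm]
  rw [h, hv.counit_eq_one, map_one]

lemma extPoint_pow (f : WithConv (B →ₐ[R] T)) (n : ℕ) {v : S ⊗[R] B} (hv : IsGroupLikeElem S v) :
    extPoint S (f ^ n).ofConv v = extPoint S f.ofConv v ^ n := by
  induction n with
  | zero => rw [pow_zero, pow_zero, extPoint_one hv]
  | succ n ih => rw [pow_succ, pow_succ, extPoint_mul _ _ hv, ih]

lemma extPoint_injective : Function.Injective (extPoint S : (B →ₐ[R] T) → _) := by
  intro f g h
  ext b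
  have := AlgHom.congr_fun h (1 ⊗ₜ b)
  simpa using this

lemma comp_convPow {N C D : Type*} [CommRing N] [Bialgebra R N] [CommRing C] [Algebra R C]
    [CommRing D] [Algebra R D] (h : C →ₐ[R] D) (f : WithConv (N →ₐ[R] C)) (n : ℕ) :
    (toConv (h.comp f.ofConv)) ^ n = toConv (h.comp (f ^ n).ofConv) := by
  induction n with
  | zero =>
    rw [pow_zero, pow_zero]
    ext a
    rw [AlgHom.convOne_apply]
    change _ = h ((1 : WithConv (N →ₐ[R] C)).ofConv a)
    rw [AlgHom.convOne_apply, AlgHom.commutes]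
  | succ n ih =>
    rw [pow_succ, pow_succ, ih, AlgHom.comp_convMul_distrib]

lemma convPow_comp {N N' C : Type*} [CommRing N] [Bialgebra R N] [CommRing N'] [Bialgebra R N']
    [CommRing C] [Algebra R C] (f : WithConv (N →ₐ[R] C)) (h : N' →ₐc[R] N) (n : ℕ) :
    (toConv (f.ofConv.comp (h : N' →ₐ[R] N))) ^ n =
      toConv ((f ^ n).ofConv.comp (h : N' →ₐ[R] N)) := by
  induction n with
  | zero =>
    rw [pow_zero, pow_zero]
    ext a
    rw [AlgHom.convOne_apply]
    change _ = (1 : WithConv (N →ₐ[R] C)).ofConv (h a)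
    rw [AlgHom.convOne_apply, CoalgHomClass.counit_comp_apply]
  | succ n ih =>
    rw [pow_succ, pow_succ, ih, AlgHom.convMul_comp_bialgHom_distrib]

end Points

/-! ### Torsion points of smooth groups -/

section Torsion

open WithConv

lemma one_add_pow_of_mul_self {A : Type*} [Ring A] {d : A} (hd : d * d = 0) (n : ℕ) :
    (1 + d) ^ n = 1 + n • d := by
  induction n with
  | zero => simp
  | succ n ih =>
    rw [pow_succ, ih, mul_add, mul_one, add_mul, one_mul, smul_mul_assoc, hd, smul_zero, add_zero,
      succ_nsmul, add_assoc]

/-- An infinitesimal deformation of an `n`-torsion point, `n` invertible, can be corrected to be an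
`n`-torsion point: if `x ^ n = 1 + δ` with `δ` a derivation into a square-zero ideal, then
`x (1 - δ / n)` is `n`-torsion. -/
lemma exists_torsion_of_sq_zero {R N C : Type*} [CommRing R] [CommRing N] [Bialgebra R N]
    [CommRing C] [Algebra R C] (I : Ideal C) (hI : I ^ 2 = ⊥) (n : ℕ) {c : R}
    (hc : (n : R) * c = 1) (x : N →ₐ[R] C)
    (hx : (toConv ((Ideal.Quotient.mkₐ R I).comp x)) ^ n = 1) :
    ∃ y : N →ₐ[R] C, (Ideal.Quotient.mkₐ R I).comp y = (Ideal.Quotient.mkₐ R I).comp x ∧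
      (toConv y) ^ n = 1 := by
  let u : WithConv (N →ₐ[R] C) := (toConv x) ^ n
  let X : WithConv (N →ₗ[R] C) := toConv x.toLinearMap
  -- In the convolution algebra of linear maps, `X ^ n = 1 + Δ`, and `Δ` has values in `I`.
  let Δ : WithConv (N →ₗ[R] C) := X ^ n - 1
  have hII (a b : C) (ha : a ∈ I) (hb : b ∈ I) : a * b = 0 := by
    have := Ideal.mul_mem_mul ha hb
    rwa [← sq, hI] at this
  have hXn : X ^ n = toConv u.ofConv.toLinearMap := (AlgHom.toLinearMap_convPow _ n).symm
  have hΔ (a : N) : Δ.ofConv a = u.ofConv a - algebraMap R C (Coalgebra.counit (R := R) a) := by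
    change (X ^ n).ofConv a - (1 : WithConv (N →ₗ[R] C)).ofConv a = _
    rw [hXn]
    rfl
  have hΔI (a : N) : Δ.ofConv a ∈ I := by
    rw [hΔ, ← Ideal.Quotient.eq]
    have h1 := comp_convPow (Ideal.Quotient.mkₐ R I) (toConv x) n
    have h2 := congrArg (fun f => f.ofConv a) (h1.symm.trans hx)
    exact h2
  have hΔΔ : Δ * Δ = 0 := by
    ext a
    change (Δ * Δ).ofConv a = 0
    rw [LinearMap.convMul_apply]
    generalize (Coalgebra.comul a : N ⊗[R] N) = t
    induction t with
    | zero => simp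
    | add a b ha hb => rw [map_add, map_add, ha, hb, add_zero]
    | tmul a b => exact hII _ _ (hΔI a) (hΔI b)
  have hleib (a b : N) : Δ.ofConv (a * b) = algebraMap R C (Coalgebra.counit (R := R) a) * Δ.ofConv b
      + algebraMap R C (Coalgebra.counit (R := R) b) * Δ.ofConv a := by
    have h1 := hII _ _ (hΔI a) (hΔI b)
    rw [hΔ, hΔ] at h1
    rw [hΔ, hΔ, hΔ, map_mul, Bialgebra.counit_mul, map_mul]
    linear_combination h1
  have hone : Δ.ofConv 1 = 0 := by
    rw [hΔ, map_one, Bialgebra.counit_one, map_one, sub_self]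
  -- The correction factor `1 - Δ / n` is a homomorphism of algebras because `Δ` is a derivation.
  let w : N →ₐ[R] C := AlgHom.ofLinearMap
    ((Algebra.linearMap R C ∘ₗ Coalgebra.counit) + (-c) • Δ.ofConv)
    (by simp [hone])
    (fun a b => by
      have h1 := hII _ _ (hΔI a) (hΔI b)
      simp only [LinearMap.add_apply, LinearMap.comp_apply, LinearMap.smul_apply, hleib,
        Bialgebra.counit_mul, Algebra.linearMap_apply, map_mul, Algebra.smul_def]
      linear_combination (-(algebraMap R C (-c) * algebraMap R C (-c))) * h1)
  have hw (a : N) : w a = algebraMap R C (Coalgebra.counit (R := R) a) + (-c) • Δ.ofConv a := rfl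
  have hW : toConv w.toLinearMap = 1 + (-c) • Δ := rfl
  refine ⟨(toConv x * toConv w).ofConv, ?_, ?_⟩
  · rw [AlgHom.comp_convMul_distrib]
    have h1 : toConv ((Ideal.Quotient.mkₐ R I).comp w) = 1 := by
      ext a
      rw [AlgHom.convOne_apply]
      change Ideal.Quotient.mk I (w a) = _
      rw [hw, map_add, Ideal.Quotient.eq_zero_iff_mem.mpr (Submodule.smul_of_tower_mem I (-c) (hΔI a)),
        add_zero]
      rfl
    change (toConv ((Ideal.Quotient.mkₐ R I).comp x) *
      toConv ((Ideal.Quotient.mkₐ R I).comp w)).ofConv = _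
    rw [h1, mul_one]
  · have hcomm : Commute X (1 + (-c) • Δ) := by
      refine (Commute.one_right _).add_right (Commute.smul_right ?_ _)
      exact (Commute.self_pow X n).sub_right (Commute.one_right _)
    have h1 : (X * (1 + (-c) • Δ)) ^ n = 1 := by
      rw [hcomm.mul_pow, one_add_pow_of_mul_self (by
        rw [smul_mul_smul_comm, hΔΔ, smul_zero])]
      have h2 : n • (-c) • Δ = -Δ := by
        rw [← Nat.cast_smul_eq_nsmul R, smul_smul, mul_neg, hc, neg_smul, one_smul]
      have h3 : X ^ n = 1 + Δ := by simp [Δ]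
      rw [h2, h3, mul_add, mul_one, mul_neg, add_mul, one_mul, hΔΔ]
      abel
    have h4 := AlgHom.toLinearMap_convPow (toConv x * toConv w) n
    rw [AlgHom.toLinearMap_convMul] at h4
    change _ = (X * toConv w.toLinearMap) ^ n at h4
    rw [hW, h1] at h4
    change (toConv x * toConv w) ^ n = 1
    ext a
    exact congrArg (fun f : WithConv (N →ₗ[R] C) => f.ofConv a) h4

/-- The kernel of multiplication by an invertible integer on a smooth group is formally smooth, so
torsion points lift along complete ideals. -/
lemma exists_torsion_lift {R N T : Type u} [CommRing R] [CommRing N] [Bialgebra R N]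
    [Algebra.Smooth R N] [CommRing T] [Algebra R T] (J : Ideal T) [IsAdicComplete J T] (n : ℕ)
    (hn : IsUnit (n : R)) (z : N →ₐ[R] T ⧸ J) (hz : (toConv z) ^ n = 1) :
    ∃ y : N →ₐ[R] T, (Ideal.Quotient.mkₐ R J).comp y = z ∧ (toConv y) ^ n = 1 := by
  obtain ⟨c, hc⟩ := hn.exists_right_inv
  -- `N ⧸ Q` is the coordinate ring of the kernel of the `n`-th power map `pw`.
  let pw : N →ₐ[R] N := ((toConv (AlgHom.id R N)) ^ n).ofConv
  let Q := Ideal.map pw (RingHom.ker (Bialgebra.counitAlgHom R N))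
  have hpw {C : Type u} [CommRing C] [Algebra R C] (x : N →ₐ[R] C) :
      (toConv x) ^ n = toConv (x.comp pw) := comp_convPow x (toConv (AlgHom.id R N)) n
  have hQ1 {C : Type u} [CommRing C] [Algebra R C] (x : N →ₐ[R] C) (hx : (toConv x) ^ n = 1) :
      ∀ a ∈ Q, x a = 0 := by
    have h1 : Q ≤ RingHom.ker x := by
      rw [Ideal.map_le_iff_le_comap]
      intro a ha
      rw [hpw] at hx
      have h2 : x (pw a) = algebraMap R C (Coalgebra.counit (R := R) a) :=
        congrArg (fun f => f.ofConv a) hx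
      have h3 : Coalgebra.counit (R := R) a = 0 := ha
      rw [h3, map_zero] at h2
      exact h2
    exact h1
  have hQ2 {C : Type u} [CommRing C] [Algebra R C] (f : N ⧸ Q →ₐ[R] C) :
      (toConv (f.comp (Ideal.Quotient.mkₐ R Q))) ^ n = 1 := by
    rw [hpw]
    ext a
    rw [AlgHom.convOne_apply]
    change f (Ideal.Quotient.mk Q (pw a)) = _
    have h1 : Ideal.Quotient.mk Q (pw a) =
        algebraMap R (N ⧸ Q) (Coalgebra.counit (R := R) a) := by
      change _ = Ideal.Quotient.mk Q (algebraMap R N _)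
      rw [Ideal.Quotient.eq, ← AlgHom.commutes pw, ← map_sub]
      refine Ideal.mem_map_of_mem _ ?_
      rw [RingHom.mem_ker]
      simp
    rw [h1, AlgHom.commutes]
  have hsm : Algebra.FormallySmooth R (N ⧸ Q) := by
    refine Algebra.FormallySmooth.of_comp_surjective fun C _ _ I hI f => ?_
    obtain ⟨x, hx⟩ := Algebra.FormallySmooth.comp_surjective R N I hI
      (f.comp (Ideal.Quotient.mkₐ R Q))
    obtain ⟨y, hy1, hy2⟩ := exists_torsion_of_sq_zero I hI n hc x (by
      change (toConv ((Ideal.Quotient.mkₐ R I).comp x)) ^ n = 1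
      rw [hx]
      exact hQ2 f)
    refine ⟨Ideal.Quotient.liftₐ Q y (hQ1 y hy2), Ideal.Quotient.algHom_ext R ?_⟩
    rw [AlgHom.comp_assoc, Ideal.Quotient.liftₐ_comp, hy1]
    exact hx
  obtain ⟨g, hg⟩ := Algebra.FormallySmooth.exists_mkₐ_comp_eq_of_isAdicComplete (I := J)
    (Ideal.Quotient.liftₐ Q z (hQ1 z hz))
  refine ⟨g.comp (Ideal.Quotient.mkₐ R Q), ?_, hQ2 g⟩
  rw [← AlgHom.comp_assoc, hg, Ideal.Quotient.liftₐ_comp]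

end Torsion

/-! ### Comparison of the ranks of a torus and of its reduction -/

section Rank

variable {O K L B M N H : Type u} [CommRing O] [IsDomain O]
  [IsDiscreteValuationRing O] [Field K] [Algebra O K] [IsFractionRing O K] [Field L] [Algebra K L]
  [CommRing B] [HopfAlgebra K B]
  [CommRing M] [HopfAlgebra O M] [CommRing N] [HopfAlgebra O N]
  [CommRing H] [HopfAlgebra (IsLocalRing.ResidueField O) H]

/-- A torus embeds its tangent space into that of a smoothening of a model, through which its
generic fibre maps to the smoothening. -/
lemma rank_le_of_isGroupSmoothening [Algebra O L] [IsScalarTower O K L]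
    {ι : M →ₐc[O] N} (hι : IsGroupSmoothening O ι)
    (e : K ⊗[O] M ≃ₐc[K] B) {d : ℕ}
    (eB : L ⊗[K] B ≃ₐc[L] MonoidAlgebra L (Multiplicative (Fin d → ℤ))) {r : ℕ}
    (hr : Nonempty ((Fin r → L) ≃ₗ[L] Tangent O N L)) : d ≤ r := by
  let _ : Algebra O B := Algebra.compHom B (algebraMap O K)
  have : IsScalarTower O K B := IsScalarTower.of_algebraMap_eq' rfl
  have := smooth_of_isTorusSplitBy (K := K) (L := L) (B := B) ⟨d, ⟨eB⟩⟩
  have := smooth_fractionField O K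
  have : Algebra.Smooth O B := Algebra.Smooth.comp O K B
  let j : M →ₐ[O] B := ((e.toBialgHom : K ⊗[O] M →ₐ[K] B).restrictScalars O).comp
    Algebra.TensorProduct.includeRight
  have hj (m : M) : j m = e (1 ⊗ₜ m) := rfl
  -- The generic fibre is smooth over `O`, so its map to the model factors through the smoothening.
  obtain ⟨g, hg, -⟩ := hι.existsUnique_lift B j
  have hg' (m : M) : g (ι m) = e (1 ⊗ₜ m) := AlgHom.congr_fun hg m
  -- By uniqueness in the universal property, the factorization is compatible with the counits.
  have hε (n : N) : Coalgebra.counit (R := K) (g n) = algebraMap O K (Coalgebra.counit n) := by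
    have h1 : ((Bialgebra.counitAlgHom K B).restrictScalars O).comp g =
        (Algebra.ofId O K).comp (Bialgebra.counitAlgHom O N) := by
      refine (hι.existsUnique_lift K
        ((Algebra.ofId O K).comp (Bialgebra.counitAlgHom O M))).unique ?_ ?_
      · ext m
        change Coalgebra.counit (R := K) (g (ι m)) = algebraMap O K (Coalgebra.counit m)
        rw [hg', CoalgHomClass.counit_comp_apply]
        simp [Algebra.algebraMap_eq_smul_one]
      · ext m
        change algebraMap O K (Coalgebra.counit (ι m)) = algebraMap O K (Coalgebra.counit m)
        rw [CoalgHomClass.counit_comp_apply]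
    exact AlgHom.congr_fun h1 n
  let τ : Tangent K B L →ₗ[L] Tangent O N L :=
    { toFun := fun δ => ⟨(δ.1.restrictScalars O) ∘ₗ g.toLinearMap, fun a b => by
        change δ.1 (g (a * b)) = _ • δ.1 (g b) + _ • δ.1 (g a)
        rw [map_mul, δ.2, hε, hε, algebraMap_smul, algebraMap_smul]⟩
      map_add' := fun _ _ => rfl
      map_smul' := fun _ _ => rfl }
  have hτ : Function.Injective τ := by
    intro δ δ' h
    have h1 (v : K ⊗[O] M) : δ.1 (e v) = δ'.1 (e v) := by
      induction v with
      | zero => simp only [map_zero]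
      | add a b ha hb => simp only [map_add, ha, hb]
      | tmul c m =>
        have h2 : (c ⊗ₜ[O] m : K ⊗[O] M) = c • (1 ⊗ₜ m) := by
          rw [TensorProduct.smul_tmul', smul_eq_mul, mul_one]
        rw [h2, map_smul, map_smul, map_smul, ← hg']
        congr 1
        exact LinearMap.congr_fun (congrArg Subtype.val h) (ι m)
    refine Subtype.ext (LinearMap.ext fun b => ?_)
    rw [← show e (e.symm b) = b from e.apply_symm_apply b]
    exact h1 _
  obtain ⟨eT⟩ := nonempty_tangent_equiv eB
  obtain ⟨eN⟩ := hr
  have h := LinearMap.finrank_le_finrank_of_injective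
    (f := eN.symm.toLinearMap ∘ₗ τ ∘ₗ eT.symm.toLinearMap)
    (eN.symm.injective.comp (hτ.comp eT.symm.injective))
  simpa using h

/-- The tangent space of a smooth group is that of the identity component of its special fibre:
derivations at the unit element kill idempotents. -/
lemma rank_le_of_isIdentityComponent {k' : Type u} [Field k']
    [Algebra (IsLocalRing.ResidueField O) k'] [Algebra O k']
    [IsScalarTower O (IsLocalRing.ResidueField O) k']
    {q : IsLocalRing.ResidueField O ⊗[O] N →ₐc[IsLocalRing.ResidueField O] H}
    (hq : IsIdentityComponent q) {d : ℕ}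
    (eH : k' ⊗[IsLocalRing.ResidueField O] H ≃ₐc[k']
      MonoidAlgebra k' (Multiplicative (Fin d → ℤ))) {r : ℕ}
    (hr : Nonempty ((Fin r → k') ≃ₗ[k'] Tangent O N k')) : r ≤ d := by
  obtain ⟨c, hc, hker⟩ := hq.isOpen
  have hcounit (n : N) : Coalgebra.counit (R := IsLocalRing.ResidueField O)
      (1 ⊗ₜ[O] n : IsLocalRing.ResidueField O ⊗[O] N) = algebraMap O _ (Coalgebra.counit n) := by
    rw [Algebra.algebraMap_eq_smul_one]
    simp
  let _ : Algebra O H := Algebra.compHom H (algebraMap O (IsLocalRing.ResidueField O))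
  have : IsScalarTower O (IsLocalRing.ResidueField O) H := IsScalarTower.of_algebraMap_eq' rfl
  let τ : Tangent (IsLocalRing.ResidueField O) H k' →ₗ[k'] Tangent O N k' :=
    { toFun := fun δ => ⟨(δ.1.restrictScalars O) ∘ₗ
          ((q : _ →ₗ[IsLocalRing.ResidueField O] H).restrictScalars O ∘ₗ
          (Algebra.TensorProduct.includeRight :
            N →ₐ[O] IsLocalRing.ResidueField O ⊗[O] N).toLinearMap), fun a b => by
        change δ.1 (q (1 ⊗ₜ (a * b))) = _ • δ.1 (q (1 ⊗ₜ b)) + _ • δ.1 (q (1 ⊗ₜ a))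
        rw [← one_mul (1 : IsLocalRing.ResidueField O), ← Algebra.TensorProduct.tmul_mul_tmul,
          map_mul, δ.2, one_mul, CoalgHomClass.counit_comp_apply,
          CoalgHomClass.counit_comp_apply, hcounit, hcounit, algebraMap_smul, algebraMap_smul]⟩
      map_add' := fun _ _ => rfl
      map_smul' := fun _ _ => rfl }
  have hτ : Function.Surjective τ := by
    intro δ
    let D : IsLocalRing.ResidueField O ⊗[O] N →ₗ[IsLocalRing.ResidueField O] k' :=
      LinearMap.liftBaseChange _ δ.1
    have hD1 (a : IsLocalRing.ResidueField O) (n : N) : D (a ⊗ₜ n) = a • δ.1 n := rfl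
    have hD (v w : IsLocalRing.ResidueField O ⊗[O] N) : D (v * w) =
        Coalgebra.counit (R := IsLocalRing.ResidueField O) v • D w +
        Coalgebra.counit (R := IsLocalRing.ResidueField O) w • D v := by
      induction v with
      | zero => simp
      | add a b ha hb => simp only [add_mul, map_add, ha, hb, add_smul, smul_add]; abel
      | tmul x a =>
        induction w with
        | zero => simp
        | add a b ha hb => simp only [mul_add, map_add, ha, hb, add_smul, smul_add]; abel
        | tmul y b =>
          rw [Algebra.TensorProduct.tmul_mul_tmul, hD1, hD1, hD1, δ.2 a b]
          simp only [TensorProduct.counit_tmul, CommSemiring.counit_apply,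
            Algebra.smul_def, map_mul, ← IsScalarTower.algebraMap_apply]
          ring
    have hqc : q c = 0 := by
      have : c ∈ RingHom.ker (q : _ →+* H) := by
        have h2 : c ∈ Ideal.span {c} := Ideal.mem_span_singleton_self c
        rw [← hker] at h2
        exact h2
      exact this
    have hεc : Coalgebra.counit (R := IsLocalRing.ResidueField O) c = 0 := by
      rw [← CoalgHomClass.counit_comp_apply q, hqc, map_zero]
    -- The counit kills the idempotent `c`, so the Leibniz rule gives `D c = D (c * c) = 0`.
    have hDc : D c = 0 := by
      have := hD c c
      rwa [hc.eq, hεc, zero_smul, add_zero] at this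
    have hDker (v) (hv : q v = 0) : D v = 0 := by
      have h1 : v ∈ Ideal.span {c} := by
        rw [← hker]
        exact hv
      obtain ⟨w, rfl⟩ := Ideal.mem_span_singleton.mp h1
      rw [hD, hεc, hDc, zero_smul, smul_zero, add_zero]
    let ql : IsLocalRing.ResidueField O ⊗[O] N →ₗ[IsLocalRing.ResidueField O] H :=
      (q : IsLocalRing.ResidueField O ⊗[O] N →ₐ[IsLocalRing.ResidueField O] H).toLinearMap
    obtain ⟨s, hs⟩ := LinearMap.exists_rightInverse_of_surjective ql
      (by rw [LinearMap.range_eq_top]; exact hq.surjective)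
    have hs' (h : H) : q (s h) = h := LinearMap.congr_fun hs h
    have hDs (v) : D (s (q v)) = D v := by
      rw [← sub_eq_zero, ← map_sub]
      exact hDker _ (by rw [map_sub, hs', sub_self])
    refine ⟨⟨D ∘ₗ s, fun a b => ?_⟩, Subtype.ext (LinearMap.ext fun n => ?_)⟩
    · have h1 : D (s (a * b)) = D (s a * s b) := by
        rw [← hDs (s a * s b), map_mul q, hs', hs']
      change D (s (a * b)) = _
      rw [h1, hD, ← CoalgHomClass.counit_comp_apply q, hs', ← CoalgHomClass.counit_comp_apply q, hs']
      rfl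
    · change D (s (q (1 ⊗ₜ n))) = δ.1 n
      rw [hDs, hD1, one_smul]
  obtain ⟨eT⟩ := nonempty_tangent_equiv eH
  obtain ⟨eN⟩ := hr
  have h := LinearMap.finrank_le_finrank_of_surjective
    (f := eN.symm.toLinearMap ∘ₗ τ ∘ₗ eT.symm.toLinearMap)
    (eN.symm.surjective.comp (hτ.comp eT.symm.surjective))
  simpa using h

end Rank

/-! ### Counting torsion points -/

section Counting

open WithConv

/-- Points of a split torus with values in roots of unity are torsion. -/
lemma exists_torsion_point {k k₁ k' H : Type u} [Field k] [Field k₁] [Field k'] [Algebra k k₁]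
    [Algebra k₁ k'] [Algebra k k'] [IsScalarTower k k₁ k'] [CommRing H] [HopfAlgebra k H] {d : ℕ}
    (e : k₁ ⊗[k] H ≃ₐc[k₁] MonoidAlgebra k₁ (Multiplicative (Fin d → ℤ))) (n : ℕ)
    (ζ : Fin d → rootsOfUnity n k') :
    ∃ x : H →ₐ[k] k', (∀ i, extPoint k₁ x (e.symm (.single (.ofAdd (Pi.single i 1)) 1)) =
      ((ζ i : k'ˣ) : k')) ∧ (toConv x) ^ n = 1 := by
  let g : Multiplicative (Fin d → ℤ) →* k'ˣ :=
    { toFun := fun y => ∏ i, (ζ i : k'ˣ) ^ (y.toAdd i)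
      map_one' := by simp
      map_mul' := fun a b => by simp [zpow_add, Finset.prod_mul_distrib] }
  have hg (i : Fin d) : g (.ofAdd (Pi.single i 1)) = ζ i := by
    change ∏ j, (ζ j : k'ˣ) ^ ((Pi.single i (1 : ℤ) : Fin d → ℤ) j) = ζ i
    rw [Finset.prod_eq_single i (fun j _ hj => by rw [Pi.single_eq_of_ne hj, zpow_zero])
      (by simp), Pi.single_eq_same, zpow_one]
  have hgn (y) : g y ^ n = 1 := by
    change (∏ i, (ζ i : k'ˣ) ^ (y.toAdd i)) ^ n = 1
    rw [← Finset.prod_pow]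
    refine Finset.prod_eq_one fun i _ => ?_
    rw [← zpow_natCast, zpow_comm, zpow_natCast, (mem_rootsOfUnity n _).mp (ζ i).2, one_zpow]
  let F : k₁ ⊗[k] H →ₐ[k₁] k' :=
    (MonoidAlgebra.lift k₁ k' _ ((Units.coeHom k').comp g)).comp (e.toBialgHom : _ →ₐ[k₁] _)
  let x : H →ₐ[k] k' := (F.restrictScalars k).comp Algebra.TensorProduct.includeRight
  have hx (v) : extPoint k₁ x v = F v := by
    induction v with
    | zero => simp only [map_zero]
    | add a b ha hb => simp only [map_add, ha, hb]
    | tmul l b =>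
      have h1 : (l ⊗ₜ[k] b : k₁ ⊗[k] H) = l • (1 ⊗ₜ b) := by
        rw [TensorProduct.smul_tmul', smul_eq_mul, mul_one]
      rw [h1, map_smul, map_smul]
      congr 1
      rw [extPoint_tmul, map_one, one_mul]
      rfl
  have hxs (y) : extPoint k₁ x (e.symm (.single y 1)) = g y := by
    rw [hx]
    change MonoidAlgebra.lift k₁ k' _ _ (e (e.symm _)) = _
    rw [show e (e.symm (.single y 1)) = _ from e.apply_symm_apply _, MonoidAlgebra.lift_single,
      one_smul]
    rfl
  refine ⟨x, fun i => by rw [hxs, hg], ?_⟩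
  have h2 : extPoint k₁ ((toConv x) ^ n).ofConv =
      extPoint k₁ (1 : WithConv (H →ₐ[k] k')).ofConv := by
    have h3 (a : MonoidAlgebra k₁ (Multiplicative (Fin d → ℤ))) :
        extPoint k₁ ((toConv x) ^ n).ofConv (e.symm a) =
        extPoint k₁ (1 : WithConv (H →ₐ[k] k')).ofConv (e.symm a) := by
      induction a using MonoidAlgebra.induction_linear with
      | zero => simp only [map_zero]
      | add a b ha hb => simp only [map_add, ha, hb]
      | single y t =>
        have hgl : IsGroupLikeElem k₁ (e.symm (.single y 1)) :=
          (MonoidAlgebra.isGroupLikeElem_single_one y).map e.symm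
        have h4 : (MonoidAlgebra.single y t : MonoidAlgebra k₁ _) = t • .single y 1 := by
          rw [MonoidAlgebra.smul_single, smul_eq_mul, mul_one]
        rw [h4, map_smul, map_smul, map_smul, extPoint_pow _ _ hgl, extPoint_one hgl]
        change t • (extPoint k₁ x _) ^ n = _
        rw [hxs, ← Units.val_pow_eq_pow_val, hgn, Units.val_one]
    refine AlgHom.ext fun v => ?_
    rw [← show e.symm (e v) = v from e.symm_apply_apply v]
    exact h3 _
  exact ofConv_injective (extPoint_injective h2)

/-- Tuples of elements of a group of prime order that satisfy a nontrivial monomial relation are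
determined by the other entries, so they cannot be as numerous as all tuples. -/
lemma dvd_of_card_relation {G : Type*} [CommGroup G] [Finite G] {l : ℕ} (hl : l.Prime)
    (hexp : ∀ g : G, g ^ l = 1) (hcard : Nat.card G ≤ l) {d r : ℕ} (hdr : d ≤ r)
    {Z : Type*} [Finite Z] (hZ : Nat.card Z = l ^ r) (f : Z → Fin d → G)
    (hf : Function.Injective f) (a : Fin d → ℤ) (ha : ∀ z, ∏ i, f z i ^ a i = 1) (j : Fin d) :
    (l : ℤ) ∣ a j := by
  by_contra hj
  -- If `l` does not divide `a j`, the relation determines the `j`-th entry from the others.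
  let F : Z → ({i : Fin d // i ≠ j} → G) := fun z i => f z i
  have hF : Function.Injective F := by
    intro z w hzw
    have h1 (i : Fin d) (hi : i ≠ j) : f z i = f w i := congrFun hzw ⟨i, hi⟩
    have h2 : f z j ^ a j = f w j ^ a j := by
      have h3 := (ha z).trans (ha w).symm
      rw [← Finset.mul_prod_erase _ _ (Finset.mem_univ j),
        ← Finset.mul_prod_erase _ _ (Finset.mem_univ j),
        Finset.prod_congr rfl (fun i hi => by rw [h1 i (Finset.ne_of_mem_erase hi)])] at h3
      exact mul_right_cancel h3
    have hcop : IsCoprime (l : ℤ) (a j) :=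
      (Nat.prime_iff_prime_int.mp hl).coprime_iff_not_dvd.mpr hj
    obtain ⟨x, y, hxy⟩ := hcop
    have h3 (g : G) : (g ^ a j) ^ y = g := by
      have h4 : g ^ (x * l + y * a j) = g := by rw [hxy, zpow_one]
      rwa [zpow_add, mul_comm x, zpow_mul, zpow_natCast, hexp, one_zpow, one_mul, mul_comm y,
        zpow_mul] at h4
    refine hf (funext fun i => ?_)
    rcases eq_or_ne i j with rfl | hi
    · rw [← h3 (f z i), h2, h3]
    · exact h1 i hi
  have h1 := Nat.card_le_card_of_injective F hF
  rw [hZ, Nat.card_fun] at h1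
  have h2 : Nat.card {i : Fin d // i ≠ j} = d - 1 := by
    simp [Fintype.card_subtype_compl]
  have hd : 0 < d := Fin.pos j
  rw [h2] at h1
  have h3 : Nat.card G ^ (d - 1) ≤ l ^ (d - 1) := Nat.pow_le_pow_left hcard _
  have h4 : l ^ (d - 1) < l ^ r := Nat.pow_lt_pow_right hl.one_lt (by omega)
  omega

end Counting

/-! ### Torsion points of the standard model take inertia-invariant values on characters -/

section BaseChangePoints

open WithConv

variable {R S B T : Type*} [CommRing R] [CommRing S] [Algebra R S] [CommRing B] [Bialgebra R B]
  [CommRing T] [Algebra R T] [Algebra S T] [IsScalarTower R S T]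

/-- The passage to the extended points is a homomorphism. -/
lemma toConv_extPoint_pow (f : WithConv (B →ₐ[R] T)) (n : ℕ) :
    (toConv (extPoint S f.ofConv)) ^ n = toConv (extPoint S (f ^ n).ofConv) := by
  induction n with
  | zero =>
    rw [pow_zero, pow_zero]
    ext b
    change (1 : WithConv (S ⊗[R] B →ₐ[S] T)) (1 ⊗ₜ b) =
      extPoint S (1 : WithConv (B →ₐ[R] T)).ofConv (1 ⊗ₜ b)
    rw [extPoint_tmul, AlgHom.convOne_apply, AlgHom.convOne_apply]
    simp [Algebra.algebraMap_eq_smul_one]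
  | succ n ih =>
    rw [pow_succ, pow_succ, ih]
    ext b
    change (toConv (extPoint S (f ^ n).ofConv) * toConv (extPoint S f.ofConv)) (1 ⊗ₜ b) =
      extPoint S (f ^ n * f).ofConv (1 ⊗ₜ b)
    have h2 := (isBialgHomOver_includeRight (R := R) S B).comul b
    rw [Algebra.TensorProduct.includeRight_apply] at h2
    rw [extPoint_tmul, map_one, one_mul, AlgHom.convMul_apply, AlgHom.convMul_apply, ← h2]
    generalize (Coalgebra.comul b : B ⊗[R] B) = t
    induction t with
    | zero => simp
    | add a b ha hb => simp only [map_add, ha, hb]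
    | tmul m n => simp

end BaseChangePoints

section Values

open WithConv

lemma map_le_jacobson_of_isIntegral {A C : Type*} [CommRing A] [IsLocalRing A] [CommRing C]
    [Algebra A C] [Algebra.IsIntegral A C] (P : Ideal A) (hP : P ≠ ⊤) :
    P.map (algebraMap A C) ≤ Ideal.jacobson ⊥ := by
  refine le_sInf fun J hJ => ?_
  have := hJ.2
  have h1 : (J.comap (algebraMap A C)).IsMaximal :=
    Ideal.isMaximal_comap_of_isIntegral_of_isMaximal J
  rw [Ideal.map_le_iff_le_comap, IsLocalRing.eq_maximalIdeal h1]
  exact IsLocalRing.le_maximalIdeal hP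

section GenericPoint

variable {O K L B M T : Type u} [CommRing O] [Field K] [Algebra O K] [Field L] [Algebra K L]
  [Algebra O L] [IsScalarTower O K L] [CommRing B] [HopfAlgebra K B] [CommRing M] [HopfAlgebra O M]
  [CommRing T] [Algebra O T]

variable (L) in
/-- The point of the generic fibre with values in `L ⊗ T` that is given by a `T`-valued point of
the model. -/
def genericPoint (e : K ⊗[O] M ≃ₐc[K] B) (t : M →ₐ[O] T) : B →ₐ[K] L ⊗[O] T :=
  (extPoint K ((Algebra.TensorProduct.includeRight : T →ₐ[O] L ⊗[O] T).comp t)).comp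
    (e.symm.toBialgHom : B →ₐ[K] K ⊗[O] M)

lemma genericPoint_apply (e : K ⊗[O] M ≃ₐc[K] B) (t : M →ₐ[O] T) (m : M) :
    genericPoint L e t (e (1 ⊗ₜ m)) = 1 ⊗ₜ t m := by
  change extPoint K _ (e.symm (e _)) = _
  rw [show e.symm (e (1 ⊗ₜ m)) = _ from e.symm_apply_apply _, extPoint_tmul, map_one, one_mul]
  rfl

lemma genericPoint_pow (e : K ⊗[O] M ≃ₐc[K] B) (t : M →ₐ[O] T) {n : ℕ} (ht : (toConv t) ^ n = 1) :
    (toConv (genericPoint L e t)) ^ n = 1 := by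
  have h (m : ℕ) : (toConv (genericPoint L e t)) ^ m = toConv ((extPoint K
      ((Algebra.TensorProduct.includeRight : T →ₐ[O] L ⊗[O] T).comp ((toConv t) ^ m).ofConv)).comp
      (e.symm.toBialgHom : B →ₐ[K] K ⊗[O] M)) := by
    have h1 := convPow_comp (toConv (extPoint K
      ((Algebra.TensorProduct.includeRight : T →ₐ[O] L ⊗[O] T).comp t))) e.symm.toBialgHom m
    have h2 := toConv_extPoint_pow (S := K) (toConv
      ((Algebra.TensorProduct.includeRight : T →ₐ[O] L ⊗[O] T).comp t)) m
    have h3 := comp_convPow (Algebra.TensorProduct.includeRight : T →ₐ[O] L ⊗[O] T) (toConv t) m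
    rw [← toConv_ofConv (toConv t), ofConv_toConv] at h3
    rw [h3] at h2
    rw [h2] at h1
    exact h1
  rw [h, ht, ← pow_zero (toConv t), ← h, pow_zero]

lemma extPoint_pow_eq_one {K L B C : Type*} [CommRing K] [CommRing L] [Algebra K L] [CommRing B]
    [Bialgebra K B] [CommRing C] [Algebra K C] [Algebra L C] [IsScalarTower K L C]
    (x : B →ₐ[K] C) {n : ℕ} (hx : (toConv x) ^ n = 1) {v : L ⊗[K] B} (hv : IsGroupLikeElem L v) :
    extPoint L x v ^ n = 1 := by
  rw [← extPoint_one (R := K) hv, ← hx, extPoint_pow _ _ hv]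

end GenericPoint

variable {O K L B M T : Type u} [CommRing O] [IsDomain O]
  [IsDiscreteValuationRing O]
  [Field K] [Algebra O K] [IsFractionRing O K] [Field L] [Algebra K L]
  [Algebra O L] [IsScalarTower O K L] [FiniteDimensional K L] [IsGalois K L]
  [CommRing B] [HopfAlgebra K B] [CommRing M] [HopfAlgebra O M]
  [CommRing T] [Algebra O T]

/-- For a basis of the ring of integers, the coordinates of `v` belong to forms that are integral
on the ring of integers. -/
lemma exists_coord_forms (v : L ⊗[K] B) : ∃ (n : ℕ) (b : Fin n → integralClosure O L)
    (f : Fin n → L →ₗ[K] K), (∀ i, ∀ x ∈ integralClosure O L, f i x ∈ (algebraMap O K).range) ∧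
    v = ∑ i, (b i : L) ⊗ₜ coordMap B (f i) v := by
  have := finite_integralClosure O K L
  have := free_integralClosure O K L
  have := isTorsionFree_of_isFractionRing O K L
  have : IsLocalization (Algebra.algebraMapSubmonoid (integralClosure O L) (nonZeroDivisors O)) L :=
    IsIntegralClosure.isLocalization O K L (integralClosure O L)
  let b := Module.finBasis O (integralClosure O L)
  let bL := b.localizationLocalization K (nonZeroDivisors O) L
  refine ⟨_, b, fun i => bL.coord i, fun i x hx => ?_, ?_⟩
  · have := b.localizationLocalization_repr_algebraMap K (nonZeroDivisors O) L ⟨x, hx⟩ i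
    exact ⟨_, this.symm⟩
  · induction v with
    | zero => simp
    | add a b ha hb =>
      simp only [map_add, TensorProduct.tmul_add, Finset.sum_add_distrib]
      rw [← ha, ← hb]
    | tmul l c =>
      have h1 (i) : ((b i : L) ⊗ₜ coordMap B (bL.coord i) (l ⊗ₜ c) : L ⊗[K] B) =
          (bL.repr l i • bL i) ⊗ₜ c := by
        rw [TensorProduct.smul_tmul]
        congr 1
        exact (b.localizationLocalization_apply K (nonZeroDivisors O) L i).symm
      rw [Finset.sum_congr rfl (fun i _ => h1 i), ← TensorProduct.sum_tmul, bL.sum_repr]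

/-- Inertia does not change the values at characters of the torsion points of the standard model:
the value at `σ χ` is the conjugate by `σ` of the value at `χ`, the two are integral roots of unity,
and they are congruent modulo the Jacobson radical since `σ` is in the inertia group. -/
lemma extPoint_galAct_eq [IsAdicComplete (IsLocalRing.maximalIdeal O) O] (e : K ⊗[O] M ≃ₐc[K] B)
    (he : Set.range (fun m : M => e (1 ⊗ₜ m)) =
      letI : Algebra O B := Algebra.compHom B (algebraMap O K)
      (standardOrder O K L B : Set B))
    [Module.Finite O T] [Module.Free O T] (t : M →ₐ[O] T) {n : ℕ} (hn0 : n ≠ 0)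
    (hn : IsUnit (n : O)) (ht : (toConv t) ^ n = 1)
    (P : Ideal (integralClosure O L)) [hP : P.IsMaximal] (σ : L ≃ₐ[K] L)
    (hσ : σ ∈ P.inertia (L ≃ₐ[K] L)) (χ : CharGroup K L B) :
    extPoint L (genericPoint L e t) (galAct B σ χ.val) =
      extPoint L (genericPoint L e t) χ.val := by
  have := isLocalRing_integralClosure O K L
  let σA : integralClosure O L →ₐ[O] integralClosure O L :=
    { MulSemiringAction.toRingHom (L ≃ₐ[K] L) (integralClosure O L) σ with
      commutes' := fun r => Subtype.ext (by
        change σ (algebraMap O L r) = algebraMap O L r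
        rw [IsScalarTower.algebraMap_apply O K L, σ.commutes]) }
  have hσA (a : integralClosure O L) : (σA a : L) = σ a := rfl
  -- The action of `σ` on `L ⊗ T`, under which `B` has invariant values, and its restriction `σT`.
  let σE : L ⊗[O] T →ₐ[O] L ⊗[O] T :=
    Algebra.TensorProduct.map ((σ : L →ₐ[K] L).restrictScalars O) (AlgHom.id O T)
  let j : integralClosure O L ⊗[O] T →ₐ[O] L ⊗[O] T :=
    Algebra.TensorProduct.map (integralClosure O L).val (AlgHom.id O T)
  have hj : Function.Injective j :=
    Module.Flat.rTensor_preserves_injective_linearMap (M := T) (integralClosure O L).val.toLinearMap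
      Subtype.val_injective
  let σT : integralClosure O L ⊗[O] T →ₐ[O] integralClosure O L ⊗[O] T :=
    Algebra.TensorProduct.map σA (AlgHom.id O T)
  have hσj (s) : j (σT s) = σE (j s) := by
    induction s with
    | zero => simp only [map_zero]
    | add a b ha hb => simp only [map_add, ha, hb]
    | tmul a y => rfl
  have hσe (c : B) : σE (genericPoint L e t c) = genericPoint L e t c := by
    rw [← show e (e.symm c) = c from e.apply_symm_apply c]
    generalize e.symm c = w
    induction w with
    | zero => simp only [map_zero]
    | add a b ha hb => simp only [map_add, ha, hb]
    | tmul x m =>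
      have h1 : (x ⊗ₜ[O] m : K ⊗[O] M) = x • (1 ⊗ₜ m) := by
        rw [TensorProduct.smul_tmul', smul_eq_mul, mul_one]
      have h2 : x • (1 ⊗ₜ[O] t m : L ⊗[O] T) = (algebraMap K L x) ⊗ₜ t m := by
        rw [TensorProduct.smul_tmul', Algebra.smul_def, mul_one]
      rw [h1, map_smul, map_smul, genericPoint_apply, h2]
      change (σ (algebraMap K L x)) ⊗ₜ[O] t m = _
      rw [σ.commutes]
  have hσv (v : L ⊗[K] B) : extPoint L (genericPoint L e t) (galAct B σ v) =
      σE (extPoint L (genericPoint L e t) v) := by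
    induction v with
    | zero => simp only [map_zero]
    | add a b ha hb => simp only [map_add, ha, hb]
    | tmul l c =>
      rw [galAct_tmul, extPoint_tmul, extPoint_tmul, map_mul σE, hσe]
      congr 1
  -- The value at `χ` is integral, because the coordinates of `χ` lie in the standard order.
  obtain ⟨s, hs⟩ : ∃ s, j s = extPoint L (genericPoint L e t) χ.val := by
    obtain ⟨d, b, f, hf, hv⟩ := exists_coord_forms (O := O) (K := K) χ.val
    have hm (i) : ∃ m : M, e (1 ⊗ₜ m) = coordMap B (f i) χ.val := by
      have : coordMap B (f i) χ.val ∈ Set.range (fun m : M => e (1 ⊗ₜ m)) := by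
        rw [he]
        let _ : Algebra O B := Algebra.compHom B (algebraMap O K)
        exact Algebra.subset_adjoin ⟨χ, f i, hf i, rfl⟩
      exact this
    choose m hm using hm
    refine ⟨∑ i, b i ⊗ₜ t (m i), ?_⟩
    rw [hv, map_sum, map_sum]
    refine Finset.sum_congr rfl fun i _ => ?_
    rw [extPoint_tmul, ← hm, genericPoint_apply]
    change (b i : L) ⊗ₜ[O] t (m i) = (b i : L) ⊗ₜ[O] (1 : T) * _
    rw [Algebra.TensorProduct.tmul_mul_tmul, mul_one, one_mul]
  rw [hσv, ← hs, ← hσj]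
  congr 1
  have hsn : s ^ n = 1 := by
    apply hj
    rw [map_pow, hs, map_one, extPoint_pow_eq_one _ (genericPoint_pow e t ht) χ.2]
  refine eq_of_pow_eq_one hn0 ?_ (by rw [← map_pow, hsn, map_one]) hsn ?_
  · simpa using hn.map (algebraMap O (integralClosure O L ⊗[O] T))
  · have := finite_integralClosure O K L
    have : Module.Finite (integralClosure O L) (integralClosure O L ⊗[O] T) :=
      Module.Finite.base_change _ _ _
    have : Algebra.IsIntegral (integralClosure O L) (integralClosure O L ⊗[O] T) :=
      Algebra.IsIntegral.of_finite _ _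
    refine map_le_jacobson_of_isIntegral P hP.ne_top ?_
    clear hsn hs
    induction s with
    | zero => simp
    | add a b ha hb =>
      rw [map_add, add_sub_add_comm]
      exact add_mem ha hb
    | tmul a y =>
      have h1 : σT (a ⊗ₜ y) - a ⊗ₜ y = (1 ⊗ₜ y) * algebraMap (integralClosure O L) _ (σA a - a) := by
        rw [Algebra.TensorProduct.algebraMap_apply, Algebra.TensorProduct.tmul_mul_tmul, one_mul,
          mul_one]
        change σA a ⊗ₜ[O] y - a ⊗ₜ[O] y = (σA a - a) ⊗ₜ[O] y
        rw [TensorProduct.sub_tmul]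
      rw [h1]
      exact Ideal.mul_mem_left _ _ (Ideal.mem_map_of_mem _ (hσ a))

end Values

/-! ### Good reduction forces inertia to act trivially on characters -/

section Necessity

open WithConv

variable {O K L B M N H : Type u} [CommRing O] [IsDomain O]
  [IsDiscreteValuationRing O]
  [Field K] [Algebra O K] [IsFractionRing O K] [Field L] [Algebra K L]
  [Algebra O L] [IsScalarTower O K L]
  [CommRing B] [HopfAlgebra K B] [CommRing M] [HopfAlgebra O M] [CommRing N] [HopfAlgebra O N]
  [CommRing H] [HopfAlgebra (IsLocalRing.ResidueField O) H]

/-- The values of a point of `Spec B` on characters. -/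
def charValue {F : Type*} [Field F] (v : L ⊗[K] B →+* F) : CharGroup K L B →* Fˣ :=
  MonoidHom.toHomUnits
    { toFun := fun χ => v χ.val
      map_one' := by rw [GroupLike.val_one, map_one]
      map_mul' := fun _ _ => by rw [GroupLike.val_mul, map_mul] }

/-- Reduction of torsion points: the points of order `n` of the special fibre lift to points of
the model, and different points have different lifts. -/
lemma exists_torsion_model_points {ι : M →ₐc[O] N} (hι : IsGroupSmoothening O ι)
    {q : IsLocalRing.ResidueField O ⊗[O] N →ₐc[IsLocalRing.ResidueField O] H}
    (hq : Function.Surjective q) {k' T : Type u} [Field k']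
    [Algebra (IsLocalRing.ResidueField O) k'] [Algebra O k']
    [IsScalarTower O (IsLocalRing.ResidueField O) k'] [CommRing T] [Algebra O T]
    [Algebra.Smooth O T]
    [IsAdicComplete ((IsLocalRing.maximalIdeal O).map (algebraMap O T)) T]
    (π : T →ₐ[O] k') (hπ : Function.Surjective π)
    (hker : RingHom.ker π = (IsLocalRing.maximalIdeal O).map (algebraMap O T))
    {n : ℕ} (hn : IsUnit (n : O)) :
    ∃ t : {x : H →ₐ[IsLocalRing.ResidueField O] k' // (toConv x) ^ n = 1} → (M →ₐ[O] T),
      Function.Injective t ∧ ∀ x, (toConv (t x)) ^ n = 1 := by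
  have := hι.smooth
  let πq : (T ⧸ (IsLocalRing.maximalIdeal O).map (algebraMap O T)) ≃ₐ[O] k' :=
    (Ideal.quotientEquivAlgOfEq O hker.symm).trans (Ideal.quotientKerAlgEquivOfSurjective hπ)
  let y₀ (x : H →ₐ[IsLocalRing.ResidueField O] k') : N →ₐ[O] k' :=
    ((x.comp (q : IsLocalRing.ResidueField O ⊗[O] N →ₐ[IsLocalRing.ResidueField O] H)).restrictScalars
      O).comp
      Algebra.TensorProduct.includeRight
  have hy₀ (x) : extPoint (IsLocalRing.ResidueField O) (y₀ x) =
      x.comp (q : IsLocalRing.ResidueField O ⊗[O] N →ₐ[IsLocalRing.ResidueField O] H) := by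
    ext n
    change extPoint (IsLocalRing.ResidueField O) (y₀ x) (1 ⊗ₜ n) = x (q (1 ⊗ₜ n))
    rw [extPoint_tmul, map_one, one_mul]
    rfl
  have hpow (x) (m : ℕ) : (toConv (y₀ x)) ^ m = toConv (y₀ ((toConv x) ^ m).ofConv) := by
    apply ofConv_injective
    apply extPoint_injective (S := IsLocalRing.ResidueField O)
    have h1 := toConv_extPoint_pow (S := IsLocalRing.ResidueField O) (toConv (y₀ x)) m
    rw [ofConv_toConv, hy₀] at h1
    rw [ofConv_toConv, hy₀, ← ofConv_toConv (extPoint _ _), ← h1]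
    exact congrArg ofConv (convPow_comp (toConv x) q m)
  have hy₀1 (x) (hx : (toConv x) ^ n = 1) : (toConv (y₀ x)) ^ n = 1 := by
    rw [hpow, hx, ← pow_zero (toConv x), ← hpow, pow_zero]
  have hz (x) (hx : (toConv x) ^ n = 1) :
      (toConv (πq.symm.toAlgHom.comp (y₀ x))) ^ n = 1 := by
    have h := comp_convPow πq.symm.toAlgHom (toConv (y₀ x))
    rw [ofConv_toConv] at h
    rw [h, hy₀1 x hx, ← pow_zero (toConv (y₀ x)), ← h, pow_zero]
  choose y hy hyn using fun x : {x : H →ₐ[IsLocalRing.ResidueField O] k' // (toConv x) ^ n = 1} =>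
    exists_torsion_lift ((IsLocalRing.maximalIdeal O).map (algebraMap O T)) n hn _ (hz x.1 x.2)
  refine ⟨fun x => (y x).comp (ι : M →ₐ[O] N), fun x x' h => ?_, fun x => ?_⟩
  · -- A point of the smoothening is determined by its image in the model, as `T` is smooth.
    have h1 : y x = y x' :=
      (hι.existsUnique_lift T ((y x).comp (ι : M →ₐ[O] N))).unique rfl h.symm
    have h2 : y₀ x.1 = y₀ x'.1 := by
      have h3 := (hy x).symm.trans ((congrArg _ h1).trans (hy x'))
      ext b
      exact πq.symm.injective (AlgHom.congr_fun h3 b)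
    have h3 := (hy₀ x.1).symm.trans ((congrArg _ h2).trans (hy₀ x'.1))
    refine Subtype.ext (AlgHom.ext fun b => ?_)
    obtain ⟨b, rfl⟩ := hq b
    exact AlgHom.congr_fun h3 b
  · have h := convPow_comp (toConv (y x)) ι
    rw [ofConv_toConv] at h
    rw [h, hyn, ← pow_zero (toConv (y x)), ← h, pow_zero]

variable [IsAdicComplete (IsLocalRing.maximalIdeal O) O] [Finite (IsLocalRing.ResidueField O)]

/-- If a character takes the value one at all `l`-torsion points of the model, where `l` is a prime
different from the residue characteristic, then it is an `l`-th power: by the comparison of ranks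
the special fibre has at least as many `l`-torsion points as the generic fibre. -/
lemma dvd_of_value_eq_one (e : K ⊗[O] M ≃ₐc[K] B)
    {ι : M →ₐc[O] N} (hι : IsGroupSmoothening O ι)
    {q : IsLocalRing.ResidueField O ⊗[O] N →ₐc[IsLocalRing.ResidueField O] H}
    (hq : Function.Surjective q) {k₁ : Type u} [Field k₁]
    [Algebra (IsLocalRing.ResidueField O) k₁]
    [FiniteDimensional (IsLocalRing.ResidueField O) k₁] {d₁ d : ℕ} (hd : d ≤ d₁)
    (eH : k₁ ⊗[IsLocalRing.ResidueField O] H ≃ₐc[k₁]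
      MonoidAlgebra k₁ (Multiplicative (Fin d₁ → ℤ)))
    (eB : L ⊗[K] B ≃ₐc[L] MonoidAlgebra L (Multiplicative (Fin d → ℤ)))
    {l : ℕ} (hl : l.Prime) (hlO : IsUnit (l : O)) (ψ : CharGroup K L B)
    (hψ : ∀ (T : Type u) [CommRing T] [Algebra O T] [Module.Finite O T] [Module.Free O T]
      (t : M →ₐ[O] T), (toConv t) ^ l = 1 → extPoint L (genericPoint L e t) ψ.val = 1)
    (j : Fin d) : (l : ℤ) ∣ (charGroupEquiv eB ψ).toAdd j := by
  have : NeZero l := ⟨hl.ne_zero⟩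
  have : NeZero (l : k₁) := ⟨by
    have := hlO.map ((algebraMap (IsLocalRing.ResidueField O) k₁).comp (algebraMap O _))
    rw [map_natCast] at this
    exact this.ne_zero⟩
  -- Over `k'` the torus in the special fibre splits and has all its `l`-torsion points; these lift
  -- to points with values in the unramified extension `T` of `O` with residue field `k'`.
  let k' := CyclotomicField l k₁
  have : FiniteDimensional k₁ k' := IsCyclotomicExtension.finite {l} k₁ k'
  have : FiniteDimensional (IsLocalRing.ResidueField O) k' := FiniteDimensional.trans _ k₁ k'
  let _ : Algebra O k' := Algebra.compHom k' (algebraMap O (IsLocalRing.ResidueField O))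
  have : IsScalarTower O (IsLocalRing.ResidueField O) k' := IsScalarTower.of_algebraMap_eq' rfl
  obtain ⟨T, _, _, π, hTf, hTfree, hTs, hTc, hπ, hker⟩ := exists_unramified O k'
  obtain ⟨t, ht, htn⟩ := exists_torsion_model_points hι hq π hπ hker hlO
  choose x hx hxn using fun ζ : Fin d₁ → rootsOfUnity l k' => exists_torsion_point eH l ζ
  have hOL : Function.Injective (algebraMap O L) := by
    rw [IsScalarTower.algebraMap_eq O K L]
    exact (algebraMap K L).injective.comp (IsFractionRing.injective O K)
  have hTE : Function.Injective
      (Algebra.TensorProduct.includeRight : T →ₐ[O] L ⊗[O] T) :=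
    Algebra.TensorProduct.includeRight_injective hOL
  have : Nontrivial T := hπ.nontrivial
  have : Nontrivial (L ⊗[O] T) := hTE.nontrivial
  -- A residue field of `L ⊗ T` is a field containing `L` and `T` in which values can be compared.
  obtain ⟨Q, hQ⟩ := Ideal.exists_maximal (L ⊗[O] T)
  let _ : Field (L ⊗[O] T ⧸ Q) := Ideal.Quotient.field Q
  let φ : T →+* (L ⊗[O] T ⧸ Q) := (Ideal.Quotient.mk Q).comp
    (Algebra.TensorProduct.includeRight : T →ₐ[O] L ⊗[O] T)
  have hφ : Function.Injective φ := by
    refine injective_of_unramified (IsAdicComplete.le_jacobson_bot _) (π : T →+* k') hπ hker φ ?_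
    have h1 : φ.comp (algebraMap O T) =
        ((Ideal.Quotient.mk Q).comp (algebraMap L (L ⊗[O] T))).comp (algebraMap O L) := by
      ext r
      change Ideal.Quotient.mk Q (1 ⊗ₜ algebraMap O T r) = Ideal.Quotient.mk Q (algebraMap O L r ⊗ₜ 1)
      rw [Algebra.algebraMap_eq_smul_one, Algebra.algebraMap_eq_smul_one, TensorProduct.smul_tmul]
    rw [h1]
    exact ((Ideal.Quotient.mk Q).comp (algebraMap L (L ⊗[O] T))).injective.comp hOL
  let tt (ζ : Fin d₁ → rootsOfUnity l k') : M →ₐ[O] T := t ⟨x ζ, hxn ζ⟩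
  have htt : Function.Injective tt := by
    intro ζ ζ' h
    have h1 : x ζ = x ζ' := congrArg Subtype.val (ht h)
    funext i
    refine Subtype.ext (Units.ext ?_)
    rw [← hx, ← hx, h1]
  let w (ζ) : L ⊗[K] B →ₐ[L] (L ⊗[O] T ⧸ Q) :=
    (Ideal.Quotient.mkₐ L Q).comp (extPoint L (genericPoint L e (tt ζ)))
  let c (ζ) : CharGroup K L B →* (L ⊗[O] T ⧸ Q)ˣ := charValue (w ζ : L ⊗[K] B →+* _)
  have hc (ζ χ) : ((c ζ χ : (L ⊗[O] T ⧸ Q)ˣ) : L ⊗[O] T ⧸ Q) = w ζ χ.val := rfl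
  have hcl (ζ χ) : c ζ χ ∈ rootsOfUnity l (L ⊗[O] T ⧸ Q) := by
    rw [mem_rootsOfUnity]
    apply Units.ext
    rw [Units.val_pow_eq_pow_val, hc, Units.val_one]
    change (Ideal.Quotient.mk Q (extPoint L (genericPoint L e (tt ζ)) χ.val)) ^ l = 1
    rw [← map_pow, extPoint_pow_eq_one _ (genericPoint_pow e _ (htn _)) χ.2, map_one]
  let X (i : Fin d) : CharGroup K L B := (charGroupEquiv eB).symm (.ofAdd (Pi.single i 1))
  have hX (χ : CharGroup K L B) : χ = ∏ i, X i ^ ((charGroupEquiv eB χ).toAdd i) := by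
    apply (charGroupEquiv eB).injective
    rw [map_prod]
    simp only [map_zpow, X, MulEquiv.apply_symm_apply]
    exact eq_prod_zpow _
  -- Each tuple `ζ` of roots of unity gives a torsion point, whose values on the basis of characters
  -- satisfy the monomial relation `ψ = 1`.
  refine dvd_of_card_relation hl (G := rootsOfUnity l (L ⊗[O] T ⧸ Q)) ?_ ?_ hd
    (Z := Fin d₁ → rootsOfUnity l k') ?_ (fun ζ i => ⟨c ζ (X i), hcl ζ _⟩) ?_
    (fun i => (charGroupEquiv eB ψ).toAdd i) (fun ζ => ?_) j
  · exact fun g => Subtype.ext ((mem_rootsOfUnity _ _).mp g.2)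
  · exact card_rootsOfUnity _ _
  · rw [Nat.card_fun, (IsCyclotomicExtension.zeta_spec l k₁ k').card_rootsOfUnity, Nat.card_fin]
  · intro ζ ζ' h
    have h1 (i) : c ζ (X i) = c ζ' (X i) := congrArg Subtype.val (congrFun h i)
    have h2 (χ) : c ζ χ = c ζ' χ := by
      rw [hX χ, map_prod, map_prod]
      exact Finset.prod_congr rfl fun i _ => by rw [map_zpow, map_zpow, h1]
    have h3 (v) : w ζ v = w ζ' v := by
      obtain ⟨a, rfl⟩ := charHom_surjective ⟨d, ⟨eB⟩⟩ v
      induction a using MonoidAlgebra.induction_linear with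
      | zero => simp only [map_zero]
      | add a b ha hb => simp only [map_add, ha, hb]
      | single χ r =>
        rw [charHom_single, map_smul, map_smul]
        congr 1
        exact congrArg Units.val (h2 χ)
    refine htt (AlgHom.ext fun m => hφ ?_)
    have h4 := h3 (1 ⊗ₜ e (1 ⊗ₜ m))
    change Ideal.Quotient.mk Q (extPoint L _ _) = Ideal.Quotient.mk Q (extPoint L _ _) at h4
    rwa [extPoint_tmul, extPoint_tmul, map_one, one_mul, one_mul, genericPoint_apply,
      genericPoint_apply] at h4
  · apply Subtype.ext
    apply Units.ext
    rw [Subgroup.val_finsetProd]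
    have h1 : c ζ ψ = 1 := by
      apply Units.ext
      rw [hc, Units.val_one]
      change Ideal.Quotient.mk Q (extPoint L (genericPoint L e (tt ζ)) ψ.val) = 1
      rw [hψ T (tt ζ) (htn _), map_one]
    rw [hX ψ, map_prod] at h1
    simp only [map_zpow] at h1
    exact congrArg Units.val h1

/-- A prime that exceeds a given bound and is invertible in `O`. -/
lemma exists_prime_isUnit (O : Type*) [CommRing O] [IsLocalRing O]
    [Finite (IsLocalRing.ResidueField O)] (n : ℕ) : ∃ l : ℕ, l.Prime ∧ n < l ∧ IsUnit (l : O) := by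
  obtain ⟨p, hp⟩ := CharP.exists (IsLocalRing.ResidueField O)
  obtain ⟨l, hln, hl⟩ := Nat.exists_infinite_primes (n + p + 1)
  refine ⟨l, hl, by omega, ?_⟩
  by_contra h
  have h1 : ((l : ℕ) : IsLocalRing.ResidueField O) = 0 := by
    rw [← map_natCast (IsLocalRing.residue O)]
    exact (IsLocalRing.residue_eq_zero_iff _).mpr ((IsLocalRing.mem_maximalIdeal _).mpr h)
  rw [CharP.cast_eq_zero_iff (IsLocalRing.ResidueField O) p] at h1
  have hp0 : p ≠ 1 := CharP.char_ne_one (IsLocalRing.ResidueField O) p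
  have := (Nat.dvd_prime hl).mp h1
  omega

/-- Inertia acts trivially on the characters of a torus with good reduction. -/
lemma galAct_eq_of_hasGoodReduction [FiniteDimensional K L] [IsGalois K L]
    (hB : IsTorusSplitBy K L B) (h : HasGoodReduction O K L B)
    (P : Ideal (integralClosure O L)) [P.IsMaximal] (σ : L ≃ₐ[K] L)
    (hσ : σ ∈ P.inertia (L ≃ₐ[K] L)) (χ : CharGroup K L B) : galAct B σ χ.val = χ.val := by
  obtain ⟨M, _, _, N, _, _, ι, H, _, _, q, ⟨e, -, he⟩, hι, hq, k₁, _, _, hk₁, -, d₁, ⟨eH⟩⟩ := h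
  obtain ⟨d, ⟨eB⟩⟩ := hB
  have := hι.smooth
  obtain ⟨r, hr⟩ := exists_finrank_tangent O N
  let _ : Algebra O k₁ := Algebra.compHom k₁ (algebraMap O (IsLocalRing.ResidueField O))
  have : IsScalarTower O (IsLocalRing.ResidueField O) k₁ := IsScalarTower.of_algebraMap_eq' rfl
  have hd : d ≤ d₁ := (rank_le_of_isGroupSmoothening hι e eB (hr L)).trans
    (rank_le_of_isIdentityComponent hq eH (hr k₁))
  have hval : (galChar K L B σ χ).val = galAct B σ χ.val := val_galChar ..
  let ψ := galChar K L B σ χ / χ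
  have hψ : ψ * χ = galChar K L B σ χ := div_mul_cancel _ _
  have hdvd {l : ℕ} (hl : l.Prime) (hlO : IsUnit (l : O)) (j : Fin d) :
      (l : ℤ) ∣ (charGroupEquiv eB ψ).toAdd j := by
    refine dvd_of_value_eq_one e hι hq.surjective hd eH eB hl hlO ψ (fun T _ _ _ _ t ht => ?_) j
    have h1 := extPoint_galAct_eq e he t hl.ne_zero hlO ht P σ hσ χ
    rw [← hval, ← hψ, GroupLike.val_mul, map_mul] at h1
    have h2 := extPoint_pow_eq_one _ (genericPoint_pow (L := L) e t ht) χ.2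
    have h3 : IsUnit (extPoint L (genericPoint L e t) χ.val) :=
      IsUnit.of_pow_eq_one h2 hl.ne_zero
    exact h3.mul_right_cancel (by rw [h1, one_mul])
  have h0 : ψ = 1 := by
    apply (charGroupEquiv eB).injective
    rw [map_one]
    apply Multiplicative.toAdd.injective
    funext j
    -- An exponent that is divisible by a prime exceeding its absolute value is zero.
    obtain ⟨l, hl, hlj, hlO⟩ := exists_prime_isUnit O ((charGroupEquiv eB ψ).toAdd j).natAbs
    exact Int.eq_zero_of_dvd_of_natAbs_lt_natAbs (hdvd hl hlO j) (by simpa using hlj)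
  rw [← hval, ← hψ, h0, one_mul]

end Necessity

/-! ### Change of coefficients of group algebras and of their forms -/

section Coefficients

variable {R S S' M A A' : Type*} [CommRing R] [CommRing S] [CommRing S'] [Algebra R S]
  [Algebra S S'] [Algebra R S'] [CommRing M] [Bialgebra R M]
  [CommRing A] [Algebra R A] [Bialgebra S A] [IsScalarTower R S A]
  [CommRing A'] [Algebra R A'] [Algebra S A'] [Bialgebra S' A'] [IsScalarTower R S A']
  [IsScalarTower R S' A'] [IsScalarTower S S' A']

lemma tmap_tmap (j : M →ₐ[R] A) (g : A →ₐ[S] A') (t : M ⊗[R] M) :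
    tmap S' ((g.restrictScalars R).comp j) ((g.restrictScalars R).comp j) t =
      tmap S' g g (tmap S j j t) := by
  induction t with
  | zero => simp only [map_zero]
  | add a b ha hb => simp only [map_add, ha, hb]
  | tmul m n => simp

variable [IsScalarTower R S S']

lemma IsBialgHomOver.trans {j : M →ₐ[R] A} (hj : IsBialgHomOver S j) {g : A →ₐ[S] A'}
    (hg : IsBialgHomOver S' g) : IsBialgHomOver S' ((g.restrictScalars R).comp j) where
  comul m := by
    rw [tmap_tmap, hj.comul, hg.comul]
    rfl
  counit m := by
    rw [IsScalarTower.algebraMap_apply R S S', hj.counit, hg.counit]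
    rfl

lemma IsBialgHomOver.of_trans {j : M →ₐ[R] A} {g : A →ₐ[S] A'} (hg : IsBialgHomOver S' g)
    (hS : Function.Injective (algebraMap S S')) (h2 : Function.Injective (tmap S' g g))
    (h : IsBialgHomOver S' ((g.restrictScalars R).comp j)) : IsBialgHomOver S j where
  comul m := h2 (by
    rw [← tmap_tmap, h.comul, hg.comul]
    rfl)
  counit m := hS (by
    rw [← IsScalarTower.algebraMap_apply R S S', h.counit, hg.counit]
    rfl)

lemma isBialgHomOver_mapAlgHom (S S' Y : Type*) [CommRing S] [CommRing S'] [Algebra S S']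
    [CommGroup Y] : IsBialgHomOver S'
      (MonoidAlgebra.mapAlgHom Y (Algebra.ofId S S') : MonoidAlgebra S Y →ₐ[S] _) where
  comul a := by
    induction a using MonoidAlgebra.induction_linear with
    | zero => simp only [map_zero]
    | add a b ha hb => simp only [map_add, ha, hb]
    | single y s =>
      have h : MonoidAlgebra.single y s = s • (MonoidAlgebra.single y 1 : MonoidAlgebra S Y) := by
        rw [MonoidAlgebra.smul_single, smul_eq_mul, mul_one]
      have h' (v : MonoidAlgebra S' Y) : Coalgebra.comul (R := S') (s • v) =
          s • Coalgebra.comul (R := S') v := by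
        rw [← algebraMap_smul S' s, map_smul, algebraMap_smul]
      rw [h, map_smul, map_smul, map_smul, h']
      congr 1
      simp
  counit a := by
    induction a using MonoidAlgebra.induction_linear with
    | zero => simp only [map_zero]
    | add a b ha hb => simp only [map_add, ha, hb]
    | single y s => simp [Algebra.ofId_apply]

lemma IsBialgHomOver.extend {j : M →ₐ[R] A'} (hj : IsBialgHomOver S' j) :
    IsBialgHomOver S' (Algebra.TensorProduct.lift (Algebra.ofId S A') j
      (fun _ _ => Commute.all _ _) : S ⊗[R] M →ₐ[S] A') where
  comul v := by
    induction v with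
    | zero => simp only [map_zero]
    | add a b ha hb => simp only [map_add, ha, hb]
    | tmul s m =>
      have h1 : (s ⊗ₜ[R] m : S ⊗[R] M) = s • (1 ⊗ₜ m) := by
        rw [TensorProduct.smul_tmul', smul_eq_mul, mul_one]
      have h' (v : A') : Coalgebra.comul (R := S') (s • v) = s • Coalgebra.comul (R := S') v := by
        rw [← algebraMap_smul S' s, map_smul, algebraMap_smul]
      have h2 := (isBialgHomOver_includeRight (R := R) S M).comul m
      rw [Algebra.TensorProduct.includeRight_apply] at h2
      rw [h1, map_smul, map_smul, map_smul, h', ← h2, ← tmap_tmap]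
      have h3 : ((Algebra.TensorProduct.lift (Algebra.ofId S A') j
          (fun _ _ => Commute.all _ _)).restrictScalars R).comp
          (Algebra.TensorProduct.includeRight : M →ₐ[R] S ⊗[R] M) = j := by
        ext m
        simp
      rw [h3, hj.comul]
      congr 1
      simp
  counit v := by
    induction v with
    | zero => simp only [map_zero]
    | add a b ha hb => simp only [map_add, ha, hb]
    | tmul s m =>
      have h1 : (s ⊗ₜ[R] m : S ⊗[R] M) = s • (1 ⊗ₜ m) := by
        rw [TensorProduct.smul_tmul', smul_eq_mul, mul_one]
      have h' (v : A') : Coalgebra.counit (R := S') (s • v) =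
          s • Coalgebra.counit (R := S') v := by
        rw [← algebraMap_smul S' s, map_smul, algebraMap_smul]
      rw [h1, map_smul, smul_eq_mul, map_mul, map_smul, h', Algebra.smul_def]
      congr 1
      simp [← hj.counit, Algebra.algebraMap_eq_smul_one]

end Coefficients

section SpecialFibre

variable (R S : Type u) {G Y : Type u} (k k' : Type u) [CommRing R] [CommRing S] [Algebra R S]
  [Group G] [Fintype G] [MulSemiringAction G S] [IsGaloisExt R S G] [CommGroup Y]
  (ρ : G →* MulAut Y) [Field k] [Field k'] [Algebra R k] [Algebra k k'] [Algebra S k']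
  [Algebra R k'] [IsScalarTower R k k'] [IsScalarTower R S k']

/-- The form of a split torus given by `ρ` is split over every field to which `S` maps. -/
lemma exists_equiv_specialFibre :
    Nonempty (k' ⊗[k] (k ⊗[R] TorusAlg R S ρ) ≃ₐc[k'] MonoidAlgebra k' Y) := by
  let c : MonoidAlgebra S Y →ₐ[S] MonoidAlgebra k' Y :=
    MonoidAlgebra.mapAlgHom Y (Algebra.ofId S k')
  let j : TorusAlg R S ρ →ₐ[R] MonoidAlgebra k' Y :=
    (c.restrictScalars R).comp (TorusAlg.val R S ρ)
  have hj : IsBialgHomOver k' j :=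
    (TorusAlg.isBialgHomOver_val ρ).trans (isBialgHomOver_mapAlgHom S k' Y)
  have hj' := hj.extend (S := k)
  let e : k' ⊗[k] (k ⊗[R] TorusAlg R S ρ) ≃ₐ[k'] MonoidAlgebra k' Y :=
    (Algebra.TensorProduct.cancelBaseChange R k k' k' (TorusAlg R S ρ)).trans
      ((Algebra.TensorProduct.cancelBaseChange R S k' k' (TorusAlg R S ρ)).symm.trans
      ((Algebra.TensorProduct.congr (AlgEquiv.refl (R := k') (A₁ := k'))
        (TorusAlg.baseChangeEquiv R S ρ).toAlgEquiv).trans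
        (MonoidAlgebra.scalarTensorEquiv S k')))
  have he (v) : e v = hj'.lift v := by
    induction v with
    | zero => simp only [map_zero]
    | add a b ha hb => simp only [map_add, ha, hb]
    | tmul a w =>
      induction w with
      | zero => simp only [TensorProduct.tmul_zero, map_zero]
      | add a b ha hb => simp only [TensorProduct.tmul_add, map_add, ha, hb]
      | tmul b m =>
        rw [IsBialgHomOver.lift_tmul]
        change MonoidAlgebra.scalarTensorEquiv S k' (Algebra.TensorProduct.congr
          (AlgEquiv.refl (R := k') (A₁ := k')) (TorusAlg.baseChangeEquiv R S ρ).toAlgEquiv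
          ((Algebra.TensorProduct.cancelBaseChange R S k' k' (TorusAlg R S ρ)).symm
          (Algebra.TensorProduct.cancelBaseChange R k k' k' (TorusAlg R S ρ)
            (a ⊗ₜ (b ⊗ₜ m))))) = _
        rw [Algebra.TensorProduct.cancelBaseChange_tmul,
          Algebra.TensorProduct.cancelBaseChange_symm_tmul]
        change MonoidAlgebra.scalarTensorEquiv S k' ((b • a) ⊗ₜ
          (TorusAlg.baseChangeEquiv R S ρ (1 ⊗ₜ m))) = _
        rw [TorusAlg.baseChangeEquiv_tmul, one_smul, MonoidAlgebra.scalarTensorEquiv_tmul,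
          Algebra.TensorProduct.lift_tmul]
        simp only [Algebra.ofId_apply, Algebra.smul_def, IsScalarTower.algebraMap_apply k k'
          (MonoidAlgebra k' Y), map_mul]
        rw [mul_comm (algebraMap k' _ (algebraMap k k' b)), mul_assoc]
        rfl
  have hbij : Function.Bijective hj'.lift := by
    have : (hj'.lift : _ → _) = e := funext fun v => (he v).symm
    rw [this]
    exact e.bijective
  exact ⟨BialgEquiv.ofBijective _ hbij⟩

variable [Module.Free ℤ (Additive Y)] [Module.Finite ℤ (Additive Y)]

/-- A form of a split torus over a noetherian ring is smooth, by descent from the split case. -/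
lemma smooth_torusAlg [IsNoetherianRing S] [Module.FaithfullyFlat R S] :
    Algebra.Smooth R (TorusAlg R S ρ) := by
  have := smooth_monoidAlgebra S Y
  have : Algebra.Smooth S (S ⊗[R] TorusAlg R S ρ) :=
    Algebra.Smooth.of_equiv (TorusAlg.baseChangeEquiv R S ρ).symm.toAlgEquiv
  exact Algebra.Smooth.of_smooth_tensorProduct_of_faithfullyFlat S

end SpecialFibre

section IdentityComponent

/-- The coordinate ring of a torus is a domain. -/
lemma isDomain_of_equiv {k k' H Y : Type*} [Field k] [Field k'] [Algebra k k'] [CommRing H]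
    [HopfAlgebra k H] [CommGroup Y] [Module.Free ℤ (Additive Y)] [Module.Finite ℤ (Additive Y)]
    (e : k' ⊗[k] H ≃ₐc[k'] MonoidAlgebra k' Y) : IsDomain H := by
  obtain ⟨d, ⟨f⟩⟩ := exists_mulEquiv_of_free Y
  let e' := e.trans (MonoidAlgebra.domCongrBialgEquiv k' k' f)
  let g : H →+* MonoidAlgebra k' (Multiplicative (Fin d → ℤ)) :=
    (e'.toAlgEquiv : k' ⊗[k] H →+* MonoidAlgebra k' (Multiplicative (Fin d → ℤ))).comp
      (Algebra.TensorProduct.includeRight : H →ₐ[k] k' ⊗[k] H)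
  have hg : Function.Injective g := e'.injective.comp
    (Algebra.TensorProduct.includeRight_injective (algebraMap k k').injective)
  exact hg.isDomain g

/-- A connected group scheme is its own identity component. -/
lemma isIdentityComponent_id {k H : Type u} [Field k] [CommRing H] [HopfAlgebra k H]
    [IsDomain H] : IsIdentityComponent (BialgHom.id k H) where
  surjective := Function.surjective_id
  isOpen := ⟨0, IsIdempotentElem.zero, by
    rw [Ideal.span_singleton_eq_bot.mpr rfl]
    exact (RingHom.injective_iff_ker_eq_bot _).mp Function.injective_id⟩
  range_eq := by
    rw [PreconnectedSpace.connectedComponent_eq_univ, Set.range_eq_univ]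
    exact fun x => ⟨x, rfl⟩

/-- A smooth group scheme is its own smoothening. -/
lemma isGroupSmoothening_id {O M : Type u} [CommRing O] [CommRing M] [HopfAlgebra O M]
    [h : Algebra.Smooth O M] : IsGroupSmoothening O (BialgHom.id O M) where
  smooth := h
  existsUnique_lift _ _ _ _ f := ⟨f, AlgHom.ext fun _ => rfl, fun g hg => by
    rw [← hg]
    exact AlgHom.ext fun _ => rfl⟩

end IdentityComponent

/-! ### The integral form of a torus on whose characters inertia acts trivially -/

lemma mapAlgHom_injective {S S' Y : Type*} [CommRing S] [CommRing S'] [Algebra S S'] [CommGroup Y]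
    (h : Function.Injective (algebraMap S S')) :
    Function.Injective (MonoidAlgebra.mapAlgHom Y (Algebra.ofId S S')) := by
  intro a b hab
  ext y
  apply h
  have := congrArg (fun c => MonoidAlgebra.coeff c y) hab
  simpa using this

section IntegralForm

variable {O K L B S G : Type u} [CommRing O]
  [Field K] [Algebra O K] [Field L] [Algebra K L]
  [Algebra O L] [IsScalarTower O K L]
  [CommRing B] [HopfAlgebra K B] [Algebra O B] [IsScalarTower O K B]
  [CommRing S] [Algebra O S] [Algebra S L] [IsScalarTower O S L] [Group G] [Fintype G]
  [MulSemiringAction G S] [IsGaloisExt O S G]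
  (ρ : G →* MulAut (CharGroup K L B))

variable (O S) in
/-- The embedding of the integral form into the group algebra of the characters over `L`. -/
def formHom : TorusAlg O S ρ →ₐ[O] MonoidAlgebra L (CharGroup K L B) :=
  ((MonoidAlgebra.mapAlgHom (CharGroup K L B) (Algebra.ofId S L)).restrictScalars O).comp
    (TorusAlg.val O S ρ)

lemma formHom_apply (m : TorusAlg O S ρ) : formHom O S ρ m =
    MonoidAlgebra.mapAlgHom (CharGroup K L B) (Algebra.ofId S L) (TorusAlg.val O S ρ m) := rfl

lemma isBialgHomOver_formHom : IsBialgHomOver L (formHom O S ρ) :=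
  (TorusAlg.isBialgHomOver_val ρ).trans (isBialgHomOver_mapAlgHom S L _)

lemma mapAlgHom_twist {π : (L ≃ₐ[K] L) →* G}
    (hπS : ∀ σ (s : S), algebraMap S L (π σ • s) = σ (algebraMap S L s))
    (hρ : ∀ σ, ρ (π σ) = galChar K L B σ)
    (σ : L ≃ₐ[K] L) (a : MonoidAlgebra S (CharGroup K L B)) :
    MonoidAlgebra.mapAlgHom (CharGroup K L B) (Algebra.ofId S L) (twist S ρ (π σ) a) =
    twist L (galChar K L B) σ (MonoidAlgebra.mapAlgHom (CharGroup K L B) (Algebra.ofId S L) a) := by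
  induction a using MonoidAlgebra.induction_linear with
  | zero => simp only [map_zero]
  | add a b ha hb => simp only [map_add, ha, hb]
  | single χ s =>
    rw [twist_single, MonoidAlgebra.mapAlgHom_single, MonoidAlgebra.mapAlgHom_single, twist_single,
      hρ]
    congr 1
    exact hπS σ s

variable [FiniteDimensional K L] [IsGalois K L]

/-- By Galois descent for `L ⊗ B`, the embedding of the integral form takes values in `B`. -/
lemma exists_formToTorus {π : (L ≃ₐ[K] L) →* G}
    (hπS : ∀ σ (s : S), algebraMap S L (π σ • s) = σ (algebraMap S L s))
    (hρ : ∀ σ, ρ (π σ) = galChar K L B σ) :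
    ∃ j : TorusAlg O S ρ →ₐ[O] B,
      ∀ m, (1 : L) ⊗ₜ[K] j m = charHom K L B (formHom O S ρ m) := by
  have h (m : TorusAlg O S ρ) :
      ∃ b : B, (1 : L) ⊗ₜ[K] b = charHom K L B (formHom O S ρ m) := by
    refine exists_one_tmul_of_galAct _ fun σ => ?_
    rw [← charHom_twist, formHom_apply, ← mapAlgHom_twist ρ hπS hρ]
    exact congrArg _ (congrArg _ (TorusAlg.twist_val ρ _ m))
  choose j hj using h
  have hinj := one_tmul_injective K L (L ≃ₐ[K] L) B
  refine ⟨⟨⟨⟨⟨j, hinj ?_⟩, fun a b => hinj ?_⟩, hinj ?_, fun a b => hinj ?_⟩, fun r => hinj ?_⟩, hj⟩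
  · change (1 : L) ⊗ₜ[K] j 1 = 1 ⊗ₜ 1
    rw [hj, map_one, map_one]
    rfl
  · change (1 : L) ⊗ₜ[K] j (a * b) = 1 ⊗ₜ (j a * j b)
    rw [hj, map_mul, map_mul, ← hj, ← hj, Algebra.TensorProduct.tmul_mul_tmul, one_mul]
  · change (1 : L) ⊗ₜ[K] j 0 = 1 ⊗ₜ 0
    rw [hj, map_zero, map_zero, TensorProduct.tmul_zero]
  · change (1 : L) ⊗ₜ[K] j (a + b) = 1 ⊗ₜ (j a + j b)
    rw [hj, map_add, map_add, ← hj, ← hj, TensorProduct.tmul_add]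
  · change (1 : L) ⊗ₜ[K] j (algebraMap O _ r) = 1 ⊗ₜ algebraMap O B r
    rw [hj, AlgHom.commutes, IsScalarTower.algebraMap_apply O L, AlgHomClass.commutes,
      Algebra.TensorProduct.algebraMap_apply, IsScalarTower.algebraMap_apply O K L,
      IsScalarTower.algebraMap_apply O K B, Algebra.algebraMap_eq_smul_one (R := K) (A := B),
      TensorProduct.tmul_smul, TensorProduct.smul_tmul', Algebra.smul_def, mul_one]
    rfl

variable {ρ} {j : TorusAlg O S ρ →ₐ[O] B}

lemma formToTorus_injective (hSL : Function.Injective (algebraMap S L))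
    (hj : ∀ m, (1 : L) ⊗ₜ[K] j m = charHom K L B (formHom O S ρ m)) : Function.Injective j := by
  intro a b hab
  have h1 : charHom K L B (formHom O S ρ a) = charHom K L B (formHom O S ρ b) := by
    rw [← hj, ← hj, hab]
  have h2 := charHom_injective h1
  rw [formHom_apply, formHom_apply] at h2
  exact TorusAlg.val_injective ρ (mapAlgHom_injective hSL h2)

lemma isBialgHomOver_formToTorus
    (hj : ∀ m, (1 : L) ⊗ₜ[K] j m = charHom K L B (formHom O S ρ m)) : IsBialgHomOver K j := by
  have h2 := (isBialgHomOver_formHom (O := O) (S := S) ρ).comp_left (charHom K L B)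
  refine (isBialgHomOver_includeRight (R := K) L B).of_trans (algebraMap K L).injective ?_ ?_
  · exact (tmap_injective_of_equiv L _ _ (LinearEquiv.refl L (L ⊗[K] B))
      (LinearEquiv.refl L (L ⊗[K] B)) (fun _ => rfl) (fun _ => rfl)
      (one_tmul_injective K L (L ≃ₐ[K] L) (B ⊗[K] B))).1
  · have h3 : ((Algebra.TensorProduct.includeRight : B →ₐ[K] L ⊗[K] B).restrictScalars O).comp j =
        ((charHom K L B : MonoidAlgebra L (CharGroup K L B) →ₐ[L] L ⊗[K] B).restrictScalars O).comp
          (formHom O S ρ) := AlgHom.ext hj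
    rw [h3]
    exact h2

/-- Elements of the generic fibre `K ⊗ M` have denominators in `O`. -/
lemma exists_smul_eq_one_tmul [IsDomain O] [IsFractionRing O K] {M : Type*} [AddCommGroup M]
    [Module O M] (w : K ⊗[O] M) : ∃ (r : O) (m : M), r ≠ 0 ∧ r • w = 1 ⊗ₜ m := by
  induction w with
  | zero => exact ⟨1, 0, one_ne_zero, by simp⟩
  | add a b ha hb =>
    obtain ⟨r, m, hr, h⟩ := ha
    obtain ⟨r', m', hr', h'⟩ := hb
    refine ⟨r * r', r' • m + r • m', mul_ne_zero hr hr', ?_⟩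
    rw [smul_add, mul_comm r r', mul_smul, h, mul_comm r' r, mul_smul, h',
      TensorProduct.tmul_add, TensorProduct.tmul_smul, TensorProduct.tmul_smul]
  | tmul x m =>
    obtain ⟨⟨a, s⟩, hs⟩ := IsLocalization.surj (nonZeroDivisors O) x
    refine ⟨s, a • m, nonZeroDivisors.ne_zero s.2, ?_⟩
    rw [TensorProduct.smul_tmul', Algebra.smul_def, mul_comm, hs,
      Algebra.algebraMap_eq_smul_one, TensorProduct.smul_tmul]

lemma formToTorus_lift_injective [IsDomain O] [IsFractionRing O K]
    (hSL : Function.Injective (algebraMap S L))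
    (hj : ∀ m, (1 : L) ⊗ₜ[K] j m = charHom K L B (formHom O S ρ m)) :
    Function.Injective (isBialgHomOver_formToTorus hj).lift := by
  intro w w' hw
  rw [← sub_eq_zero, ← map_sub] at hw
  rw [← sub_eq_zero]
  obtain ⟨r, m, hr, h⟩ := exists_smul_eq_one_tmul (w - w')
  have h2 : j m = 0 := by
    have h3 := IsBialgHomOver.lift_tmul (isBialgHomOver_formToTorus hj) 1 m
    rw [← h, ← algebraMap_smul K r, map_smul, hw, smul_zero, one_smul] at h3
    exact h3.symm
  rw [(map_eq_zero_iff j (formToTorus_injective hSL hj)).mp h2, TensorProduct.tmul_zero,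
    ← algebraMap_smul K r] at h
  exact (smul_eq_zero.mp h).resolve_left
    (by rwa [map_eq_zero_iff _ (IsFractionRing.injective O K)])

lemma coeff_twist_of_eq_one {σ : L ≃ₐ[K] L} (h1 : galChar K L B σ = 1)
    (v : MonoidAlgebra L (CharGroup K L B)) (χ : CharGroup K L B) :
    (twist L (galChar K L B) σ v).coeff χ = σ (v.coeff χ) := by
  induction v using MonoidAlgebra.induction_linear with
  | zero => simp
  | add v w hv hw => simp [hv, hw]
  | single ψ t =>
    rw [twist_single, h1]
    classical
    simp [Finsupp.single_apply, apply_ite σ]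

lemma exists_mapAlgHom_eq {Y : Type*} [CommGroup Y] (a : MonoidAlgebra L Y)
    (h : ∀ y, ∃ s : S, algebraMap S L s = a.coeff y) :
    ∃ a', MonoidAlgebra.mapAlgHom Y (Algebra.ofId S L) a' = a := by
  choose s hs using h
  classical
  refine ⟨∑ y ∈ a.coeff.support, .single y (s y), ?_⟩
  rw [map_sum]
  ext y
  simp only [MonoidAlgebra.mapAlgHom_single, Algebra.ofId_apply, hs]
  simp +contextual [Finsupp.single_apply, MonoidAlgebra.coeff_sum]

/-- The generic fibre of the integral form is the given torus: the coefficients of an element of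
`B` at the characters are fixed by inertia, and its multiples by a common denominator come from
the form. -/
lemma formToTorus_lift_surjective [IsDomain O] [IsFractionRing O K] (hB : IsTorusSplitBy K L B)
    (hSL : Function.Injective (algebraMap S L)) {π : (L ≃ₐ[K] L) →* G}
    (hπ : Function.Surjective π)
    (hπS : ∀ σ (s : S), algebraMap S L (π σ • s) = σ (algebraMap S L s))
    (hint : ∀ l : L, (∀ σ, π σ = 1 → σ l = l) → IsIntegral O l → ∃ s : S, algebraMap S L s = l)
    (hρ : ∀ σ, ρ (π σ) = galChar K L B σ)
    (hj : ∀ m, (1 : L) ⊗ₜ[K] j m = charHom K L B (formHom O S ρ m)) :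
    Function.Surjective (isBialgHomOver_formToTorus hj).lift := by
  intro b
  obtain ⟨a, ha, hat⟩ : ∃ a, charHom K L B a = 1 ⊗ₜ b ∧ ∀ σ, twist L (galChar K L B) σ a = a :=
    ⟨_, charHom_val_torusEquiv hB b, fun σ => TorusAlg.twist_val _ σ _⟩
  classical
  -- A common denominator `r` of the coefficients of `b` in terms of characters.
  obtain ⟨r, hr, hri⟩ := exists_integral_multiples O K (a.coeff.support.image a.coeff)
  have hrL (l : L) : r • l = algebraMap K L (algebraMap O K r) * l := by
    rw [Algebra.smul_def, IsScalarTower.algebraMap_apply O K L]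
  obtain ⟨a', ha'⟩ := exists_mapAlgHom_eq (S := S) (r • a) (fun χ => by
    rw [MonoidAlgebra.coeff_smul, Finsupp.smul_apply]
    refine hint _ (fun σ hσ => ?_) ?_
    · have h1 : galChar K L B σ = 1 := by rw [← hρ, hσ, map_one]
      rw [hrL, map_mul, σ.commutes, ← coeff_twist_of_eq_one h1, hat]
    · by_cases h : χ ∈ a.coeff.support
      · exact hri _ (Finset.mem_image_of_mem _ h)
      · rw [Finsupp.notMem_support_iff.mp h, smul_zero]
        exact isIntegral_zero)
  obtain ⟨m, hm⟩ : ∃ m, TorusAlg.val O S ρ m = a' := by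
    refine TorusAlg.exists_val_eq ρ fun g => ?_
    obtain ⟨σ, rfl⟩ := hπ g
    apply mapAlgHom_injective hSL
    rw [mapAlgHom_twist ρ hπS hρ, ha', ← algebraMap_smul L r, twist_smul, hat,
      IsScalarTower.algebraMap_apply O K L]
    congr 1
    exact σ.commutes _
  have hjm : j m = r • b := by
    refine one_tmul_injective K L (L ≃ₐ[K] L) B ?_
    change (1 : L) ⊗ₜ[K] j m = 1 ⊗ₜ (r • b)
    rw [hj, formHom_apply, hm, ha', ← algebraMap_smul L r, map_smul, ha, ← algebraMap_smul K r b,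
      TensorProduct.tmul_smul, IsScalarTower.algebraMap_apply O K L, algebraMap_smul]
  refine ⟨(algebraMap O K r)⁻¹ ⊗ₜ m, ?_⟩
  rw [IsBialgHomOver.lift_tmul, hjm, ← algebraMap_smul K r, smul_smul, inv_mul_cancel₀, one_smul]
  rwa [Ne, map_eq_zero_iff _ (IsFractionRing.injective O K)]

/-- The invariant element `∑ g • a` of the integral form. -/
def formAvg (ρ : G →* MulAut (CharGroup K L B)) (a : MonoidAlgebra S (CharGroup K L B)) :
    TorusAlg O S ρ := (avg ρ a : invAlg O S ρ)

lemma val_formAvg (a : MonoidAlgebra S (CharGroup K L B)) :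
    TorusAlg.val O S ρ (formAvg ρ a) = ∑ g, twist S ρ g a := rfl

lemma formAvg_sum {n : ℕ} (r : Fin n → O) (a : Fin n → MonoidAlgebra S (CharGroup K L B)) :
    formAvg (O := O) ρ (∑ i, r i • a i) = ∑ i, r i • formAvg ρ (a i) := by
  apply TorusAlg.val_injective
  rw [map_sum, val_formAvg]
  simp only [map_smul, val_formAvg, map_sum]
  rw [Finset.sum_comm]
  refine Finset.sum_congr rfl fun i _ => ?_
  rw [Finset.smul_sum]
  refine Finset.sum_congr rfl fun g _ => ?_
  rw [← algebraMap_smul S (r i), twist_smul, IsGaloisExt.smul_algebraMap, algebraMap_smul]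

/-- In Galois coordinates, a character is an integral combination of elements of the integral
form. -/
lemma coordMap_char_eq_sum (hj : ∀ m, (1 : L) ⊗ₜ[K] j m = charHom K L B (formHom O S ρ m))
    {n : ℕ} {x y : Fin n → S} (h1 : ∑ i, x i * y i = 1)
    (h2 : ∀ g : G, g ≠ 1 → ∑ i, x i * g • y i = 0) (χ : CharGroup K L B) (f : L →ₗ[K] K) :
    coordMap B f χ.val =
      ∑ i, f (algebraMap S L (x i)) • j (formAvg ρ (y i • .single χ 1)) := by
  have h : χ.val = ∑ i, algebraMap S L (x i) ⊗ₜ[K] j (formAvg ρ (y i • .single χ 1)) := by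
    have h3 := congrArg (fun a => charHom K L B (MonoidAlgebra.mapAlgHom (CharGroup K L B)
      (Algebra.ofId S L) a)) (sum_smul_avg (R := O) (ρ := ρ) h1 h2 (.single χ 1))
    simp only [map_sum, map_smul, MonoidAlgebra.mapAlgHom_single, map_one, charHom_single,
      one_smul] at h3
    rw [← h3]
    refine Finset.sum_congr rfl fun i _ => ?_
    rw [← algebraMap_smul L (x i), map_smul]
    change _ • charHom K L B (formHom O S ρ (formAvg ρ (y i • .single χ 1))) = _
    rw [← hj, TensorProduct.smul_tmul', smul_eq_mul, mul_one]
  rw [h, map_sum]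
  exact Finset.sum_congr rfl fun i _ => rfl

/-- The integral form is the standard order. -/
lemma range_formToTorus [Algebra.IsIntegral O S]
    (hj : ∀ m, (1 : L) ⊗ₜ[K] j m = charHom K L B (formHom O S ρ m))
    (hext : ∀ f : S →ₗ[O] O, ∃ f' : L →ₗ[K] K,
      (∀ x ∈ integralClosure O L, f' x ∈ (algebraMap O K).range) ∧
      ∀ s, f' (algebraMap S L s) = algebraMap O K (f s)) :
    j.range = standardOrder O K L B := by
  obtain ⟨n, x, y, h1, h2⟩ := IsGaloisExt.exists_coords (R := O) (S := S) (G := G)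
  apply le_antisymm
  · rintro _ ⟨m, rfl⟩
    obtain ⟨c, hc⟩ := IsGaloisExt.exists_trace (R := O) (S := S) (G := G)
    have hm : formAvg ρ (c • TorusAlg.val O S ρ m) = m := avg_smul_eq_self ρ c hc m
    change j m ∈ _
    rw [← hm]
    generalize c • TorusAlg.val O S ρ m = a
    induction a using MonoidAlgebra.induction_linear with
    | zero =>
      have : formAvg (O := O) ρ (0 : MonoidAlgebra S (CharGroup K L B)) = 0 := by
        apply TorusAlg.val_injective
        simp [val_formAvg]
      rw [this, map_zero]
      exact zero_mem _
    | add a b ha hb =>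
      have : formAvg (O := O) ρ (a + b) = formAvg ρ a + formAvg ρ b := by
        apply TorusAlg.val_injective
        simp [val_formAvg, Finset.sum_add_distrib]
      rw [this, map_add]
      exact add_mem ha hb
    | single χ s =>
      obtain ⟨τ, hτ⟩ := exists_trace_form O S G
      -- The average of `s χ` is itself a coordinate of `χ`, for the form `x ↦ τ (s x)` with `τ` the
      -- trace.
      obtain ⟨f, hf, hfs⟩ := hext (τ ∘ₗ LinearMap.mulLeft O s)
      refine Algebra.subset_adjoin ⟨χ, f, hf, ?_⟩
      -- The roles of the two families of coordinates can be exchanged.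
      have h1' : ∑ i, y i * x i = 1 := by simpa only [mul_comm] using h1
      have h2' (g : G) (hg : g ≠ 1) : ∑ i, y i * g • x i = 0 := by
        have h3 := congrArg (g • ·) (h2 g⁻¹ (inv_ne_one.mpr hg))
        simpa only [Finset.smul_sum, smul_mul', smul_inv_smul, smul_zero, mul_comm] using h3
      have hs : ∑ i, τ (s * x i) • y i = s := by
        have h3 := sum_coords h1' h2' (fun g => g • s)
        rw [one_smul] at h3
        refine Eq.trans (Finset.sum_congr rfl fun i _ => ?_) h3
        rw [Algebra.smul_def, hτ, smul_eq_mul, mul_comm]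
        congr 1
        refine Finset.sum_congr rfl fun g _ => ?_
        rw [smul_mul', smul_eq_mul, mul_comm]
      have hss : (.single χ s : MonoidAlgebra S (CharGroup K L B)) =
          ∑ i, τ (s * x i) • (y i • .single χ 1) := by
        simp only [← smul_assoc]
        rw [← Finset.sum_smul, hs, MonoidAlgebra.smul_single, smul_eq_mul, mul_one]
      rw [coordMap_char_eq_sum hj h1 h2, hss, formAvg_sum, map_sum]
      refine Finset.sum_congr rfl fun i _ => ?_
      rw [hfs, map_smul, algebraMap_smul]
      rfl
  · refine Algebra.adjoin_le ?_
    rintro _ ⟨χ, f, hf, rfl⟩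
    rw [coordMap_char_eq_sum hj h1 h2]
    refine sum_mem fun i _ => ?_
    obtain ⟨r, hr⟩ := hf (algebraMap S L (x i)) ((Algebra.IsIntegral.isIntegral (x i)).algebraMap)
    rw [← hr, algebraMap_smul]
    exact Subalgebra.smul_mem _ ((AlgHom.mem_range _).mpr ⟨_, rfl⟩) r

end IntegralForm

/-! ### Tori on whose characters inertia acts trivially have good reduction -/

section Sufficiency

variable {O K L B : Type u} [CommRing O] [IsDomain O] [IsDiscreteValuationRing O]
  [IsAdicComplete (IsLocalRing.maximalIdeal O) O] [Finite (IsLocalRing.ResidueField O)]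
  [Field K] [Algebra O K] [IsFractionRing O K] [Field L] [Algebra K L]
  [Algebra O L] [IsScalarTower O K L] [FiniteDimensional K L] [IsGalois K L]
  [CommRing B] [HopfAlgebra K B]

/-- A torus has good reduction if inertia acts trivially on its characters: the standard model is
the form of the split torus over the ring of integers of the inertia field, which is smooth and
whose special fibre is a torus. -/
lemma hasGoodReduction_of_galAct_eq (hB : IsTorusSplitBy K L B)
    (P : Ideal (integralClosure O L)) [hP : P.IsMaximal]
    (h : ∀ σ ∈ P.inertia (L ≃ₐ[K] L), ∀ χ : CharGroup K L B, galAct B σ χ.val = χ.val) :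
    HasGoodReduction O K L B := by
  have := isLocalRing_integralClosure O K L
  have := normal_inertia (K := K) P
  let F := IntermediateField.fixedField (P.inertia (L ≃ₐ[K] L))
  have : IsGalois K F := IsGalois.of_fixedField_normal_subgroup _
  have hGal : IsGaloisExt O (integralClosure O F) (F ≃ₐ[K] F) := isGaloisExt_fixedField O P F rfl
  have := isLocalRing_integralClosure O K F
  have := finite_integralClosure O K F
  have := free_integralClosure O K F
  have := isTorsionFree_of_isFractionRing O K F
  have := charGroup_free hB
  have := charGroup_finite hB
  let S := integralClosure O F
  let π : (L ≃ₐ[K] L) →* (F ≃ₐ[K] F) := AlgEquiv.restrictNormalHom F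
  have hπ : Function.Surjective π := AlgEquiv.restrictNormalHom_surjective L
  have hker (σ : L ≃ₐ[K] L) : π σ = 1 ↔ σ ∈ P.inertia (L ≃ₐ[K] L) := by
    rw [← MonoidHom.mem_ker, IntermediateField.restrictNormalHom_ker,
      IntermediateField.fixingSubgroup_fixedField]
  let ρ : (F ≃ₐ[K] F) →* MulAut (CharGroup K L B) := π.liftOfSurjective hπ ⟨galChar K L B, by
    intro σ hσ
    rw [MonoidHom.mem_ker, hker] at hσ
    rw [MonoidHom.mem_ker]
    exact MulEquiv.ext fun χ => GroupLike.val_injective ((val_galChar ..).trans (h σ hσ χ))⟩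
  have hρ (σ) : ρ (π σ) = galChar K L B σ := MonoidHom.liftOfRightInverse_comp_apply ..
  have hπS (σ) (s : S) : algebraMap S L (π σ • s) = σ (algebraMap S L s) :=
    AlgEquiv.restrictNormal_commutes σ F (s : F)
  have hSL : Function.Injective (algebraMap S L) := fun _ _ h => Subtype.ext (Subtype.ext h)
  have hint (l : L) (hl : ∀ σ, π σ = 1 → σ l = l) (hli : IsIntegral O l) :
      ∃ s : S, algebraMap S L s = l := by
    have hlF : l ∈ F := by
      rw [IntermediateField.mem_fixedField_iff]
      exact fun σ hσ => hl σ ((hker σ).mpr hσ)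
    exact ⟨⟨⟨l, hlF⟩, (isIntegral_algebraMap_iff (algebraMap F L).injective).mp hli⟩, rfl⟩
  let _ : Algebra O B := Algebra.compHom B (algebraMap O K)
  have : IsScalarTower O K B := IsScalarTower.of_algebraMap_eq' rfl
  obtain ⟨j, hj⟩ := exists_formToTorus (O := O) ρ hπS hρ
  let e : K ⊗[O] TorusAlg O S ρ ≃ₐc[K] B := BialgEquiv.ofBijective _
    ⟨formToTorus_lift_injective hSL hj, formToTorus_lift_surjective hB hSL hπ hπS hint hρ hj⟩
  have he (m) : e (1 ⊗ₜ m) = j m :=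
    (IsBialgHomOver.lift_tmul (isBialgHomOver_formToTorus hj) 1 m).trans (one_smul _ _)
  have hrange := range_formToTorus hj fun f => exists_extension_form O F f
  have : IsNoetherianRing S := IsNoetherianRing.of_finite O S
  have := smooth_torusAlg O S ρ
  let k := IsLocalRing.ResidueField O
  let k' := IsLocalRing.ResidueField S
  have : Finite k' := IsLocalRing.ResidueField.finite_of_finite (R := O) inferInstance
  obtain ⟨eH⟩ := exists_equiv_specialFibre O S k k' ρ
  -- The special fibre is connected because its coordinate ring is a domain.
  have := isDomain_of_equiv eH
  refine ⟨TorusAlg O S ρ, _, _, TorusAlg O S ρ, _, _, BialgHom.id _ _, k ⊗[O] TorusAlg O S ρ, _, _,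
    BialgHom.id _ _, ⟨e, ?_, ?_⟩, isGroupSmoothening_id, isIdentityComponent_id,
    ⟨k', _, _, inferInstance, inferInstance, isTorusSplitBy_of_equiv eH⟩⟩
  · intro m m' hm
    exact formToTorus_injective hSL hj ((he m).symm.trans (hm.trans (he m')))
  · ext b
    change (∃ m, e (1 ⊗ₜ m) = b) ↔ b ∈ standardOrder O K L B
    rw [← hrange, AlgHom.mem_range]
    simp only [he]

end Sufficiency

/-! ### Subtori and their characters -/

section Kernels

variable {K L B C C' : Type u} [Field K] [Field L] [Algebra K L]
  [CommRing B] [HopfAlgebra K B] [CommRing C] [HopfAlgebra K C] [CommRing C'] [HopfAlgebra K C']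

lemma mapDomainBialgHom_eq (f : CharGroup K L B →* CharGroup K L C)
    (a : MonoidAlgebra L (CharGroup K L B)) :
    MonoidAlgebra.mapDomainBialgHom L f a = MonoidAlgebra.mapDomain f a := rfl

/-- A subtorus whose character group is a quotient of that of another subtorus is contained in
it. -/
lemma ker_le_ker_of_mapChar [FiniteDimensional K L] [IsGalois K L] (hB : IsTorusSplitBy K L B)
    (q : B →ₐc[K] C) (q' : B →ₐc[K] C')
    (h : ∀ χ, mapChar L q χ = 1 → mapChar L q' χ = 1) :
    RingHom.ker ((q : B →ₐ[K] C) : B →+* C) ≤ RingHom.ker ((q' : B →ₐ[K] C') : B →+* C') := by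
  intro b hb
  have hb : q b = 0 := hb
  obtain ⟨a, ha⟩ := charHom_surjective hB (1 ⊗ₜ b)
  have hfac : Function.FactorsThrough (mapChar L q') (mapChar L q) := fun χ χ' hχ => by
    rw [← div_eq_one, ← map_div]
    exact h _ (by rw [map_div, hχ, div_self'])
  have h1 : MonoidAlgebra.mapDomain (mapChar L q) a = 0 := by
    rw [← mapDomainBialgHom_eq]
    apply charHom_injective
    rw [charHom_mapDomain, ha, map_zero]
    change (1 : L) ⊗ₜ[K] q b = 0
    rw [hb, TensorProduct.tmul_zero]
  have h2 : MonoidAlgebra.mapDomain (mapChar L q') a = 0 := by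
    -- `mapChar q'` factors through `mapChar q` as a map of sets, which is enough for group
    -- algebras.
    have h3 : (mapChar L q' : CharGroup K L B → CharGroup K L C') =
        Function.extend (mapChar L q) (mapChar L q') 1 ∘ mapChar L q :=
      (hfac.extend_comp _).symm
    have h4 (g : CharGroup K L C → CharGroup K L C') :
        MonoidAlgebra.mapDomain (g ∘ mapChar L q) a =
          MonoidAlgebra.mapDomain g (MonoidAlgebra.mapDomain (mapChar L q) a) :=
      congrArg MonoidAlgebra.ofCoeff Finsupp.mapDomain_comp
    rw [h3, h4, h1, MonoidAlgebra.mapDomain_zero]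
  have h3 := charHom_mapDomain q' a
  rw [mapDomainBialgHom_eq, h2, map_zero, ha] at h3
  exact one_tmul_injective K L (L ≃ₐ[K] L) C' (h3.symm.trans (TensorProduct.tmul_zero _ _).symm)

lemma mapChar_eq_one_of_ker_le (q : B →ₐc[K] C) (hq : Function.Surjective q) (q' : B →ₐc[K] C')
    (h : RingHom.ker ((q : B →ₐ[K] C) : B →+* C) ≤ RingHom.ker ((q' : B →ₐ[K] C') : B →+* C'))
    (χ : CharGroup K L B) (hχ : mapChar L q χ = 1) : mapChar L q' χ = 1 := by
  let ql : B →ₗ[K] C := (q : B →ₐ[K] C).toLinearMap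
  obtain ⟨t, ht⟩ := LinearMap.exists_rightInverse_of_surjective ql
    (by rw [LinearMap.range_eq_top]; exact hq)
  let s : C →ₗ[K] C' := (q' : B →ₐ[K] C').toLinearMap ∘ₗ t
  have hs (b : B) : s (q b) = q' b := by
    have h1 : t (q b) - b ∈ RingHom.ker ((q : B →ₐ[K] C) : B →+* C) := by
      rw [RingHom.mem_ker, map_sub, sub_eq_zero]
      exact LinearMap.congr_fun ht (q b)
    have h2 := h h1
    rw [RingHom.mem_ker, map_sub, sub_eq_zero] at h2
    exact h2
  have hv (v : L ⊗[K] B) : Bialgebra.TensorProduct.map (BialgHom.id L L) q' v =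
      LinearMap.lTensor L s (Bialgebra.TensorProduct.map (BialgHom.id L L) q v) := by
    induction v with
    | zero => simp only [map_zero]
    | add a b ha hb => simp only [map_add, ha, hb]
    | tmul l b =>
      change l ⊗ₜ[K] q' b = l ⊗ₜ[K] s (q b)
      rw [hs]
  refine GroupLike.val_injective ?_
  rw [val_mapChar, hv, ← val_mapChar, hχ, ← map_one (mapChar L q), val_mapChar, ← hv,
    ← val_mapChar, map_one]

lemma mapChar_surjective (hB : IsTorusSplitBy K L B) (q : B →ₐc[K] C)
    (hq : Function.Surjective q) : Function.Surjective (mapChar L q) := by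
  intro ψ
  have h1 : Function.Surjective (Bialgebra.TensorProduct.map (BialgHom.id L L) q) := by
    intro v
    induction v with
    | zero => exact ⟨0, map_zero _⟩
    | add a b ha hb =>
      obtain ⟨a, rfl⟩ := ha
      obtain ⟨b, rfl⟩ := hb
      exact ⟨a + b, map_add _ _ _⟩
    | tmul l c =>
      obtain ⟨b, rfl⟩ := hq c
      exact ⟨l ⊗ₜ b, rfl⟩
  obtain ⟨v, hv⟩ := h1 ψ.val
  obtain ⟨a, rfl⟩ := charHom_surjective hB v
  rw [← charHom_mapDomain, mapDomainBialgHom_eq] at hv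
  have h2 : MonoidAlgebra.mapDomain (mapChar L q) a = .single ψ 1 := by
    apply charHom_injective
    rw [hv, charHom_single, one_smul]
  classical
  have h3 : ψ ∈ (Finsupp.mapDomain (mapChar L q) a.coeff).support := by
    have h4 := congrArg (fun b => MonoidAlgebra.coeff b ψ) h2
    have h5 : Finsupp.mapDomain (mapChar L q) a.coeff ψ = 1 := by
      simpa using h4
    rw [Finsupp.mem_support_iff, h5]
    exact one_ne_zero
  obtain ⟨χ, -, hχ⟩ := Finset.mem_image.mp (Finsupp.mapDomain_support h3)
  exact ⟨χ, hχ⟩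

lemma injective_of_mapChar [FiniteDimensional K L] [IsGalois K L] (hB : IsTorusSplitBy K L B)
    (φ : B →ₐc[K] C) (h : Function.Injective (mapChar L φ)) : Function.Injective φ := by
  intro b b' hb
  obtain ⟨a, ha⟩ := charHom_surjective hB (1 ⊗ₜ b)
  obtain ⟨a', ha'⟩ := charHom_surjective hB (1 ⊗ₜ b')
  refine one_tmul_injective K L (L ≃ₐ[K] L) B (ha.symm.trans (Eq.trans ?_ ha'))
  congr 1
  refine MonoidAlgebra.mapDomain_injective h ?_
  rw [← mapDomainBialgHom_eq, ← mapDomainBialgHom_eq]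
  apply charHom_injective
  rw [charHom_mapDomain, charHom_mapDomain, ha, ha']
  change (1 : L) ⊗ₜ[K] φ b = 1 ⊗ₜ φ b'
  rw [hb]

lemma mapChar_injective (φ : B →ₐc[K] C) (h : Function.Injective φ) :
    Function.Injective (mapChar L φ) := by
  intro χ χ' hχ
  have h1 := congrArg GroupLike.val hχ
  exact GroupLike.val_injective (Module.Flat.lTensor_preserves_injective_linearMap (M := L)
    (φ : B →ₐ[K] C).toLinearMap h h1)

end Kernels

/-! ### Isogenies -/

section Isogeny

variable {K L B C : Type u} [Field K] [Field L] [Algebra K L] [FiniteDimensional K L]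
  [IsGalois K L] [CommRing B] [HopfAlgebra K B] [CommRing C] [HopfAlgebra K C]

/-- A homomorphism of tori that makes the character group of the target a subgroup of finite
exponent in that of the source is an isogeny: the coordinate ring of the source is a finite module
over that of the target. -/
lemma isIsogeny_of_mapChar (hB : IsTorusSplitBy K L B) (hC : IsTorusSplitBy K L C)
    (φ : B →ₐc[K] C) (hinj : Function.Injective (mapChar L φ)) {n : ℕ} (hn : n ≠ 0)
    (hexp : ∀ ψ : CharGroup K L C, ∃ χ, mapChar L φ χ = ψ ^ n) : IsIsogeny φ := by
  have hφ := injective_of_mapChar hB φ hinj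
  -- `C` is integral over `B`: after extension to `L` it is generated by characters, whose `n`-th
  -- powers come from `B`, and `L ⊗ B` is integral over `B`.
  let _ : Algebra B C := ((φ : B →ₐ[K] C) : B →+* C).toAlgebra
  have : IsScalarTower K B C := IsScalarTower.of_algebraMap_eq fun x =>
    (AlgHom.commutes (φ : B →ₐ[K] C) x).symm
  let ΦL : L ⊗[K] B →ₐ[L] L ⊗[K] C :=
    (Bialgebra.TensorProduct.map (BialgHom.id L L) φ : L ⊗[K] B →ₐ[L] L ⊗[K] C)
  have hΦ : (ΦL : L ⊗[K] B →+* L ⊗[K] C).IsIntegral := by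
    intro v
    obtain ⟨a, rfl⟩ := charHom_surjective hC v
    induction a using MonoidAlgebra.induction_linear with
    | zero => rw [map_zero]; exact RingHom.isIntegralElem_zero _
    | add a b ha hb => rw [map_add]; exact ha.add _ hb
    | single ψ l =>
      have h1 : (ΦL : L ⊗[K] B →+* L ⊗[K] C).IsIntegralElem ψ.val := by
        obtain ⟨χ, hχ⟩ := hexp ψ
        have h2 : ψ.val ^ n = (ΦL : L ⊗[K] B →+* L ⊗[K] C) χ.val := by
          rw [← GroupLike.val_pow, ← hχ]
          rfl
        let _ : Algebra (L ⊗[K] B) (L ⊗[K] C) := (ΦL : L ⊗[K] B →+* L ⊗[K] C).toAlgebra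
        refine IsIntegral.of_pow (R := L ⊗[K] B) (Nat.pos_of_ne_zero hn) ?_
        rw [h2]
        exact isIntegral_algebraMap
      have h2 : charHom K L C (.single ψ l) =
          (ΦL : L ⊗[K] B →+* L ⊗[K] C) (algebraMap L _ l) * ψ.val := by
        rw [charHom_single, Algebra.smul_def]
        congr 1
        exact (ΦL.commutes l).symm
      rw [h2]
      exact (RingHom.isIntegralElem_map _).mul _ h1
  have hincl : ((Algebra.TensorProduct.includeRight : B →ₐ[K] L ⊗[K] B) :
      B →+* L ⊗[K] B).IsIntegral := by
    intro v
    induction v with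
    | zero => exact RingHom.isIntegralElem_zero _
    | add a b ha hb => exact ha.add _ hb
    | tmul l b =>
      have h1 : (l ⊗ₜ[K] b : L ⊗[K] B) = (l ⊗ₜ 1) * (1 ⊗ₜ b) := by
        rw [Algebra.TensorProduct.tmul_mul_tmul, mul_one, one_mul]
      rw [h1]
      refine RingHom.IsIntegralElem.mul _ ?_ (RingHom.isIntegralElem_map _)
      let _ : Algebra B (L ⊗[K] B) := ((Algebra.TensorProduct.includeRight : B →ₐ[K] L ⊗[K] B) :
        B →+* L ⊗[K] B).toAlgebra
      have : IsScalarTower K B (L ⊗[K] B) := IsScalarTower.of_algebraMap_eq fun x =>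
        ((Algebra.TensorProduct.includeRight : B →ₐ[K] L ⊗[K] B).commutes x).symm
      exact ((Algebra.IsIntegral.isIntegral (R := K) l).map
        (Algebra.TensorProduct.includeLeft : L →ₐ[K] L ⊗[K] B)).tower_top (A := B)
  have hint : Algebra.IsIntegral B C := by
    have h1 : ((Algebra.TensorProduct.includeRight : C →ₐ[K] L ⊗[K] C) : C →+* L ⊗[K] C).comp
        ((φ : B →ₐ[K] C) : B →+* C) = (ΦL : L ⊗[K] B →+* L ⊗[K] C).comp
        ((Algebra.TensorProduct.includeRight : B →ₐ[K] L ⊗[K] B) : B →+* L ⊗[K] B) :=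
      RingHom.ext fun _ => rfl
    refine ⟨RingHom.IsIntegral.tower_bot _ ((Algebra.TensorProduct.includeRight :
      C →ₐ[K] L ⊗[K] C) : C →+* L ⊗[K] C) (one_tmul_injective K L (L ≃ₐ[K] L) C) ?_⟩
    exact h1 ▸ hincl.trans _ _ hΦ
  have hft : Algebra.FiniteType K C := by
    have := smooth_of_isTorusSplitBy hC
    infer_instance
  have : Algebra.FiniteType B C := Algebra.FiniteType.of_restrictScalars_finiteType K B C
  have hfin : Module.Finite B C := Algebra.IsIntegral.finite
  have : FaithfulSMul B C := (faithfulSMul_iff_algebraMap_injective B C).mpr hφ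
  -- Surjectivity is lying over, and the kernel is the fibre of a finite morphism.
  refine ⟨Algebra.IsIntegral.comap_surjective B C, ?_⟩
  obtain ⟨s, hs⟩ := hfin.fg_top
  classical
  refine ⟨⟨s.image (Ideal.Quotient.mk _), ?_⟩⟩
  rw [eq_top_iff]
  rintro x -
  obtain ⟨x, rfl⟩ := Ideal.Quotient.mk_surjective x
  have hx : x ∈ Submodule.span B (s : Set C) := by rw [hs]; trivial
  induction hx using Submodule.span_induction with
  | zero => rw [map_zero]; exact Submodule.zero_mem _
  | add a b _ _ ha hb => rw [map_add]; exact Submodule.add_mem _ ha hb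
  | mem c hc =>
    exact Submodule.subset_span (by simpa using ⟨c, hc, rfl⟩)
  | smul b c _ h =>
    have h1 : Ideal.Quotient.mk (Ideal.map ((φ : B →ₐ[K] C) : B →+* C)
        (RingHom.ker (Bialgebra.counitAlgHom K B))) (b • c) =
        Coalgebra.counit (R := K) b • Ideal.Quotient.mk _ c := by
      change _ = Ideal.Quotient.mk _ (Coalgebra.counit (R := K) b • c)
      rw [Ideal.Quotient.eq, Algebra.smul_def, Algebra.smul_def, ← sub_mul,
        IsScalarTower.algebraMap_apply K B C, ← map_sub]
      refine Ideal.mul_mem_right _ _ (Ideal.mem_map_of_mem _ ?_)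
      rw [RingHom.mem_ker, map_sub, AlgHom.commutes]
      exact sub_self _
    rw [h1]
    exact Submodule.smul_mem _ _ h

end Isogeny

/-! ### Stable subgroups of the character group and the norm of inertia -/

section Norm

variable {K L B : Type u} [Field K] [Field L] [Algebra K L] [CommRing B] [HopfAlgebra K B]

/-- The action of the Galois group on a stable subgroup of the character group. -/
def galSub (Y : Subgroup (CharGroup K L B))
    (hY : ∀ (σ : L ≃ₐ[K] L), ∀ χ ∈ Y, galChar K L B σ χ ∈ Y) : (L ≃ₐ[K] L) →* MulAut Y where
  toFun σ :=
    { toFun := fun χ => ⟨galChar K L B σ χ, hY σ χ χ.2⟩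
      invFun := fun χ => ⟨galChar K L B σ⁻¹ χ, hY σ⁻¹ χ χ.2⟩
      left_inv := fun χ => Subtype.ext (by
        change galChar K L B σ⁻¹ (galChar K L B σ χ) = χ
        rw [← MulAut.mul_apply, ← map_mul, inv_mul_cancel, map_one, MulAut.one_apply])
      right_inv := fun χ => Subtype.ext (by
        change galChar K L B σ (galChar K L B σ⁻¹ χ) = χ
        rw [← MulAut.mul_apply, ← map_mul, mul_inv_cancel, map_one, MulAut.one_apply])
      map_mul' := fun χ χ' => Subtype.ext (map_mul _ _ _) }
  map_one' := MulEquiv.ext fun χ => Subtype.ext (by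
    change galChar K L B 1 χ = χ
    rw [map_one, MulAut.one_apply])
  map_mul' σ τ := MulEquiv.ext fun χ => Subtype.ext (by
    change galChar K L B (σ * τ) χ = galChar K L B σ (galChar K L B τ χ)
    rw [map_mul, MulAut.mul_apply])

lemma free_subgroup (hB : IsTorusSplitBy K L B) (Y : Subgroup (CharGroup K L B)) :
    Module.Free ℤ (Additive Y) ∧ Module.Finite ℤ (Additive Y) := by
  have := charGroup_free hB
  have := charGroup_finite hB
  let f : Additive Y →ₗ[ℤ] Additive (CharGroup K L B) :=
    (MonoidHom.toAdditive Y.subtype).toIntLinearMap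
  have hf : Function.Injective f := Y.subtype_injective
  let e := LinearEquiv.ofInjective f hf
  exact ⟨Module.Free.of_equiv e.symm, Module.Finite.of_injective f hf⟩

lemma galChar_mem_invariantChars {I : Subgroup (L ≃ₐ[K] L)} [hI : I.Normal] (σ : L ≃ₐ[K] L)
    (χ : CharGroup K L B) (hχ : χ ∈ invariantChars B I) :
    galChar K L B σ χ ∈ invariantChars B I := by
  rw [mem_invariantChars] at hχ ⊢
  intro τ hτ
  have h1 : τ * σ = σ * (σ⁻¹ * τ * σ) := by group
  rw [← MulAut.mul_apply, ← map_mul, h1, map_mul, MulAut.mul_apply,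
    hχ _ (by simpa using hI.conj_mem τ hτ σ⁻¹)]

variable [FiniteDimensional K L]

variable (B) in
/-- The norm of a group of Galois automorphisms on characters. -/
def charNorm (I : Subgroup (L ≃ₐ[K] L)) : CharGroup K L B →* CharGroup K L B :=
  letI := Fintype.ofFinite I
  ∏ σ : I, (galChar K L B σ : CharGroup K L B →* CharGroup K L B)

lemma map_charNorm {X : Type*} [CommGroup X] (I : Subgroup (L ≃ₐ[K] L))
    (r : CharGroup K L B →* X) (hr : ∀ σ ∈ I, ∀ χ, r (galChar K L B σ χ) = r χ)
    (χ : CharGroup K L B) : r (charNorm B I χ) = r χ ^ Nat.card I := by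
  let _ := Fintype.ofFinite I
  rw [charNorm, MonoidHom.finsetProd_apply, map_prod,
    Finset.prod_congr rfl (fun σ _ => hr σ.1 σ.2 χ), Finset.prod_const, Finset.card_univ,
    Nat.card_eq_fintype_card]

lemma galChar_charNorm_of_mem (I : Subgroup (L ≃ₐ[K] L)) {τ : L ≃ₐ[K] L} (hτ : τ ∈ I)
    (χ : CharGroup K L B) : galChar K L B τ (charNorm B I χ) = charNorm B I χ := by
  let _ := Fintype.ofFinite I
  rw [charNorm, MonoidHom.finsetProd_apply, map_prod]
  refine Fintype.prod_equiv (Equiv.mulLeft (⟨τ, hτ⟩ : I)) _ _ fun σ => ?_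
  change galChar K L B τ (galChar K L B σ χ) = galChar K L B (τ * σ) χ
  rw [map_mul, MulAut.mul_apply]

lemma charNorm_galChar (I : Subgroup (L ≃ₐ[K] L)) [I.Normal] (τ : L ≃ₐ[K] L)
    (χ : CharGroup K L B) :
    charNorm B I (galChar K L B τ χ) = galChar K L B τ (charNorm B I χ) := by
  let _ := Fintype.ofFinite I
  rw [charNorm, MonoidHom.finsetProd_apply, MonoidHom.finsetProd_apply, map_prod]
  refine (Fintype.prod_equiv (MulAut.conjNormal τ : I ≃* I).toEquiv _ _ fun σ => ?_).symm
  change galChar K L B τ (galChar K L B σ χ) =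
    galChar K L B (MulAut.conjNormal τ σ : I) (galChar K L B τ χ)
  rw [MulAut.conjNormal_apply, ← MulAut.mul_apply, ← MulAut.mul_apply, ← map_mul, ← map_mul,
    inv_mul_cancel_right]

lemma charNorm_mem (I : Subgroup (L ≃ₐ[K] L)) (χ : CharGroup K L B) :
    charNorm B I χ ∈ invariantChars B I :=
  mem_invariantChars.mpr fun _ hσ => galChar_charNorm_of_mem I hσ χ

lemma charNorm_eq_pow (I : Subgroup (L ≃ₐ[K] L)) {χ : CharGroup K L B}
    (hχ : χ ∈ invariantChars B I) : charNorm B I χ = χ ^ Nat.card I := by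
  rw [mem_invariantChars] at hχ
  let _ := Fintype.ofFinite I
  rw [charNorm, MonoidHom.finsetProd_apply,
    Finset.prod_congr rfl (fun σ _ => hχ σ.1 σ.2), Finset.prod_const, Finset.card_univ,
    Nat.card_eq_fintype_card]

end Norm

/-! ### The maximal subtorus with good reduction and the invariant factor torus -/

section Main

variable {O K L B : Type u} [CommRing O] [IsDomain O] [IsDiscreteValuationRing O]
  [IsAdicComplete (IsLocalRing.maximalIdeal O) O] [Finite (IsLocalRing.ResidueField O)]
  [Field K] [Algebra O K] [IsFractionRing O K] [Field L] [Algebra K L]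
  [Algebra O L] [IsScalarTower O K L] [FiniteDimensional K L] [IsGalois K L]
  [CommRing B] [HopfAlgebra K B] (P : Ideal (integralClosure O L)) [hP : P.IsMaximal]

/-- The maximal subtorus with good reduction belongs to the image of the norm of inertia; the
characters that it kills are those of norm one. -/
lemma exists_isMaximalGoodSubtorus (hB : IsTorusSplitBy K L B) :
    ∃ (C : Type u) (_ : CommRing C) (_ : HopfAlgebra K C) (q : B →ₐc[K] C),
      IsMaximalGoodSubtorus O L q ∧
        ∀ χ, mapChar L q χ = 1 → charNorm B (P.inertia (L ≃ₐ[K] L)) χ = 1 := by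
  have := isLocalRing_integralClosure O K L
  have := normal_inertia (K := K) P
  let I := P.inertia (L ≃ₐ[K] L)
  let Y : Subgroup (CharGroup K L B) := (charNorm B I).range
  have hY (σ : L ≃ₐ[K] L) (χ) (hχ : χ ∈ Y) : galChar K L B σ χ ∈ Y := by
    obtain ⟨χ, rfl⟩ := hχ
    exact ⟨galChar K L B σ χ, charNorm_galChar I σ χ⟩
  obtain ⟨_, _⟩ := free_subgroup hB Y
  let ρ := galSub Y hY
  let θ : CharGroup K L B →* Y := (charNorm B I).rangeRestrict
  have hθ (σ χ) : θ (galChar K L B σ χ) = ρ σ (θ χ) := Subtype.ext (charNorm_galChar I σ χ)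
  let q := homOfChar hB θ hθ
  have hq (χ) (h : mapChar L q χ = 1) : charNorm B I χ = 1 := by
    have h1 := torusChar_homOfChar hB θ hθ χ
    rw [show mapChar L (homOfChar hB θ hθ) χ = 1 from h, map_one] at h1
    exact (congrArg Subtype.val h1).symm
  have hC : IsTorusSplitBy K L (TorusAlg K L ρ) := isTorusSplitBy_torusAlg ρ
  refine ⟨TorusAlg K L ρ, _, _, q, ⟨?_, hC, ?_, fun C' _ _ q' hq' hC' hgood => ?_⟩, hq⟩
  · exact homOfChar_surjective hB θ hθ (charNorm B I).rangeRestrict_surjective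
  · refine hasGoodReduction_of_galAct_eq hC P fun σ hσ ψ => ?_
    have h1 : galChar K L _ σ ψ = ψ := by
      apply (torusChar ρ).injective
      rw [torusChar_galChar]
      obtain ⟨χ, hχ⟩ := (torusChar ρ ψ).2
      refine Subtype.ext ?_
      change galChar K L B σ (torusChar ρ ψ : Y) = _
      rw [← hχ, galChar_charNorm_of_mem I hσ]
    exact congrArg GroupLike.val h1
  · refine ker_le_ker_of_mapChar (L := L) hB q q' fun χ hχ => ?_
    -- If `C'` has good reduction, the `|I|`-th power of the restriction of `χ` to it is the
    -- restriction of the norm of `χ`, which is trivial.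
    refine charGroup_eq_one_of_pow hC' (n := Nat.card I) Nat.card_pos.ne' ?_
    rw [← map_charNorm I (mapChar L q') (fun σ hσ χ => ?_), hq χ hχ, map_one]
    rw [mapChar_galChar]
    exact GroupLike.val_injective (galAct_eq_of_hasGoodReduction hC' hgood P σ hσ _)

lemma exists_isInvariantFactorTorus (hB : IsTorusSplitBy K L B) (I : Subgroup (L ≃ₐ[K] L))
    [I.Normal] : ∃ (D : Type u) (_ : CommRing D) (_ : HopfAlgebra K D) (j : D →ₐc[K] B),
      IsInvariantFactorTorus I j := by
  let Y : Subgroup (CharGroup K L B) := invariantChars B I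
  have hY (σ : L ≃ₐ[K] L) (χ) (hχ : χ ∈ Y) : galChar K L B σ χ ∈ Y :=
    galChar_mem_invariantChars σ χ hχ
  obtain ⟨_, _⟩ := free_subgroup hB Y
  let ρ := galSub Y hY
  have hθ (σ) (y : Y) : Y.subtype (ρ σ y) = galChar K L B σ (Y.subtype y) := rfl
  have hj (ψ) : charPullback (homToChar hB Y.subtype hθ) ψ = (torusChar ρ ψ : CharGroup K L B) :=
    mapChar_homToChar hB Y.subtype hθ ψ
  refine ⟨TorusAlg K L ρ, _, _, homToChar hB Y.subtype hθ,
    homToChar_injective hB Y.subtype hθ Y.subtype_injective, isTorusSplitBy_torusAlg ρ, ?_⟩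
  ext χ
  constructor
  · rintro ⟨ψ, rfl⟩
    rw [hj]
    exact (torusChar ρ ψ).2
  · intro hχ
    refine ⟨(torusChar ρ).symm ⟨χ, hχ⟩, ?_⟩
    rw [hj, MulEquiv.apply_symm_apply]

/-- The composite of the inclusion of the maximal subtorus with good reduction and the projection
to the invariant factor torus is an isogeny. -/
lemma isIsogeny_comp {C D : Type u} [CommRing C] [HopfAlgebra K C] [CommRing D] [HopfAlgebra K D]
    (hB : IsTorusSplitBy K L B) {q : B →ₐc[K] C} {j : D →ₐc[K] B}
    (hq : IsMaximalGoodSubtorus O L q)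
    (hj : IsInvariantFactorTorus (P.inertia (L ≃ₐ[K] L)) j) : IsIsogeny (q.comp j) := by
  let I := P.inertia (L ≃ₐ[K] L)
  have hI : Nat.card I ≠ 0 := Nat.card_pos.ne'
  -- The subtorus `q` contains the image of the norm, so a character trivial on it has norm one.
  obtain ⟨C₀, _, _, q₀, hq₀, hnorm⟩ := exists_isMaximalGoodSubtorus (O := O) (K := K) P hB
  refine isIsogeny_of_mapChar (L := L) hj.isTorus hq.isTorus _ ?_ hI fun ψ => ?_
  · rw [injective_iff_map_eq_one]
    intro χ hχ
    rw [mapChar_comp] at hχ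
    have h1 : mapChar L j χ ∈ invariantChars B I := by
      have : charPullback j χ ∈ (invariantChars B I : Set (CharGroup K L B)) :=
        hj.range_eq ▸ ⟨χ, rfl⟩
      exact this
    have h2 := mapChar_eq_one_of_ker_le q hq.surjective q₀
      (hq.le C₀ q₀ hq₀.surjective hq₀.isTorus hq₀.good) _ hχ
    have h3 := hnorm _ h2
    rw [charNorm_eq_pow I h1] at h3
    refine mapChar_injective j hj.injective ?_
    rw [charGroup_eq_one_of_pow hB hI h3, map_one]
  · obtain ⟨χ, rfl⟩ := mapChar_surjective hB q hq.surjective ψ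
    have h1 : charNorm B I χ ∈ Set.range (charPullback (L := L) j) := by
      rw [hj.range_eq]
      exact charNorm_mem I χ
    obtain ⟨ψ, hψ⟩ := h1
    refine ⟨ψ, ?_⟩
    rw [mapChar_comp, show mapChar L j ψ = charNorm B I χ from hψ]
    refine map_charNorm I (mapChar L q) (fun σ hσ χ => ?_) χ
    rw [mapChar_galChar]
    exact GroupLike.val_injective (galAct_eq_of_hasGoodReduction hq.isTorus hq.good P σ hσ _)

end Main

end AlgTorus
end

theorem mainTheorem7 {K L B : Type u} [Field K] [ValuativeRel K] [TopologicalSpace K]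
    [IsNonarchimedeanLocalField K] [Field L] [Algebra K L] [FiniteDimensional K L] [IsGalois K L]
    [CommRing B] [HopfAlgebra K B] (hB : AlgTorus.IsTorusSplitBy K L B)
    (P : Ideal (integralClosure 𝒪[K] L)) (hP : P.IsMaximal) :
    (∃ (C : Type u) (_ : CommRing C) (_ : HopfAlgebra K C) (q : B →ₐc[K] C),
      AlgTorus.IsMaximalGoodSubtorus 𝒪[K] L q) ∧
    (∃ (D : Type u) (_ : CommRing D) (_ : HopfAlgebra K D) (j : D →ₐc[K] B),
      AlgTorus.IsInvariantFactorTorus (P.inertia (L ≃ₐ[K] L)) j) ∧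
    ∀ (C : Type u) [CommRing C] [HopfAlgebra K C] (q : B →ₐc[K] C)
      (D : Type u) [CommRing D] [HopfAlgebra K D] (j : D →ₐc[K] B),
      AlgTorus.IsMaximalGoodSubtorus 𝒪[K] L q →
      AlgTorus.IsInvariantFactorTorus (P.inertia (L ≃ₐ[K] L)) j →
      AlgTorus.IsIsogenous K C D := by
  have : IsAdicComplete (IsLocalRing.maximalIdeal 𝒪[K]) 𝒪[K] := by
    let _ := IsTopologicalAddGroup.rightUniformSpace K
    have := isUniformAddGroup_of_addCommGroup (G := K)
    infer_instance
  have := AlgTorus.isLocalRing_integralClosure 𝒪[K] K L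
  have := AlgTorus.normal_inertia (K := K) P
  refine ⟨?_, AlgTorus.exists_isInvariantFactorTorus hB _, ?_⟩
  · obtain ⟨C, _, _, q, hq, -⟩ := AlgTorus.exists_isMaximalGoodSubtorus (K := K) P hB
    exact ⟨C, _, _, q, hq⟩
  · intro C _ _ q D _ _ j hq hj
    exact ⟨_, AlgTorus.isIsogeny_comp P hB hq hj⟩
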